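/- Let $k$ be a field, $r\ge 0$ an integer, and let $A=\bigoplus_{g\in\mathbb Z^{r+1}}A_g$ be a (left and right) noetherian, connected $\mathbb Z^{r+1}$-graded $k$-algebra, where connected means that $A_g=0$ unless $g\in\mathbb N^{r+1}$ and that $A_0=k$. Let $\tau=\{\tau_g\mid g\in\mathbb Z^{r+1}\}$ be a normalized left twisting system on $A$: a family of $k$-linear automorphisms of $A$ preserving the grading, such that $\tau_{g''}(\tau_{g'}(a)a')=\tau_{g'+g''}(a)\,\tau_{g''}(a')$ for all $g,g',g''\in\mathbb Z^{r+1}$, $a\in A_g$, $a'\in A_{g'}$, and $\tau_0(1)=1$. Let ${}^\tau\!A$ be the corresponding Zhang twist of $A$: the same graded vector space with the product $a\circ a'=\tau_{g'}(a)a'$ for $a\in A$, $a'\in A_{g'}$. For an algebra $B$ graded by an abelian group $G$ (here $G=\mathbb Z^{r+1}$ or $G=\mathbb Z$), let $\mathfrak m$ be the two-sided ideal generated by the homogeneous elements of nonzero degree and let $k=B/\mathfrak m$ be the trivial module (the algebras considered here being connected). For a graded left $B$-module $M$, let $M[g]$ be its shift, $M[g]_{g'}=M_{g'+g}$, let $H^i_{\mathfrak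 m}$ be the right derived functors, on the category of graded left $B$-modules, of $M\mapsto\{x\in M\mid \mathfrak m^n x=0 \text{ for } n\gg 0\}$, and let $\underline{\mathrm{Ext}}^i_B(k,B)=\bigoplus_{g\in G}\mathrm{Ext}^i(k,B[g])$, where $\mathrm{Ext}$ is computed in the category of graded left $B$-modules; it is a graded right $B$-module. Then: * $B$ is AS-Cohen--Macaulay if there is $n\in\mathbb N$ such that $H^i_{\mathfrak m}(B)=0$ and $H^i_{\mathfrak m^{\mathrm{opp}}}(B^{\mathrm{opp}})=0$ for all $i\neq n$; * $B$ is AS-Gorenstein if there are $n\in\mathbb N$ and $\ell\in G$ such that, for both $C=B$ and $C=B^{\mathrm{opp}}$, the graded injective dimension of the left module $C$ is $n$, $\underline{\mathrm{Ext}}^i_C(k,C)=0$ for $i\neq n$, and $\underline{\mathrm{Ext}}^n_C(k,C)\cong k[\ell]$ as graded right $C$-modules; * $B$ is AS-regular if it is AS-Gorenstein and its left and right graded global dimensions are finite and equal. Then, when $A$ and ${}^\tau\!A$ are regarded as $\mathbb N$-graded (that is, $\mathbb Z$-graded) algebras through the total degree $\mathbb Z^{r+1}\to\mathbb Z$, $(a_0,\dots,a_r)\mapsto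 a_0+\dots+a_r$: 1. $A$ is AS-Cohen--Macaulay if and only if ${}^\tau\!A$ is AS-Cohen--Macaulay; 2. $A$ is AS-Gorenstein if and only if ${}^\tau\!A$ is AS-Gorenstein; 3. $A$ is AS-regular if and only if ${}^\tau\!A$ is AS-regular. The same three equivalences hold when the properties of $A$ and ${}^\tau\!A$ are taken with respect to their $\mathbb Z^{r+1}$-gradings. -/

import Mathlib

universe v u

set_option linter.unusedSectionVars false

noncomputable section

open CategoryTheory CategoryTheory.Limits

/-! ### The category of graded modules -/

/-- Elementary criterion: subgroups `gr g` that span `M` and are separated by additive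
"projections" `p g` form a direct sum decomposition of `M`. -/
theorem isInternal_of_proj {G M : Type*} [DecidableEq G] [AddCommGroup M]
    {σ : Type*} [SetLike σ M] [AddSubgroupClass σ M] (gr : G → σ) (p : G → M →+ M)
    (same : ∀ g, ∀ x ∈ gr g, p g x = x)
    (ne : ∀ g h, ∀ x ∈ gr h, h ≠ g → p g x = 0)
    (top : ∀ x, x ∈ AddSubgroup.closure {y : M | ∃ g, y ∈ gr g}) : DirectSum.IsInternal gr := by
  have key : ∀ (d : DirectSum G fun g => gr g) (g : G),
      p g (DirectSum.coeAddMonoidHom gr d) = d g := by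
    intro d g
    induction d using DirectSum.induction_on with
    | zero => simp
    | of h x =>
      rw [DirectSum.coeAddMonoidHom_of]
      by_cases hg : h = g
      · subst hg; simp [same h x x.2]
      · rw [ne g h x x.2 hg, DirectSum.of_eq_of_ne _ _ _ (Ne.symm hg)]; rfl
    | add x y hx hy => simp [map_add, hx, hy]
  refine ⟨?_, fun x => ?_⟩
  · intro d e hde
    ext g
    rw [← key, ← key]
    exact congrArg _ hde
  · induction top x using AddSubgroup.closure_induction with
    | mem x hx =>
      obtain ⟨g, hg⟩ := hx
      exact ⟨DirectSum.of (fun g => gr g) g ⟨x, hg⟩, DirectSum.coeAddMonoidHom_of _ _ _⟩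
    | zero => exact ⟨0, map_zero _⟩
    | add x y _ _ hx hy =>
      obtain ⟨d, rfl⟩ := hx
      obtain ⟨e, rfl⟩ := hy
      exact ⟨d + e, map_add _ _ _⟩
    | neg x _ hx =>
      obtain ⟨d, rfl⟩ := hx
      exact ⟨-d, map_neg _ _⟩

variable {G : Type} [AddCommGroup G] [DecidableEq G]
variable {k : Type v} [Field k] {A : Type u} [Ring A] [Algebra k A]

/-- A `G`-graded left module over the `G`-graded `k`-algebra `A = ⨁ 𝒜 g`.  (Since `k ⊆ 𝒜 0`, the
homogeneous components are automatically `k`-subspaces.) -/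
structure GrMod (𝒜 : G → Submodule k A) where
  carrier : Type u
  [addCommGroup : AddCommGroup carrier]
  [module : Module A carrier]
  gr : G → AddSubgroup carrier
  isInternal : DirectSum.IsInternal gr
  smul_mem : ∀ {g h : G} {a : A} {m : carrier}, a ∈ 𝒜 g → m ∈ gr h → a • m ∈ gr (g + h)

namespace GrMod

variable {𝒜 : G → Submodule k A}

instance : CoeSort (GrMod 𝒜) (Type u) := ⟨GrMod.carrier⟩
instance (M : GrMod 𝒜) : AddCommGroup M := M.addCommGroup
instance (M : GrMod 𝒜) : Module A M := M.module

/-- The projection onto the component of degree `g`. -/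
def proj (M : GrMod 𝒜) (g : G) : M →+ M :=
  letI := M.isInternal.chooseDecomposition
  (M.gr g).subtype.comp
    ((DFinsupp.evalAddMonoidHom g).comp (DirectSum.decomposeAddEquiv M.gr).toAddMonoidHom)

theorem proj_mem (M : GrMod 𝒜) (g : G) (x : M) : M.proj g x ∈ M.gr g := Subtype.prop _

theorem proj_same (M : GrMod 𝒜) {g : G} {x : M} (hx : x ∈ M.gr g) : M.proj g x = x :=
  letI := M.isInternal.chooseDecomposition
  DirectSum.decompose_of_mem_same M.gr hx

theorem proj_ne (M : GrMod 𝒜) {g h : G} {x : M} (hx : x ∈ M.gr h) (hgh : h ≠ g) :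
    M.proj g x = 0 :=
  letI := M.isInternal.chooseDecomposition
  DirectSum.decompose_of_mem_ne M.gr hx hgh

theorem induction (M : GrMod 𝒜) {motive : M → Prop} (zero : motive 0)
    (homogeneous : ∀ g, ∀ m ∈ M.gr g, motive m)
    (add : ∀ m m' : M, motive m → motive m' → motive (m + m')) (m : M) : motive m :=
  letI := M.isInternal.chooseDecomposition
  DirectSum.Decomposition.inductionOn M.gr zero (fun {i} m => homogeneous i m m.2) add m

theorem sum_proj (M : GrMod 𝒜) (x : M) : ∃ s : Finset G, x = ∑ g ∈ s, M.proj g x := by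
  classical
  let := M.isInternal.chooseDecomposition
  exact ⟨_, (DirectSum.sum_support_decompose M.gr x).symm⟩

theorem eq_zero_of_proj (M : GrMod 𝒜) {x : M} (h : ∀ g, M.proj g x = 0) : x = 0 := by
  obtain ⟨s, hs⟩ := M.sum_proj x
  rw [hs]; exact Finset.sum_eq_zero fun g _ => h g

theorem mem_gr_iff (M : GrMod 𝒜) {g : G} {x : M} :
    x ∈ M.gr g ↔ ∀ h, h ≠ g → M.proj h x = 0 := by
  refine ⟨fun hx h hh => M.proj_ne hx (Ne.symm hh), fun H => ?_⟩
  have : x - M.proj g x = 0 := by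
    refine M.eq_zero_of_proj fun h => ?_
    by_cases hh : h = g
    · subst hh; rw [map_sub, M.proj_same (M.proj_mem h x), sub_self]
    · rw [map_sub, H h hh, M.proj_ne (M.proj_mem g x) (Ne.symm hh), sub_self]
  rw [sub_eq_zero.1 this]; exact M.proj_mem g x

/-- Morphisms of graded modules: `A`-linear maps of degree `0`. -/
@[ext]
structure Hom (M N : GrMod 𝒜) where
  lin : M →ₗ[A] N
  map_mem : ∀ {g : G} {m : M}, m ∈ M.gr g → lin m ∈ N.gr g

instance : Category (GrMod 𝒜) where
  Hom := Hom
  id M := ⟨LinearMap.id, id⟩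
  comp f g := ⟨g.lin.comp f.lin, fun h => g.map_mem (f.map_mem h)⟩

@[ext]
theorem hom_ext {M N : GrMod 𝒜} {f g : M ⟶ N} (h : ∀ x, f.lin x = g.lin x) : f = g :=
  Hom.ext (LinearMap.ext h)

@[simp] theorem id_lin (M : GrMod 𝒜) : Hom.lin (𝟙 M) = LinearMap.id := rfl
@[simp] theorem comp_lin {M N P : GrMod 𝒜} (f : M ⟶ N) (g : N ⟶ P) :
    (f ≫ g).lin = g.lin.comp f.lin := rfl

theorem lin_proj {M N : GrMod 𝒜} (f : M ⟶ N) (g : G) (x : M) :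
    f.lin (M.proj g x) = N.proj g (f.lin x) := by
  induction x using M.induction with
  | zero => simp
  | homogeneous h m hm =>
    by_cases hh : h = g
    · subst hh; rw [M.proj_same hm, N.proj_same (f.map_mem hm)]
    · rw [M.proj_ne hm hh, N.proj_ne (f.map_mem hm) hh, map_zero]
  | add x y hx hy => simp [map_add, hx, hy]

instance (M N : GrMod 𝒜) : Zero (M ⟶ N) := ⟨⟨0, fun _ => zero_mem _⟩⟩
instance (M N : GrMod 𝒜) : Add (M ⟶ N) :=
  ⟨fun f g => ⟨f.lin + g.lin, fun h => add_mem (f.map_mem h) (g.map_mem h)⟩⟩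
instance (M N : GrMod 𝒜) : Neg (M ⟶ N) :=
  ⟨fun f => ⟨-f.lin, fun h => neg_mem (f.map_mem h)⟩⟩
instance (M N : GrMod 𝒜) : Sub (M ⟶ N) :=
  ⟨fun f g => ⟨f.lin - g.lin, fun h => sub_mem (f.map_mem h) (g.map_mem h)⟩⟩
instance (M N : GrMod 𝒜) : SMul ℕ (M ⟶ N) :=
  ⟨fun n f => ⟨n • f.lin, fun h => nsmul_mem (f.map_mem h) n⟩⟩
instance (M N : GrMod 𝒜) : SMul ℤ (M ⟶ N) :=
  ⟨fun n f => ⟨n • f.lin, fun h => zsmul_mem (f.map_mem h) n⟩⟩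

instance (M N : GrMod 𝒜) : AddCommGroup (M ⟶ N) :=
  Function.Injective.addCommGroup (Hom.lin : (M ⟶ N) → (M →ₗ[A] N)) (fun _ _ => Hom.ext)
    rfl (fun _ _ => rfl) (fun _ => rfl) (fun _ _ => rfl) (fun _ _ => rfl) (fun _ _ => rfl)

@[simp] theorem zero_lin (M N : GrMod 𝒜) : Hom.lin (0 : M ⟶ N) = 0 := rfl
@[simp] theorem add_lin {M N : GrMod 𝒜} (f g : M ⟶ N) : (f + g).lin = f.lin + g.lin := rfl

instance : Preadditive (GrMod 𝒜) where
  add_comp _ _ _ f f' g := by ext x; simp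
  comp_add _ _ _ f g g' := by ext x; simp

/-- A submodule stable under the projections, as a graded module. -/
def ofSub (M : GrMod 𝒜) (S : Submodule A M) (hS : ∀ g, ∀ x ∈ S, M.proj g x ∈ S) : GrMod 𝒜 where
  carrier := S
  gr g := (M.gr g).comap S.subtype.toAddMonoidHom
  isInternal := isInternal_of_proj _
    (fun g => ((M.proj g).comp S.subtype.toAddMonoidHom).codRestrict S fun x => hS g x x.2)
    (fun g x hx => Subtype.ext (M.proj_same hx))
    (fun g h x hx hgh => Subtype.ext (M.proj_ne hx hgh))
    (fun x => by
      obtain ⟨s, hs⟩ := M.sum_proj x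
      have : x = ∑ g ∈ s, (⟨M.proj g x, hS g x x.2⟩ : S) := by
        apply Subtype.ext; simpa using hs
      rw [this]
      exact sum_mem fun g _ => AddSubgroup.subset_closure ⟨g, (M.proj_mem g x)⟩)
  smul_mem ha hm := M.smul_mem ha hm

/-- The quotient by a submodule stable under the projections, as a graded module. -/
def ofQuot (M : GrMod 𝒜) (S : Submodule A M) (hS : ∀ g, ∀ x ∈ S, M.proj g x ∈ S) : GrMod 𝒜 where
  carrier := M ⧸ S
  gr g := (M.gr g).map S.mkQ.toAddMonoidHom
  isInternal := isInternal_of_proj _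
    (fun g => QuotientAddGroup.lift S.toAddSubgroup (S.mkQ.toAddMonoidHom.comp (M.proj g))
      (fun x hx => (Submodule.Quotient.mk_eq_zero S).2 (hS g x hx)))
    (by
      rintro g _ ⟨x, hx, rfl⟩
      exact congrArg S.mkQ (M.proj_same hx))
    (by
      rintro g h _ ⟨x, hx, rfl⟩ hgh
      exact (congrArg S.mkQ (M.proj_ne hx hgh)).trans (map_zero _))
    (by
      intro y
      obtain ⟨x, rfl⟩ := S.mkQ_surjective y
      obtain ⟨s, hs⟩ := M.sum_proj x
      rw [hs, map_sum]
      exact sum_mem fun g _ => AddSubgroup.subset_closure ⟨g, ⟨_, M.proj_mem g x, rfl⟩⟩)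
  smul_mem := by
    rintro g h a _ ha ⟨x, hx, rfl⟩
    exact ⟨a • x, M.smul_mem ha hx, map_smul S.mkQ a x⟩

/-- The product of two graded modules. -/
def prod (M N : GrMod 𝒜) : GrMod 𝒜 where
  carrier := M × N
  gr g := (M.gr g).prod (N.gr g)
  isInternal := isInternal_of_proj _ (fun g => (M.proj g).prodMap (N.proj g))
    (fun g x hx => Prod.ext (M.proj_same hx.1) (N.proj_same hx.2))
    (fun g h x hx hgh => Prod.ext (M.proj_ne hx.1 hgh) (N.proj_ne hx.2 hgh))
    (by
      rintro ⟨x, y⟩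
      obtain ⟨s, hs⟩ := M.sum_proj x
      obtain ⟨t, ht⟩ := N.sum_proj y
      have : ((x, y) : M × N) = ∑ g ∈ s, AddMonoidHom.inl M N (M.proj g x) +
          ∑ g ∈ t, AddMonoidHom.inr M N (N.proj g y) := by
        rw [← map_sum, ← map_sum, ← hs, ← ht]; simp
      rw [this]
      exact add_mem
        (sum_mem fun g _ => AddSubgroup.subset_closure ⟨g, ⟨M.proj_mem g x, zero_mem _⟩⟩)
        (sum_mem fun g _ => AddSubgroup.subset_closure ⟨g, ⟨zero_mem _, N.proj_mem g y⟩⟩))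
  smul_mem ha hm := ⟨M.smul_mem ha hm.1, N.smul_mem ha hm.2⟩

/-- The zero graded module. -/
def zero : GrMod 𝒜 where
  carrier := PUnit
  gr _ := ⊤
  isInternal := isInternal_of_proj _ (fun _ => 0) (fun _ _ _ => rfl) (fun _ _ _ _ _ => rfl)
    (fun x => by cases x; exact zero_mem _)
  smul_mem _ _ := trivial

theorem isZero_of_subsingleton (M : GrMod 𝒜) [Subsingleton M] : IsZero M :=
  (IsZero.iff_id_eq_zero M).2 (by ext x; exact Subsingleton.elim _ _)

instance : HasZeroObject (GrMod 𝒜) :=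
  ⟨zero, haveI : Subsingleton (zero : GrMod 𝒜) := inferInstanceAs (Subsingleton PUnit)
    isZero_of_subsingleton _⟩

instance : HasBinaryProducts (GrMod 𝒜) :=
  haveI : ∀ M N : GrMod 𝒜, HasLimit (pair M N) := fun M N =>
    HasLimit.mk ⟨BinaryFan.mk (P := prod M N) ⟨LinearMap.fst A M N, fun h => h.1⟩
      ⟨LinearMap.snd A M N, fun h => h.2⟩,
      BinaryFan.isLimitMk
        (fun s => ⟨LinearMap.prod (Hom.lin s.fst) (Hom.lin s.snd),
          fun h => ⟨Hom.map_mem s.fst h, Hom.map_mem s.snd h⟩⟩)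
        (fun s => by ext x; rfl) (fun s => by ext x; rfl)
        (fun s m h₁ h₂ => by
          ext x
          exact Prod.ext (congrArg (fun f => Hom.lin f x) h₁) (congrArg (fun f => Hom.lin f x) h₂))⟩
  hasBinaryProducts_of_hasLimit_pair _

instance : HasFiniteProducts (GrMod 𝒜) :=
  haveI : HasTerminal (GrMod 𝒜) := HasZeroObject.hasTerminal
  hasFiniteProducts_of_has_binary_and_terminal

variable {M N : GrMod 𝒜} (f : M ⟶ N)

/-- The kernel of a morphism, with the induced grading. -/
def ker : GrMod 𝒜 := M.ofSub (LinearMap.ker f.lin) fun g x hx => by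
  rw [LinearMap.mem_ker] at hx ⊢
  rw [lin_proj, hx, map_zero]

/-- The inclusion of the kernel. -/
def kerι : ker f ⟶ M := ⟨(LinearMap.ker f.lin).subtype, fun h => h⟩

theorem kerι_comp : kerι f ≫ f = 0 := by ext x; exact x.2

/-- `ker f` is a kernel of `f`. -/
def kerIsLimit : IsLimit (KernelFork.ofι (kerι f) (kerι_comp f)) :=
  KernelFork.IsLimit.ofι _ _
    (fun {_} g hg => ⟨LinearMap.codRestrict _ g.lin fun x => congrArg (fun t => Hom.lin t x) hg,
      fun h => g.map_mem h⟩)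
    (fun {_} g hg => by ext x; rfl)
    (fun {_} g hg m hm => by ext x; exact Subtype.ext (congrArg (fun t => Hom.lin t x) hm))

/-- The cokernel of a morphism, with the induced grading. -/
def coker : GrMod 𝒜 := N.ofQuot (LinearMap.range f.lin) fun g x hx => by
  obtain ⟨y, rfl⟩ := hx
  exact ⟨M.proj g y, lin_proj f g y⟩

/-- The projection onto the cokernel. -/
def cokerπ : N ⟶ coker f := ⟨(LinearMap.range f.lin).mkQ, fun h => ⟨_, h, rfl⟩⟩

theorem comp_cokerπ : f ≫ cokerπ f = 0 := by
  ext x; exact (Submodule.Quotient.mk_eq_zero _).2 ⟨x, rfl⟩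

/-- `coker f` is a cokernel of `f`. -/
def cokerIsColimit : IsColimit (CokernelCofork.ofπ (cokerπ f) (comp_cokerπ f)) :=
  CokernelCofork.IsColimit.ofπ _ _
    (fun {_} g hg => ⟨(LinearMap.range f.lin).liftQ g.lin (by
        rintro _ ⟨x, rfl⟩; exact congrArg (fun t => Hom.lin t x) hg),
      by rintro _ _ ⟨x, hx, rfl⟩; exact g.map_mem hx⟩)
    (fun {_} g hg => by ext x; rfl)
    (fun {_} g hg m hm => by
      ext x
      obtain ⟨x, rfl⟩ := Submodule.mkQ_surjective _ x
      exact congrArg (fun t => Hom.lin t x) hm)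

variable {f}

theorem injective_of_mono [Mono f] : Function.Injective f.lin := by
  rw [← LinearMap.ker_eq_bot, eq_bot_iff]
  intro x hx
  have h : kerι f = 0 := by
    rw [← cancel_mono f, kerι_comp, zero_comp]
  exact congrArg (fun t => Hom.lin t (⟨x, hx⟩ : LinearMap.ker f.lin)) h

theorem surjective_of_epi [Epi f] : Function.Surjective f.lin := by
  rw [← LinearMap.range_eq_top, eq_top_iff]
  intro x _
  have h : cokerπ f = 0 := by
    rw [← cancel_epi f, comp_cokerπ, comp_zero]
  exact (Submodule.Quotient.mk_eq_zero _).1 (congrArg (fun t => Hom.lin t x) h)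

theorem mono_of_injective (h : Function.Injective f.lin) : Mono f :=
  ⟨fun a b hab => by ext x; exact h (congrArg (fun t => Hom.lin t x) hab)⟩

theorem epi_of_surjective (h : Function.Surjective f.lin) : Epi f :=
  ⟨fun a b hab => by
    ext x; obtain ⟨y, rfl⟩ := h x; exact congrArg (fun t => Hom.lin t y) hab⟩

theorem mem_gr_of_injective (hf : Function.Injective f.lin) {g : G} {x : M}
    (h : f.lin x ∈ N.gr g) : x ∈ M.gr g := by
  rw [mem_gr_iff] at h ⊢
  intro g' hg'
  apply hf
  rw [lin_proj, h g' hg', map_zero]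

theorem exists_mem_gr_of_surjective (hf : Function.Surjective f.lin) {g : G} {y : N}
    (h : y ∈ N.gr g) : ∃ x ∈ M.gr g, f.lin x = y := by
  obtain ⟨x, rfl⟩ := hf y
  exact ⟨M.proj g x, M.proj_mem g x, by rw [lin_proj, N.proj_same h]⟩

/-- The factorization of `g` through an injective `f` whose range contains that of `g`. -/
def liftMono (hf : Function.Injective f.lin) {W : GrMod 𝒜} (g : W ⟶ N)
    (hr : ∀ x, g.lin x ∈ LinearMap.range f.lin) : W ⟶ M :=
  have hs : ∀ x, f.lin ((LinearEquiv.ofInjective f.lin hf).symm ⟨g.lin x, hr x⟩) = g.lin x :=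
    fun x => congrArg Subtype.val
      ((LinearEquiv.ofInjective f.lin hf).apply_symm_apply ⟨g.lin x, hr x⟩)
  ⟨(LinearEquiv.ofInjective f.lin hf).symm.toLinearMap.comp (LinearMap.codRestrict _ g.lin hr),
    fun {d x} hx => mem_gr_of_injective hf (f := f) (by
      change f.lin ((LinearEquiv.ofInjective f.lin hf).symm ⟨g.lin x, hr x⟩) ∈ _
      rw [hs]; exact g.map_mem hx)⟩

theorem liftMono_comp (hf : Function.Injective f.lin) {W : GrMod 𝒜} (g : W ⟶ N)
    (hr : ∀ x, g.lin x ∈ LinearMap.range f.lin) : liftMono hf g hr ≫ f = g := by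
  ext x
  exact congrArg Subtype.val
    ((LinearEquiv.ofInjective f.lin hf).apply_symm_apply ⟨g.lin x, hr x⟩)

/-- The factorization of `g` through a surjective `f` whose kernel is contained in that of `g`. -/
def descEpi (hf : Function.Surjective f.lin) {W : GrMod 𝒜} (g : M ⟶ W)
    (hk : LinearMap.ker f.lin ≤ LinearMap.ker g.lin) : N ⟶ W :=
  have hs : ∀ x, (f.lin.quotKerEquivOfSurjective hf).symm (f.lin x) =
      (LinearMap.ker f.lin).mkQ x := fun x => by
    rw [LinearEquiv.symm_apply_eq]; rfl
  ⟨((LinearMap.ker f.lin).liftQ g.lin hk).comp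
      (f.lin.quotKerEquivOfSurjective hf).symm.toLinearMap,
    fun {d y} hy => by
      obtain ⟨x, hx, rfl⟩ := exists_mem_gr_of_surjective hf hy
      rw [LinearMap.comp_apply, LinearEquiv.coe_coe, hs]
      exact g.map_mem hx⟩

theorem comp_descEpi (hf : Function.Surjective f.lin) {W : GrMod 𝒜} (g : M ⟶ W)
    (hk : LinearMap.ker f.lin ≤ LinearMap.ker g.lin) : f ≫ descEpi hf g hk = g := by
  ext x
  have hs : (f.lin.quotKerEquivOfSurjective hf).symm (f.lin x) =
      (LinearMap.ker f.lin).mkQ x := by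
    rw [LinearEquiv.symm_apply_eq]; rfl
  change (LinearMap.ker f.lin).liftQ g.lin hk
    ((f.lin.quotKerEquivOfSurjective hf).symm (f.lin x)) = _
  rw [hs]; rfl

/-- An injective morphism is a kernel of its cokernel. -/
@[reducible]
def normalMono (hf : Function.Injective f.lin) : NormalMono f where
  Z := coker f
  g := cokerπ f
  w := comp_cokerπ f
  isLimit := KernelFork.IsLimit.ofι _ _
    (fun {W} g hg => liftMono hf g fun x =>
      (Submodule.Quotient.mk_eq_zero _).1 (congrArg (fun t => Hom.lin t x) hg))
    (fun {W} g hg => liftMono_comp hf g _)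
    (fun {W} g hg m hm => by
      have := mono_of_injective hf
      rw [← cancel_mono f, hm, liftMono_comp])

/-- A surjective morphism is a cokernel of its kernel. -/
@[reducible]
def normalEpi (hf : Function.Surjective f.lin) : NormalEpi f where
  W := ker f
  g := kerι f
  w := kerι_comp f
  isColimit := CokernelCofork.IsColimit.ofπ _ _
    (fun {W} g hg => descEpi hf g fun x hx =>
      show g.lin x = 0 from
        congrArg (fun t : ker f ⟶ W => t.lin (⟨x, hx⟩ : LinearMap.ker f.lin)) hg)
    (fun {W} g hg => comp_descEpi hf g _)
    (fun {W} g hg m hm => by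
      have := epi_of_surjective hf
      rw [← cancel_epi f]
      exact hm.trans (comp_descEpi hf g _).symm)

/-- The category of graded modules is abelian. -/
instance : Abelian (GrMod 𝒜) where
  has_kernels := ⟨fun f => HasLimit.mk ⟨_, kerIsLimit f⟩⟩
  has_cokernels := ⟨fun f => HasColimit.mk ⟨_, cokerIsColimit f⟩⟩
  normalMonoOfMono _ _ := ⟨normalMono injective_of_mono⟩
  normalEpiOfEpi _ _ := ⟨normalEpi surjective_of_epi⟩

/-- The suspension `M[g]`, with `M[g]_{g'} = M_{g' + g}`. -/
def shift (M : GrMod 𝒜) (g : G) : GrMod 𝒜 where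
  carrier := M
  gr g' := M.gr (g' + g)
  isInternal := isInternal_of_proj _ (fun g' => M.proj (g' + g))
    (fun g' x hx => M.proj_same hx)
    (fun g' h x hx hgh => M.proj_ne hx fun e => hgh (add_right_cancel e))
    (fun x => by
      obtain ⟨s, hs⟩ := M.sum_proj x
      rw [hs]
      refine sum_mem fun h _ => AddSubgroup.subset_closure ⟨(h - g), ?_⟩
      rw [sub_add_cancel]; exact M.proj_mem h x)
  smul_mem {g₁ h a m} ha hm := by rw [add_assoc]; exact M.smul_mem ha hm

/-! ### Enough injectives -/

section Injectives

variable (𝒜) [GradedAlgebra 𝒜]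

/-- The additive map giving the action of `A` on `⨁_g N`: an element `a` of degree `h` sends
`n` in position `g` to `a • n` in position `h + g`. -/
def cofreeAct (N : Type u) [AddCommGroup N] [Module A N] : A →+ (G →₀ N) →+ (G →₀ N) :=
  (DirectSum.toAddMonoid fun h =>
    (AddMonoidHom.mk' (fun a : 𝒜 h => Finsupp.liftAddHom fun g =>
        (Finsupp.singleAddHom (h + g)).comp (DistribSMul.toAddMonoidHom N (a : A)))
      (fun a b => by ext; simp [add_smul]) : 𝒜 h →+ (G →₀ N) →+ (G →₀ N))).comp
    (DirectSum.decomposeAddEquiv 𝒜).toAddMonoidHom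

variable {𝒜}

theorem cofreeAct_single (N : Type u) [AddCommGroup N] [Module A N] {h : G} {a : A}
    (ha : a ∈ 𝒜 h) (g : G) (n : N) :
    cofreeAct 𝒜 N a (Finsupp.single g n) = Finsupp.single (h + g) (a • n) := by
  simp [cofreeAct, DirectSum.decompose_of_mem 𝒜 ha]

theorem alg_induction (𝒜 : G → Submodule k A) [GradedAlgebra 𝒜] {motive : A → Prop}
    (zero : motive 0) (homogeneous : ∀ g, ∀ a ∈ 𝒜 g, motive a)
    (add : ∀ a b, motive a → motive b → motive (a + b)) (a : A) : motive a :=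
  DirectSum.Decomposition.inductionOn 𝒜 zero (fun {i} m => homogeneous i m m.2) add a

variable (𝒜)

/-- The additive group `⨁_g N`, with the action of `A` given by `cofreeAct`. -/
def Cofree (_ : G → Submodule k A) (N : Type u) [AddCommGroup N] : Type u := G →₀ N

instance (N : Type u) [AddCommGroup N] : AddCommGroup (Cofree 𝒜 N) :=
  inferInstanceAs (AddCommGroup (G →₀ N))

instance (N : Type u) [AddCommGroup N] [Module A N] : Module A (Cofree 𝒜 N) where
  smul a f := cofreeAct 𝒜 N a f
  one_smul f := by
    change cofreeAct 𝒜 N 1 f = f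
    induction f using Finsupp.induction_linear with
    | zero => exact map_zero _
    | add f g hf hg => rw [map_add, hf, hg]
    | single g n => rw [cofreeAct_single N SetLike.GradedOne.one_mem, zero_add, one_smul]
  mul_smul a b f := by
    change cofreeAct 𝒜 N (a * b) f = cofreeAct 𝒜 N a (cofreeAct 𝒜 N b f)
    induction f using Finsupp.induction_linear with
    | zero => simp only [map_zero]
    | add f g hf hg => simp only [map_add, hf, hg]
    | single g n =>
      induction a using alg_induction 𝒜 with
      | zero => simp
      | add a a' h h' => simp only [add_mul, map_add, AddMonoidHom.add_apply, h, h']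
      | homogeneous i a ha =>
        induction b using alg_induction 𝒜 with
        | zero => simp
        | add b b' h h' => simp only [mul_add, map_add, AddMonoidHom.add_apply, h, h']
        | homogeneous j b hb =>
          rw [cofreeAct_single N hb, cofreeAct_single N ha,
            cofreeAct_single N (SetLike.GradedMul.mul_mem ha hb), mul_smul, add_assoc]
  smul_zero a := map_zero (cofreeAct 𝒜 N a)
  smul_add a := map_add (cofreeAct 𝒜 N a)
  add_smul a b f := congrArg (fun t => t f) (map_add (cofreeAct 𝒜 N) a b)
  zero_smul f := congrArg (fun t => t f) (map_zero (cofreeAct 𝒜 N))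

variable {𝒜}

variable (𝒜)

/-- The graded module `⨁_g N` attached to a module `N`. -/
def cofreeObj (N : Type u) [AddCommGroup N] [Module A N] : GrMod 𝒜 where
  carrier := Cofree 𝒜 N
  gr g := (Finsupp.singleAddHom g : N →+ (G →₀ N)).range
  isInternal := isInternal_of_proj (M := G →₀ N) _
    (fun g => (Finsupp.singleAddHom g).comp (Finsupp.applyAddHom g))
    (by rintro g _ ⟨n, rfl⟩; simp)
    (by rintro g h _ ⟨n, rfl⟩ hgh; simp [Finsupp.single_eq_of_ne (Ne.symm hgh)])
    (fun f => by
      induction f using Finsupp.induction_linear with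
      | zero => exact zero_mem _
      | add f g hf hg => exact add_mem hf hg
      | single g n => exact AddSubgroup.subset_closure ⟨g, ⟨n, rfl⟩⟩)
  smul_mem := by
    rintro g h a _ ha ⟨n, rfl⟩
    exact ⟨a • n, (cofreeAct_single N ha h n).symm⟩

variable {N : Type u} [AddCommGroup N] [Module A N]

/-- The (ungraded) summation map `⨁_g N → N`. -/
def cofreeSum : cofreeObj 𝒜 N →ₗ[A] N where
  toFun := (Finsupp.liftAddHom fun _ => AddMonoidHom.id N : (G →₀ N) →+ N)
  map_add' := map_add (Finsupp.liftAddHom fun _ => AddMonoidHom.id N : (G →₀ N) →+ N)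
  map_smul' a x := by
    change (Finsupp.liftAddHom fun _ => AddMonoidHom.id N : (G →₀ N) →+ N) (cofreeAct 𝒜 N a x) =
      a • (Finsupp.liftAddHom fun _ => AddMonoidHom.id N : (G →₀ N) →+ N) x
    induction x using Finsupp.induction_linear with
    | zero => simp
    | add x y hx hy => simp only [map_add, hx, hy, smul_add]
    | single g n =>
      induction a using alg_induction 𝒜 with
      | zero => simp
      | add a b ha hb => simp only [map_add, AddMonoidHom.add_apply, ha, hb, add_smul]
      | homogeneous h a ha => rw [cofreeAct_single N ha]; simp

theorem cofreeSum_single (g : G) (n : N) :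
    cofreeSum 𝒜 (show Cofree 𝒜 N from Finsupp.single g n) = n := by
  change (Finsupp.liftAddHom fun _ => AddMonoidHom.id N : (G →₀ N) →+ N) _ = n
  simp

variable {𝒜}

/-- The additive map `x ↦ (f (x_g))_g`. -/
def toCofreeAdd {M : GrMod 𝒜} (f : M →ₗ[A] N) : M →+ (G →₀ N) :=
  letI := M.isInternal.chooseDecomposition
  (DirectSum.toAddMonoid fun g =>
    (Finsupp.singleAddHom g).comp (f.toAddMonoidHom.comp (M.gr g).subtype)).comp
    (DirectSum.decomposeAddEquiv M.gr).toAddMonoidHom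

theorem toCofreeAdd_of_mem {M : GrMod 𝒜} (f : M →ₗ[A] N) {g : G} {x : M} (hx : x ∈ M.gr g) :
    toCofreeAdd f x = Finsupp.single g (f x) := by
  let := M.isInternal.chooseDecomposition
  simp [toCofreeAdd, DirectSum.decompose_of_mem M.gr hx]

/-- The graded morphism `M ⟶ ⨁_g N` corresponding to a linear map `M → N`. -/
def toCofree {M : GrMod 𝒜} (f : M →ₗ[A] N) : M ⟶ cofreeObj 𝒜 N where
  lin :=
    { toFun := toCofreeAdd f
      map_add' := map_add (toCofreeAdd f)
      map_smul' := fun a x => by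
        change toCofreeAdd f (a • x) = cofreeAct 𝒜 N a (toCofreeAdd f x)
        induction x using M.induction with
        | zero => simp
        | add x y hx hy => simp only [smul_add, map_add, hx, hy]
        | homogeneous g x hx =>
          induction a using alg_induction 𝒜 with
          | zero => simp
          | add a b ha hb => simp only [add_smul, map_add, AddMonoidHom.add_apply, ha, hb]
          | homogeneous h a ha =>
            rw [toCofreeAdd_of_mem f hx, toCofreeAdd_of_mem f (M.smul_mem ha hx),
              cofreeAct_single N ha, map_smul] }
  map_mem {g x} hx := ⟨f x, (toCofreeAdd_of_mem f hx).symm⟩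

theorem cofreeSum_toCofree {M : GrMod 𝒜} (f : M →ₗ[A] N) (x : M) :
    cofreeSum 𝒜 ((toCofree f).lin x) = f x := by
  induction x using M.induction with
  | zero => simp
  | add x y hx hy => simp only [map_add, hx, hy]
  | homogeneous g x hx =>
    exact (congrArg _ (toCofreeAdd_of_mem f hx)).trans (cofreeSum_single 𝒜 g (f x))

theorem eq_of_cofreeSum {M : GrMod 𝒜} {f f' : M ⟶ cofreeObj 𝒜 N}
    (h : ∀ x, cofreeSum 𝒜 (f.lin x) = cofreeSum 𝒜 (f'.lin x)) : f = f' := by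
  ext x
  induction x using M.induction with
  | zero => simp
  | add x y hx hy => simp only [map_add, hx, hy]
  | homogeneous g x hx =>
    obtain ⟨n, hn⟩ := f.map_mem hx
    obtain ⟨n', hn'⟩ := f'.map_mem hx
    have := h x
    rw [← hn, ← hn'] at this
    have e : n = n' :=
      (cofreeSum_single 𝒜 g n).symm.trans (this.trans (cofreeSum_single 𝒜 g n'))
    rw [← hn, ← hn', e]

instance (J : ModuleCat.{u} A) [Injective J] : Injective (cofreeObj 𝒜 J) where
  factors {X Y} F i _ := by
    have : Mono (ModuleCat.ofHom i.lin) :=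
      (ModuleCat.mono_iff_injective _).2 injective_of_mono
    refine ⟨toCofree (Injective.factorThru
      (ModuleCat.ofHom ((cofreeSum 𝒜).comp F.lin)) (ModuleCat.ofHom i.lin)).hom, ?_⟩
    refine eq_of_cofreeSum fun x => ?_
    rw [comp_lin, LinearMap.comp_apply, cofreeSum_toCofree]
    exact congrArg (fun t => t.hom x) (Injective.comp_factorThru
      (ModuleCat.ofHom ((cofreeSum 𝒜).comp F.lin)) (ModuleCat.ofHom i.lin))

/-- The category of graded modules has enough injectives. -/
instance : EnoughInjectives (GrMod 𝒜) where
  presentation M := by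
    let i := Injective.ι (ModuleCat.of A M)
    refine ⟨⟨cofreeObj 𝒜 (Injective.under (ModuleCat.of A M) : ModuleCat.{u} A), inferInstance,
      toCofree i.hom, mono_of_injective fun x y hxy => ?_⟩⟩
    apply (ModuleCat.mono_iff_injective i).1 inferInstance
    have := congrArg (cofreeSum 𝒜) hxy
    rwa [cofreeSum_toCofree, cofreeSum_toCofree] at this

instance : HasExt.{u} (GrMod 𝒜) := hasExt_of_enoughInjectives _

end Injectives

end GrMod

/-! ### Local cohomology -/

section Torsion

variable {𝒜 : G → Submodule k A} [GradedAlgebra 𝒜]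

theorem isHomogeneous_pow {I : Ideal A} [I.IsTwoSided] (hI : I.IsHomogeneous 𝒜) (n : ℕ) :
    (I ^ n).IsHomogeneous 𝒜 := by
  induction n with
  | zero =>
    rw [Submodule.pow_zero, Ideal.one_eq_top]
    exact Ideal.IsHomogeneous.top 𝒜
  | succ n ih =>
    rw [Submodule.pow_succ]
    have h2 : (I ^ n).IsTwoSided := inferInstance
    rw [Ideal.IsHomogeneous.iff_exists] at hI ih
    obtain ⟨S, hS⟩ := hI
    obtain ⟨T, hT⟩ := ih
    rw [hT] at h2
    rw [hS] at hT ⊢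
    rw [hT, Ideal.span_mul_span']
    apply Ideal.homogeneous_span
    rintro _ ⟨_, ⟨s, -, rfl⟩, _, ⟨t, -, rfl⟩, rfl⟩
    exact s.2.mul t.2

namespace GrMod

/-- The submodule `{x ∈ M | 𝔞 ^ n x = 0 for n ≫ 0}`. -/
def torsionSubmodule (𝔞 : Ideal A) [𝔞.IsTwoSided] (M : GrMod 𝒜) : Submodule A M where
  carrier := {x | ∃ n : ℕ, ∀ a ∈ 𝔞 ^ n, a • x = 0}
  zero_mem' := ⟨0, fun _ _ => smul_zero _⟩
  add_mem' := by
    rintro x y ⟨m, hm⟩ ⟨n, hn⟩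
    refine ⟨m + n, fun a ha => ?_⟩
    rw [Ideal.IsTwoSided.pow_add] at ha
    rw [smul_add, hm a (Ideal.mul_le_left ha), hn a (Ideal.mul_le_right ha), add_zero]
  smul_mem' := by
    rintro b x ⟨n, hn⟩
    exact ⟨n, fun a ha => by rw [← mul_smul]; exact hn _ (Ideal.mul_mem_right b _ ha)⟩

theorem proj_mem_torsionSubmodule (𝔞 : Ideal A) [𝔞.IsTwoSided] (h𝔞 : 𝔞.IsHomogeneous 𝒜)
    (M : GrMod 𝒜) (g : G) (x : M) (hx : x ∈ torsionSubmodule 𝔞 M) :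
    M.proj g x ∈ torsionSubmodule 𝔞 M := by
  obtain ⟨n, hn⟩ := hx
  refine ⟨n, fun a ha => ?_⟩
  classical
  have key : ∀ h : G, ∀ b ∈ 𝒜 h, b • M.proj g x = M.proj (h + g) (b • x) := by
    intro h b hb
    clear hn
    induction x using M.induction with
    | zero => simp
    | add x y hx hy => simp only [map_add, smul_add, hx, hy]
    | homogeneous g' x hx =>
      by_cases e : g' = g
      · subst e; rw [M.proj_same hx, M.proj_same (M.smul_mem hb hx)]
      · rw [M.proj_ne hx e, M.proj_ne (M.smul_mem hb hx) (fun e' => e (add_left_cancel e')),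
          smul_zero]
  rw [← DirectSum.sum_support_decompose 𝒜 a, Finset.sum_smul]
  refine Finset.sum_eq_zero fun h _ => ?_
  rw [key h _ (SetLike.coe_mem _), hn _ (isHomogeneous_pow h𝔞 n h ha), map_zero]

/-- The torsion functor `Γ_𝔞` on graded modules. -/
def torsion (𝔞 : Ideal A) [𝔞.IsTwoSided] (h𝔞 : 𝔞.IsHomogeneous 𝒜) : GrMod 𝒜 ⥤ GrMod 𝒜 where
  obj M := M.ofSub (torsionSubmodule 𝔞 M) (proj_mem_torsionSubmodule 𝔞 h𝔞 M)
  map {M N} f :=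
    { lin := f.lin.restrict (p := torsionSubmodule 𝔞 M) (q := torsionSubmodule 𝔞 N) (by
        rintro x ⟨n, hn⟩
        exact ⟨n, fun a ha => by rw [← map_smul, hn a ha, map_zero]⟩)
      map_mem := fun h => f.map_mem h }

instance (𝔞 : Ideal A) [𝔞.IsTwoSided] (h𝔞 : 𝔞.IsHomogeneous 𝒜) :
    (torsion 𝔞 h𝔞).Additive where

/-- The local cohomology functors `H^i_𝔞`: the right derived functors of `Γ_𝔞`. -/
def localCohomology (𝔞 : Ideal A) [𝔞.IsTwoSided] (h𝔞 : 𝔞.IsHomogeneous 𝒜) (i : ℕ) :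
    GrMod 𝒜 ⥤ GrMod 𝒜 :=
  (torsion 𝔞 h𝔞).rightDerived i

end GrMod

end Torsion

/-! ### The regular and the trivial module, graded `Ext`, dimensions -/

section Regular

variable (𝒜 : G → Submodule k A) [GradedAlgebra 𝒜]

/-- `A` as a graded left module over itself. -/
def regularModule : GrMod 𝒜 where
  carrier := A
  gr g := (𝒜 g).toAddSubgroup
  isInternal := isInternal_of_proj _ (GradedRing.proj 𝒜)
    (fun _ _ hx => DirectSum.decompose_of_mem_same 𝒜 hx)
    (fun _ _ _ hx hgh => DirectSum.decompose_of_mem_ne 𝒜 hx hgh)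
    (fun x => by
      induction x using GrMod.alg_induction 𝒜 with
      | zero => exact zero_mem _
      | add x y hx hy => exact add_mem hx hy
      | homogeneous g x hx => exact AddSubgroup.subset_closure ⟨g, hx⟩)
  smul_mem ha hm := SetLike.GradedMul.mul_mem ha hm

theorem regularModule_proj (g : G) (x : A) :
    (regularModule 𝒜).proj g x = (DirectSum.decompose 𝒜 x g : A) := by
  induction x using GrMod.alg_induction 𝒜 with
  | zero => rw [DirectSum.decompose_zero]; exact map_zero _
  | add x y hx hy =>
    rw [DirectSum.decompose_add]
    exact (map_add ((regularModule 𝒜).proj g) x y).trans (congrArg₂ (fun a b : A => a + b) hx hy)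
  | homogeneous h x hx =>
    by_cases e : h = g
    · subst e
      exact ((regularModule 𝒜).proj_same hx).trans (DirectSum.decompose_of_mem_same 𝒜 hx).symm
    · exact ((regularModule 𝒜).proj_ne hx e).trans (DirectSum.decompose_of_mem_ne 𝒜 hx e).symm

/-- The two-sided ideal `𝔪` generated by all homogeneous elements of nonzero degree. -/
def augmentationIdeal (𝒜 : G → Submodule k A) : Ideal A :=
  (TwoSidedIdeal.span {a : A | ∃ g : G, g ≠ 0 ∧ a ∈ 𝒜 g}).asIdeal

instance : (augmentationIdeal 𝒜).IsTwoSided :=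
  inferInstanceAs (TwoSidedIdeal.asIdeal _).IsTwoSided

theorem augmentationIdeal_isHomogeneous : (augmentationIdeal 𝒜).IsHomogeneous 𝒜 := by
  have : augmentationIdeal 𝒜 =
      Ideal.span {x : A | ∃ g a h b, g ≠ 0 ∧ a ∈ 𝒜 g ∧ b ∈ 𝒜 h ∧ x = a * b} := by
    apply le_antisymm
    · intro x hx
      replace hx := TwoSidedIdeal.mem_span_iff_mem_addSubgroup_closure.1
        (TwoSidedIdeal.mem_asIdeal.1 hx)
      induction hx using AddSubgroup.closure_induction with
      | zero => exact zero_mem _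
      | add x y _ _ hx hy => exact add_mem hx hy
      | neg x _ hx => exact neg_mem hx
      | mem x hx =>
        obtain ⟨_, ⟨r, -, a, ⟨g, hg, ha⟩, rfl⟩, b, -, rfl⟩ := hx
        change r * a * b ∈ _
        rw [mul_assoc]
        apply Ideal.mul_mem_left
        induction b using GrMod.alg_induction 𝒜 with
        | zero => rw [mul_zero]; exact zero_mem _
        | add b c hb hc => rw [mul_add]; exact add_mem hb hc
        | homogeneous h b hb => exact Ideal.subset_span ⟨g, a, h, b, hg, ha, hb, rfl⟩
    · rw [Ideal.span_le]
      rintro _ ⟨g, a, h, b, hg, ha, hb, rfl⟩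
      exact Ideal.mul_mem_right b _
        (TwoSidedIdeal.mem_asIdeal.2 (TwoSidedIdeal.subset_span ⟨g, hg, ha⟩))
  rw [this]
  apply Ideal.homogeneous_span
  rintro _ ⟨g, a, h, b, -, ha, hb, rfl⟩
  exact ⟨g + h, SetLike.GradedMul.mul_mem ha hb⟩

/-- The trivial graded module `A / 𝔪`, which is `k` (in degree `0`) when `A` is connected. -/
def trivialModule : GrMod 𝒜 :=
  (regularModule 𝒜).ofQuot (augmentationIdeal 𝒜) fun g x hx =>
    (congrArg (fun y : A => y ∈ augmentationIdeal 𝒜) (regularModule_proj 𝒜 g x)).mpr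
      (augmentationIdeal_isHomogeneous 𝒜 g hx)

variable {𝒜} in
/-- Right multiplication by a homogeneous `a` of degree `h`, as a morphism of graded left modules
`A[g] ⟶ A[g']`, where `g' = g + h`. -/
def rightMul {g h g' : G} (e : g + h = g') {a : A} (ha : a ∈ 𝒜 h) :
    (regularModule 𝒜).shift g ⟶ (regularModule 𝒜).shift g' where
  lin := LinearMap.toSpanSingleton A A a
  map_mem {t x} hx := by
    have h₁ : ∀ y ∈ 𝒜 (t + g), y * a ∈ 𝒜 (t + g') := fun y hy => by
      rw [← e, ← add_assoc]; exact SetLike.GradedMul.mul_mem hy ha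
    exact h₁ x hx

end Regular

/-! ### Opposite algebra and change of the grading group -/

section Gradings

variable (𝒜 : G → Submodule k A)

/-- The grading of the opposite algebra, `(Aᵒᵖᵖ)_g = A_g`. -/
def opGrading (g : G) : Submodule k Aᵐᵒᵖ :=
  (𝒜 g).map (MulOpposite.opLinearEquiv k).toLinearMap

variable {𝒜} in
theorem mem_opGrading {g : G} {x : Aᵐᵒᵖ} : x ∈ opGrading 𝒜 g ↔ x.unop ∈ 𝒜 g := by
  constructor
  · rintro ⟨a, ha, rfl⟩; exact ha
  · intro h; exact ⟨x.unop, h, rfl⟩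

instance opGrading.gradedMonoid [GradedAlgebra 𝒜] : SetLike.GradedMonoid (opGrading 𝒜) where
  one_mem := mem_opGrading.2 SetLike.GradedOne.one_mem
  mul_mem g h a b ha hb := mem_opGrading.2 (by
    rw [add_comm]
    exact SetLike.GradedMul.mul_mem (mem_opGrading.1 hb) (mem_opGrading.1 ha))

instance [GradedAlgebra 𝒜] : GradedAlgebra (opGrading 𝒜) :=
  { opGrading.gradedMonoid 𝒜 with
    toDecomposition := (isInternal_of_proj (opGrading 𝒜)
      (fun g => (MulOpposite.opAddEquiv (α := A)).toAddMonoidHom.comp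
        ((GradedRing.proj 𝒜 g).comp (MulOpposite.opAddEquiv (α := A)).symm.toAddMonoidHom))
      (fun g x hx => congrArg MulOpposite.op
        (DirectSum.decompose_of_mem_same 𝒜 (mem_opGrading.1 hx)))
      (fun g h x hx hgh => congrArg MulOpposite.op
        (DirectSum.decompose_of_mem_ne 𝒜 (mem_opGrading.1 hx) hgh))
      (fun x => by
        obtain ⟨x, rfl⟩ := MulOpposite.op_surjective x
        induction x using GrMod.alg_induction 𝒜 with
        | zero => exact zero_mem _
        | add x y hx hy => exact add_mem hx hy
        | homogeneous g x hx =>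
          exact AddSubgroup.subset_closure ⟨g, mem_opGrading.2 hx⟩)).chooseDecomposition }

variable {H : Type} [AddCommGroup H] [DecidableEq H] (φ : G →+ H)

/-- The `H`-grading induced on `A` by a group morphism `φ : G → H`:
the component of degree `h` is the sum of the `A_g` with `φ g = h`. -/
def regrade (h : H) : Submodule k A := ⨆ g : {g : G // φ g = h}, 𝒜 g

variable {𝒜 φ} in
theorem mem_regrade {g : G} {x : A} (hx : x ∈ 𝒜 g) : x ∈ regrade 𝒜 φ (φ g) :=
  Submodule.mem_iSup_of_mem (p := fun g' : {g' : G // φ g' = φ g} => 𝒜 g') ⟨g, rfl⟩ hx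

theorem regrade_induction {h : H} {motive : A → Prop}
    (zero : motive 0) (homogeneous : ∀ g, φ g = h → ∀ a ∈ 𝒜 g, motive a)
    (add : ∀ a b, motive a → motive b → motive (a + b)) {a : A} (ha : a ∈ regrade 𝒜 φ h) :
    motive a :=
  Submodule.iSup_induction _ (motive := motive) ha (fun g x hx => homogeneous g g.2 x hx) zero add

instance regrade.gradedMonoid [GradedAlgebra 𝒜] : SetLike.GradedMonoid (regrade 𝒜 φ) where
  one_mem := by
    have := mem_regrade (φ := φ) (SetLike.GradedOne.one_mem (A := 𝒜))
    rwa [map_zero] at this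
  mul_mem h h' a b ha hb := by
    refine regrade_induction 𝒜 φ (motive := fun a => a * b ∈ regrade 𝒜 φ (h + h'))
      ?_ ?_ ?_ ha
    · rw [zero_mul]; exact zero_mem _
    · rintro g rfl a ha
      refine regrade_induction 𝒜 φ (motive := fun b => a * b ∈ regrade 𝒜 φ (φ g + h'))
        ?_ ?_ ?_ hb
      · rw [mul_zero]; exact zero_mem _
      · rintro g' rfl b hb
        rw [← map_add]
        exact mem_regrade (SetLike.GradedMul.mul_mem ha hb)
      · intro x y hx hy; rw [mul_add]; exact add_mem hx hy
    · intro x y hx hy; rw [add_mul]; exact add_mem hx hy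

/-- The projection of `A` onto the component of degree `h` of the induced grading. -/
def regradeProj [GradedAlgebra 𝒜] (h : H) : A →+ A :=
  (DirectSum.toAddMonoid fun g =>
    if φ g = h then (𝒜 g).subtype.toAddMonoidHom else 0).comp
    (DirectSum.decomposeAddEquiv 𝒜).toAddMonoidHom

theorem regradeProj_of_mem [GradedAlgebra 𝒜] (h : H) {g : G} {x : A} (hx : x ∈ 𝒜 g) :
    regradeProj 𝒜 φ h x = if φ g = h then x else 0 := by
  simp only [regradeProj, AddMonoidHom.comp_apply, AddEquiv.toAddMonoidHom_eq_coe,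
    AddMonoidHom.coe_coe, DirectSum.decomposeAddEquiv_apply, DirectSum.decompose_of_mem 𝒜 hx,
    DirectSum.toAddMonoid_of]
  split_ifs <;> rfl

instance [GradedAlgebra 𝒜] : GradedAlgebra (regrade 𝒜 φ) :=
  { regrade.gradedMonoid 𝒜 φ with
    toDecomposition := (isInternal_of_proj (regrade 𝒜 φ) (regradeProj 𝒜 φ)
      (fun h x hx => by
        refine regrade_induction 𝒜 φ (motive := fun x => regradeProj 𝒜 φ h x = x)
          (map_zero _) ?_ (fun a b ha hb => by rw [map_add, ha, hb]) hx
        rintro g hg a ha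
        rw [regradeProj_of_mem 𝒜 φ h ha, if_pos hg])
      (fun h h' x hx hne => by
        refine regrade_induction 𝒜 φ (motive := fun x => regradeProj 𝒜 φ h x = 0)
          (map_zero _) ?_ (fun a b ha hb => by rw [map_add, ha, hb, add_zero]) hx
        rintro g rfl a ha
        rw [regradeProj_of_mem 𝒜 φ h ha, if_neg hne])
      (fun x => by
        induction x using GrMod.alg_induction 𝒜 with
        | zero => exact zero_mem _
        | add x y hx hy => exact add_mem hx hy
        | homogeneous g x hx =>
          exact AddSubgroup.subset_closure ⟨φ g, mem_regrade hx⟩)).chooseDecomposition }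

/-- The morphism `ℤ^{r+1} → ℤ`, `(a_0, …, a_r) ↦ a_0 + ⋯ + a_r`. -/
def sumHom (r : ℕ) : (Fin (r + 1) → ℤ) →+ ℤ where
  toFun a := ∑ i, a i
  map_zero' := by simp
  map_add' a b := by simp [Finset.sum_add_distrib]

/-- The grading by total degree of a `ℤ^{r+1}`-graded algebra. -/
abbrev totalGrading {r : ℕ} (𝒜 : (Fin (r + 1) → ℤ) → Submodule k A) : ℤ → Submodule k A :=
  regrade 𝒜 (sumHom r)

end Gradings

/-! ### Zhang twists -/

section Twist

/-- A normalized left twisting system on the `G`-graded algebra `A = ⨁ 𝒜 g`. -/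
structure NormalizedLeftTwistingSystem (𝒜 : G → Submodule k A) where
  /-- The `k`-linear automorphisms `τ_g`. -/
  τ : G → (A ≃ₗ[k] A)
  /-- Each `τ_g` preserves the grading. -/
  map_mem : ∀ (g h : G) (a : A), a ∈ 𝒜 h → τ g a ∈ 𝒜 h
  /-- `τ_{g''} (τ_{g'} (a) a') = τ_{g' + g''} (a) τ_{g''} (a')` for `a ∈ A_g`, `a' ∈ A_{g'}`. -/
  map_mul : ∀ (g g' g'' : G) (a a' : A), a ∈ 𝒜 g → a' ∈ 𝒜 g' →
    τ g'' (τ g' a * a') = τ (g' + g'') a * τ g'' a'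
  /-- The system is normalized. -/
  map_one : τ 0 1 = 1

namespace NormalizedLeftTwistingSystem

variable {𝒜 : G → Submodule k A} [GradedAlgebra 𝒜] (T : NormalizedLeftTwistingSystem 𝒜)

theorem map_mul' {g' : G} (g'' : G) (a : A) {a' : A} (ha' : a' ∈ 𝒜 g') :
    T.τ g'' (T.τ g' a * a') = T.τ (g' + g'') a * T.τ g'' a' := by
  induction a using GrMod.alg_induction 𝒜 with
  | zero => simp
  | add a b ha hb => simp only [map_add, add_mul, ha, hb]
  | homogeneous g a ha => exact T.map_mul g g' g'' a a' ha ha'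

theorem exists_map_eq (g : G) {h : G} {b : A} (hb : b ∈ 𝒜 h) : ∃ a ∈ 𝒜 h, T.τ g a = b := by
  have key : ∀ a : A, T.τ g (DirectSum.decompose 𝒜 a h : A) =
      (DirectSum.decompose 𝒜 (T.τ g a) h : A) := by
    intro a
    induction a using GrMod.alg_induction 𝒜 with
    | zero => simp
    | add a b ha hb => simp [map_add, DirectSum.decompose_add, ha, hb]
    | homogeneous i a ha =>
      by_cases e : i = h
      · subst e
        rw [DirectSum.decompose_of_mem_same 𝒜 ha,
          DirectSum.decompose_of_mem_same 𝒜 (T.map_mem g _ a ha)]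
      · rw [DirectSum.decompose_of_mem_ne 𝒜 ha e,
          DirectSum.decompose_of_mem_ne 𝒜 (T.map_mem g _ a ha) e, map_zero]
  refine ⟨_, SetLike.coe_mem (DirectSum.decompose 𝒜 ((T.τ g).symm b) h), ?_⟩
  rw [key, LinearEquiv.apply_symm_apply, DirectSum.decompose_of_mem_same 𝒜 hb]

theorem apply_one (g : G) : T.τ g 1 = 1 := by
  obtain ⟨a, ha, h⟩ := T.exists_map_eq g (SetLike.GradedOne.one_mem (A := 𝒜))
  have := T.map_mul' g 1 ha
  rwa [T.map_one, one_mul, zero_add, h, mul_one, eq_comm] at this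

theorem apply_zero (a : A) : T.τ 0 a = a := by
  have := T.map_mul' 0 a (SetLike.GradedOne.one_mem (A := 𝒜))
  rw [T.map_one, mul_one, mul_one, zero_add] at this
  exact (T.τ 0).injective this

/-- The product `a ∘ b = ∑_g τ_g (a) b_g` (with the two arguments swapped). -/
def mulAux : A →+ A →+ A :=
  (DirectSum.toAddMonoid fun g => (AddMonoidHom.mk' (fun b : 𝒜 g =>
      (AddMonoidHom.mulRight (b : A)).comp (T.τ g).toLinearMap.toAddMonoidHom)
    (fun b c => by ext; simp [mul_add]) : 𝒜 g →+ A →+ A)).comp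
    (DirectSum.decomposeAddEquiv 𝒜).toAddMonoidHom

theorem mulAux_of_mem {g : G} {b : A} (hb : b ∈ 𝒜 g) (a : A) :
    T.mulAux b a = T.τ g a * b := by
  simp [mulAux, DirectSum.decompose_of_mem 𝒜 hb]

theorem mulAux_one_left (a : A) : T.mulAux a 1 = a := by
  induction a using GrMod.alg_induction 𝒜 with
  | zero => simp
  | add a b ha hb => rw [map_add, AddMonoidHom.add_apply, ha, hb]
  | homogeneous g a ha => rw [T.mulAux_of_mem ha, T.apply_one, one_mul]

theorem mulAux_one_right (a : A) : T.mulAux 1 a = a := by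
  rw [T.mulAux_of_mem SetLike.GradedOne.one_mem, T.apply_zero, mul_one]

theorem mulAux_assoc (a b c : A) :
    T.mulAux c (T.mulAux b a) = T.mulAux (T.mulAux c b) a := by
  induction c using GrMod.alg_induction 𝒜 with
  | zero => simp
  | add c c' h h' => simp only [map_add, AddMonoidHom.add_apply, h, h']
  | homogeneous j c hc =>
    induction b using GrMod.alg_induction 𝒜 with
    | zero => simp
    | add b b' h h' => simp only [map_add, AddMonoidHom.add_apply, h, h']
    | homogeneous i b hb =>
      rw [T.mulAux_of_mem hb, T.mulAux_of_mem hc, T.mulAux_of_mem hc, T.map_mul' j a hb,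
        T.mulAux_of_mem (SetLike.GradedMul.mul_mem (T.map_mem j i b hb) hc), mul_assoc]

theorem mulAux_smul_left (c : k) (a b : A) : T.mulAux b (c • a) = c • T.mulAux b a := by
  induction b using GrMod.alg_induction 𝒜 with
  | zero => simp
  | add b b' h h' => simp only [map_add, AddMonoidHom.add_apply, h, h', smul_add]
  | homogeneous g b hb =>
    rw [T.mulAux_of_mem hb, T.mulAux_of_mem hb, map_smul, smul_mul_assoc]

theorem mulAux_smul_right (c : k) (a b : A) : T.mulAux (c • b) a = c • T.mulAux b a := by
  induction b using GrMod.alg_induction 𝒜 with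
  | zero => simp
  | add b b' h h' => simp only [map_add, AddMonoidHom.add_apply, h, h', smul_add]
  | homogeneous g b hb =>
    rw [T.mulAux_of_mem hb, T.mulAux_of_mem (Submodule.smul_mem _ c hb), mul_smul_comm]

/-- The twisted algebra `^τ A`: the `k`-module `A`, with the product determined by
`a ∘ a' = τ_{g'} (a) a'` for `a' ∈ A_{g'}` (see `mul_of_mem`). -/
def Twist (_ : NormalizedLeftTwistingSystem 𝒜) : Type u := A

instance : AddCommGroup T.Twist := inferInstanceAs (AddCommGroup A)
instance : Module k T.Twist := inferInstanceAs (Module k A)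

instance : Ring T.Twist :=
  { (inferInstance : AddCommGroup T.Twist) with
    mul := fun a b => T.mulAux b a
    one := (1 : A)
    left_distrib := fun a b c => congrArg (fun f => f a) (map_add T.mulAux b c)
    right_distrib := fun a b c => map_add (T.mulAux c) a b
    zero_mul := fun a => map_zero (T.mulAux a)
    mul_zero := fun a => congrArg (fun f => f a) (map_zero T.mulAux)
    one_mul := T.mulAux_one_left
    mul_one := T.mulAux_one_right
    mul_assoc := T.mulAux_assoc }

theorem mul_of_mem (a : A) {g' : G} {a' : A} (ha' : a' ∈ 𝒜 g') :
    ((show T.Twist from a) * (show T.Twist from a') : T.Twist) = (T.τ g' a * a' : A) :=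
  T.mulAux_of_mem ha' a

instance : Algebra k T.Twist :=
  Algebra.ofModule T.mulAux_smul_left T.mulAux_smul_right

/-- The grading of the twisted algebra, which is the grading of `A`. -/
def twistGrading (g : G) : Submodule k T.Twist where
  carrier := {x : A | x ∈ 𝒜 g}
  add_mem' := (𝒜 g).add_mem
  zero_mem' := (𝒜 g).zero_mem
  smul_mem' c _ hx := (𝒜 g).smul_mem c hx

theorem mulAux_mem {g h : G} {a b : A} (ha : a ∈ 𝒜 g) (hb : b ∈ 𝒜 h) :
    T.mulAux b a ∈ 𝒜 (g + h) := by
  rw [T.mulAux_of_mem hb]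
  exact SetLike.GradedMul.mul_mem (T.map_mem h g a ha) hb

instance twistGrading.gradedMonoid : SetLike.GradedMonoid T.twistGrading where
  one_mem := show (1 : A) ∈ 𝒜 0 from SetLike.GradedOne.one_mem
  mul_mem _ _ _ _ ha hb := T.mulAux_mem ha hb

instance : GradedAlgebra T.twistGrading :=
  { twistGrading.gradedMonoid T with
    toDecomposition := (isInternal_of_proj T.twistGrading (GradedRing.proj 𝒜)
      (fun _ x (hx : (show A from x) ∈ 𝒜 _) => DirectSum.decompose_of_mem_same 𝒜 hx)
      (fun g h x (hx : (show A from x) ∈ 𝒜 h) hgh => DirectSum.decompose_of_mem_ne 𝒜 hx hgh)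
      (fun x => GrMod.alg_induction 𝒜
        (motive := fun x : A => (show T.Twist from x) ∈
          AddSubgroup.closure {y : T.Twist | ∃ g, y ∈ T.twistGrading g})
        (zero_mem _) (fun g _ hx => AddSubgroup.subset_closure ⟨g, hx⟩)
        (fun _ _ hx hy => add_mem hx hy) x)).chooseDecomposition }

end NormalizedLeftTwistingSystem

end Twist

/-! ### The regularity conditions -/

section Regularity

/-- A connected `ℤ^{r+1}`-graded algebra: the support lies in `ℕ^{r+1}` and `A_0 = k`. -/
structure IsConnectedGrading {r : ℕ} (𝒜 : (Fin (r + 1) → ℤ) → Submodule k A) : Prop where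
  support : ∀ g, 𝒜 g ≠ ⊥ → ∀ i, 0 ≤ g i
  algebraMap_injective : Function.Injective (algebraMap k A)
  zero_eq_range : ∀ a : A, a ∈ 𝒜 0 ↔ a ∈ Set.range (algebraMap k A)

variable (𝒜 : G → Submodule k A) [GradedAlgebra 𝒜]

open Abelian

/-- `A` is AS-Cohen–Macaulay with respect to the grading `𝒜`: for some `n`, the local cohomology
modules `H^i_𝔪 (A)` and `H^i_{𝔪ᵒᵖ} (A)` vanish for all `i ≠ n`. -/
def IsASCohenMacaulay : Prop :=
  ∃ n : ℕ, ∀ i : ℕ, i ≠ n →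
    IsZero ((GrMod.localCohomology _ (augmentationIdeal_isHomogeneous 𝒜) i).obj
      (regularModule 𝒜)) ∧
    IsZero ((GrMod.localCohomology _ (augmentationIdeal_isHomogeneous (opGrading 𝒜)) i).obj
      (regularModule (opGrading 𝒜)))

/-- The component of degree `g` of the graded right `A`-module `\underline{Ext}^i(k, A)`. -/
abbrev gradedExt (i : ℕ) (g : G) : Type u :=
  Ext (trivialModule 𝒜) ((regularModule 𝒜).shift g) i

variable {𝒜} in
/-- The right action of a homogeneous element `a ∈ A_h` on `\underline{Ext}^i(k, A)`, mapping the
component of degree `g` to the component of degree `g' = g + h`: it is induced by the right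
multiplication `A[g] ⟶ A[g']`. -/
def gradedExtSMul (i : ℕ) {g h g' : G} (e : g + h = g') {a : A} (ha : a ∈ 𝒜 h)
    (x : gradedExt 𝒜 i g) : gradedExt 𝒜 i g' :=
  x.comp (Ext.mk₀ (rightMul e ha)) (add_zero i)

/-- `A` is left AS-Gorenstein of (finite) graded injective dimension `n` and Gorenstein shift `ℓ`:
`\underline{Ext}^i(k, A)` is `0` for `i ≠ n`, and for `i = n` it is isomorphic to `k[ℓ]` as
a graded right `A`-module (that is: there is a family of isomorphisms between the homogeneous
components which is compatible with the action of all homogeneous elements of `A`). -/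
structure IsLeftASGorensteinWith (n : ℕ) (ℓ : G) : Prop where
  injectiveDimension_eq : injectiveDimension (regularModule 𝒜) = n
  ext_eq_zero : ∀ i : ℕ, i ≠ n → ∀ g : G, Subsingleton (gradedExt 𝒜 i g)
  ext_iso : ∃ e : ∀ g : G, gradedExt 𝒜 n g ≃+ ((trivialModule (opGrading 𝒜)).shift ℓ).gr g,
    ∀ (g h g' : G) (hg : g + h = g') (a : A) (ha : a ∈ 𝒜 h) (x : gradedExt 𝒜 n g),
      (e g' (gradedExtSMul n hg ha x) : (trivialModule (opGrading 𝒜)).shift ℓ) =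
        MulOpposite.op a • (e g x : (trivialModule (opGrading 𝒜)).shift ℓ)

/-- `A` is AS-Gorenstein with respect to the grading `𝒜`: both `A` and `Aᵒᵖᵖ` are left
AS-Gorenstein, with the same injective dimensions and Gorenstein shifts. -/
def IsASGorenstein : Prop :=
  ∃ (n : ℕ) (ℓ : G), IsLeftASGorensteinWith 𝒜 n ℓ ∧ IsLeftASGorensteinWith (opGrading 𝒜) n ℓ

/-- The graded left global dimension of `A`. -/
def gradedGlobalDimension (𝒜 : G → Submodule k A) : WithBot ℕ∞ :=
  ⨆ M : GrMod 𝒜, projectiveDimension M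

/-- `A` is AS-regular with respect to the grading `𝒜`: it is AS-Gorenstein, and its left and right
graded global dimensions are finite and coincide. -/
def IsASRegular : Prop :=
  IsASGorenstein 𝒜 ∧
    ∃ d : ℕ, gradedGlobalDimension 𝒜 = d ∧ gradedGlobalDimension (opGrading 𝒜) = d

end Regularity

end

noncomputable section

open CategoryTheory CategoryTheory.Limits

variable {G : Type} [AddCommGroup G] [DecidableEq G]
variable {k : Type v} [Field k] {A : Type u} [Ring A] [Algebra k A]

/-! ### Graded modules and morphisms from homogeneous components -/

namespace GrMod

section Components

variable {𝒜 : G → Submodule k A}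

/-! For the fine grading by `ℤ^{r+1}` the reason is Zhang's equivalence. A graded `A`-module `M`
becomes a graded module over the twist `B` by letting `b` act on `M_g` as `τ_g(b)`. This is an
equivalence `GrMod A ≌ GrMod B` that matches shifts of the regular module, the trivial module and
the torsion functors. It therefore preserves local cohomology, injective dimension, graded `Ext` and
global dimension. The right `A`-action on `Ext(k, A)` is matched only up to a twist depending on the
degree, which is undone by a degree-dependent identification of the trivial right modules. The
notion `TwistedIso` isolates what is needed. It applies to the opposite algebras too, where the
automorphism of index `g` acts on `A_{g'}` as `τ_{-g-g'}`.

For the total degree this argument is not available, because `τ_g` depends on the multidegree and a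
twisted action makes no sense on a merely `ℤ`-graded module. Instead each property for the total
grading is expressed through the fine grading, for `A` and for its twist separately. The comparison
uses exact functors `U ⊣ R ⊣ P` attached to a coarsening `φ` of the grading group: `U` forgets to
the coarse grading, `R N = ⨁_g N_{φ g}`, and `P` takes products over the fibres of `φ`. Since their
left adjoints are exact, `R` and `P` preserve injectives. Every `Y` is a retract of `R U Y`.

Cohen–Macaulay: `R U E` is the direct sum of the shifts `E[h]` with `φ h = 0`, so over a noetherian
algebra `R U` preserves injectives by Baer's criterion (`injective_RU`). The local cohomology of `R
U A` is then both `R` of the coarse and `R U` of the fine local cohomology of `A`, and both functors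
reflect zero objects.

Gorenstein: a connected algebra has finitely many nonzero components over each total degree, so `U A
≅ P A` and the two injective dimensions agree. Moreover `Ext(U k, A[m]) ≅ Ext(k, R(A[m]))`, and
`R(A[m])` is the product of the fine shifts `A[g]` with `φ g = m`. A one-dimensional coarse `Ext`
thus has exactly one nonzero fine component (`Coarsening.isLeftASGorensteinWith_iff`). The fine
shifts found on the left and on the right might differ, but each one-sided condition is invariant
under twists, which suffices.

Regular: the retraction of `R U` bounds the fine global dimension by the coarse one. Conversely, a
coarse module `V` killed by `𝔪` is a retract of `P R V`, so its injective dimension is bounded by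
the fine global dimension. Over a connected algebra, minimal free covers show that such `V` detect
the projective dimension of bounded below modules. Cyclic modules are bounded below, and a
dimension-shifted Baer criterion extends the bound to all modules. -/

theorem smul_mem' (M : GrMod 𝒜) {h g g' : G} (e : h + g = g') {a : A} {m : M} (ha : a ∈ 𝒜 h)
    (hm : m ∈ M.gr g) : a • m ∈ M.gr g' :=
  e ▸ M.smul_mem ha hm

theorem hom_ext_gr {M N : GrMod 𝒜} {f f' : M ⟶ N} (h : ∀ g, ∀ x ∈ M.gr g, f.lin x = f'.lin x) :
    f = f' := by
  ext x
  induction x using M.induction with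
  | zero => simp
  | homogeneous g x hx => exact h g x hx
  | add x y hx hy => rw [map_add, map_add, hx, hy]

theorem congr_lin {M N : GrMod 𝒜} {f f' : M ⟶ N} (h : f = f') (x : M) : f.lin x = f'.lin x := by
  rw [h]

theorem proj_smul [GradedAlgebra 𝒜] (M : GrMod 𝒜) {h g g' : G} (e : h + g = g') {a : A}
    (ha : a ∈ 𝒜 h) (x : M) : M.proj g' (a • x) = a • M.proj g x := by
  subst e
  induction x using M.induction with
  | zero => simp
  | add x y hx hy => rw [smul_add, map_add, map_add, hx, hy, smul_add]
  | homogeneous i x hx =>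
    by_cases hi : i = g
    · subst hi; rw [M.proj_same hx, M.proj_same (M.smul_mem ha hx)]
    · rw [M.proj_ne hx hi, smul_zero,
        M.proj_ne (M.smul_mem ha hx) fun e => hi (add_left_cancel e)]

/-- The additive map on a graded module determined by its restrictions to the components. -/
def addMk (M : GrMod 𝒜) {N : Type*} [AddCommGroup N] (f : ∀ g, M.gr g →+ N) : M →+ N :=
  letI := M.isInternal.chooseDecomposition
  (DirectSum.toAddMonoid f).comp (DirectSum.decomposeAddEquiv M.gr).toAddMonoidHom

theorem addMk_of_mem (M : GrMod 𝒜) {N : Type*} [AddCommGroup N] (f : ∀ g, M.gr g →+ N) {g : G}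
    {x : M} (hx : x ∈ M.gr g) : M.addMk f x = f g ⟨x, hx⟩ := by
  let := M.isInternal.chooseDecomposition
  simp [addMk, DirectSum.decompose_of_mem M.gr hx]

variable [GradedAlgebra 𝒜]

/-- The linear map on a graded module determined by its restrictions to the components. -/
def linMk (M : GrMod 𝒜) {N : Type*} [AddCommGroup N] [Module A N] (f : ∀ g, M.gr g →+ N)
    (hf : ∀ h g a (ha : a ∈ 𝒜 h) x (hx : x ∈ M.gr g),
      f (h + g) ⟨a • x, M.smul_mem ha hx⟩ = a • f g ⟨x, hx⟩) : M →ₗ[A] N where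
  toFun := M.addMk f
  map_add' := map_add _
  map_smul' a x := by
    induction x using M.induction with
    | zero => simp
    | add x y hx hy =>
      rw [RingHom.id_apply] at *
      rw [smul_add, map_add, map_add, hx, hy, smul_add]
    | homogeneous g x hx =>
      induction a using alg_induction 𝒜 with
      | zero => simp
      | add a b ha hb =>
        rw [RingHom.id_apply] at *
        rw [add_smul, map_add, ha, hb, add_smul]
      | homogeneous h a ha =>
        rw [RingHom.id_apply, M.addMk_of_mem f hx, M.addMk_of_mem f (M.smul_mem ha hx),
          hf h g a ha x hx]

theorem linMk_of_mem (M : GrMod 𝒜) {N : Type*} [AddCommGroup N] [Module A N]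
    (f : ∀ g, M.gr g →+ N) (hf) {g : G} {x : M} (hx : x ∈ M.gr g) :
    M.linMk f hf x = f g ⟨x, hx⟩ := M.addMk_of_mem f hx

/-- The morphism of graded modules determined by its restrictions to the components. -/
def homMk {M N : GrMod 𝒜} (f : ∀ g, M.gr g →+ N.gr g)
    (hf : ∀ h g a (ha : a ∈ 𝒜 h) x (hx : x ∈ M.gr g),
      (f (h + g) ⟨a • x, M.smul_mem ha hx⟩ : N) = a • (f g ⟨x, hx⟩ : N)) : M ⟶ N where
  lin := M.linMk (fun g => (N.gr g).subtype.comp (f g)) hf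
  map_mem {g x} hx := (congrArg (· ∈ N.gr g) (M.linMk_of_mem
    (fun g => (N.gr g).subtype.comp (f g)) hf hx)).mpr (f g ⟨x, hx⟩).2

theorem homMk_of_mem {M N : GrMod 𝒜} (f : ∀ g, M.gr g →+ N.gr g) (hf) {g : G} {x : M}
    (hx : x ∈ M.gr g) : (homMk f hf).lin x = f g ⟨x, hx⟩ :=
  M.linMk_of_mem (fun g => (N.gr g).subtype.comp (f g)) hf hx

/-- A morphism inducing bijections on all components is an isomorphism. -/
theorem bijective_of_gr {M N : GrMod 𝒜} (f : M ⟶ N) (inj : ∀ g, ∀ x ∈ M.gr g, f.lin x = 0 → x = 0)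
    (surj : ∀ g, ∀ y ∈ N.gr g, ∃ x, f.lin x = y) : Function.Bijective f.lin := by
  refine ⟨(injective_iff_map_eq_zero _).2 fun x hx => M.eq_zero_of_proj fun g =>
    inj g _ (M.proj_mem g x) (by rw [lin_proj, hx, map_zero]), fun y => ?_⟩
  induction y using N.induction with
  | zero => exact ⟨0, map_zero _⟩
  | homogeneous g y hy => exact surj g y hy
  | add y y' h h' =>
    obtain ⟨x, rfl⟩ := h
    obtain ⟨x', rfl⟩ := h'
    exact ⟨x + x', map_add _ _ _⟩

theorem injective_of_gr {M N : GrMod 𝒜} (f : M ⟶ N)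
    (inj : ∀ g, ∀ x ∈ M.gr g, f.lin x = 0 → x = 0) : Function.Injective f.lin :=
  (injective_iff_map_eq_zero _).2 fun x hx => M.eq_zero_of_proj fun g =>
    inj g _ (M.proj_mem g x) (by rw [lin_proj, hx, map_zero])

theorem surjective_of_gr {M N : GrMod 𝒜} (f : M ⟶ N)
    (surj : ∀ g, ∀ y ∈ N.gr g, ∃ x, f.lin x = y) : Function.Surjective f.lin := fun y => by
  induction y using N.induction with
  | zero => exact ⟨0, map_zero _⟩
  | homogeneous g y hy => exact surj g y hy
  | add y y' h h' =>
    obtain ⟨x, rfl⟩ := h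
    obtain ⟨x', rfl⟩ := h'
    exact ⟨x + x', map_add _ _ _⟩

theorem isIso_of_bijective {M N : GrMod 𝒜} {f : M ⟶ N} (h : Function.Bijective f.lin) :
    IsIso f := by
  have := mono_of_injective h.1
  have := epi_of_surjective h.2
  exact isIso_of_mono_of_epi f

end Components

/-! ### Short exact sequences of graded modules, in terms of elements. -/

section Exact

variable {𝒜 : G → Submodule k A}

theorem shortExact_mk {S : ShortComplex (GrMod 𝒜)} (inj : Function.Injective S.f.lin)
    (surj : Function.Surjective S.g.lin) (ex : ∀ x, S.g.lin x = 0 → ∃ y, S.f.lin y = x) :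
    S.ShortExact where
  mono_f := mono_of_injective inj
  epi_g := epi_of_surjective surj
  exact := S.exact_of_f_is_kernel (KernelFork.IsLimit.ofι _ _
    (fun {W} g hg => liftMono inj g fun x => ex _ (congr_lin hg x))
    (fun {W} g hg => liftMono_comp inj g _)
    (fun {W} g hg m hm => by
      have := mono_of_injective inj
      rw [← cancel_mono S.f]
      exact hm.trans (liftMono_comp inj g _).symm))

theorem _root_.CategoryTheory.ShortComplex.ShortExact.exists_lin_eq {S : ShortComplex (GrMod 𝒜)}
    (hS : S.ShortExact) {x : S.X₂} (hx : S.g.lin x = 0) : ∃ y, S.f.lin y = x := by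
  have := hS.mono_f
  -- The concrete kernel of `S.g` factors through `S.f` by exactness; the factorization is evaluated
  -- at `x`.
  refine ⟨Hom.lin (hS.exact.lift (kerι S.g) (kerι_comp S.g)) (⟨x, hx⟩ : LinearMap.ker S.g.lin), ?_⟩
  exact congr_lin (hS.exact.lift_f (kerι S.g) (kerι_comp S.g)) (⟨x, hx⟩ : LinearMap.ker S.g.lin)

theorem shortExact_coker {M N : GrMod 𝒜} (f : M ⟶ N) (hf : Function.Injective f.lin) :
    (ShortComplex.mk f (cokerπ f) (comp_cokerπ f)).ShortExact :=
  shortExact_mk hf (Submodule.mkQ_surjective _)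
    fun _ hx => (Submodule.Quotient.mk_eq_zero _).1 hx

theorem shortExact_ker {M N : GrMod 𝒜} (f : M ⟶ N) (hf : Function.Surjective f.lin) :
    (ShortComplex.mk (kerι f) f (kerι_comp f)).ShortExact :=
  shortExact_mk Subtype.val_injective hf fun x hx => ⟨⟨x, hx⟩, rfl⟩

end Exact

/-- The data of the homogeneous components of a graded module. -/
structure Components (𝒜 : G → Submodule k A) [GradedAlgebra 𝒜] where
  V : G → Type u
  [addCommGroup : ∀ g, AddCommGroup (V g)]
  -- The target degree is a variable together with an equation, so that the unit and associativity
  -- laws can be stated without transport between components.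
  act : ∀ {h g g' : G}, h + g = g' → 𝒜 h → V g → V g'
  act_add : ∀ {h g g' : G} (e : h + g = g') (a : 𝒜 h) (x y : V g),
    act e a (x + y) = act e a x + act e a y
  add_act : ∀ {h g g' : G} (e : h + g = g') (a b : 𝒜 h) (x : V g),
    act e (a + b) x = act e a x + act e b x
  one_act : ∀ {g : G} (x : V g), act (zero_add g) ⟨1, SetLike.GradedOne.one_mem⟩ x = x
  mul_act : ∀ {i h g g' g'' : G} (e : h + g = g') (e' : i + g' = g'') (e'' : i + h + g = g'')
    (a : 𝒜 i) (b : 𝒜 h) (x : V g),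
    act e'' ⟨a * b, SetLike.GradedMul.mul_mem a.2 b.2⟩ x = act e' a (act e b x)

namespace Components

variable {𝒜 : G → Submodule k A} [GradedAlgebra 𝒜] (D : Components 𝒜)

instance (g : G) : AddCommGroup (D.V g) := D.addCommGroup g

/-- The action of `A` on the direct sum of the components. -/
def actHom : A →+ (DirectSum G D.V) →+ (DirectSum G D.V) :=
  (DirectSum.toAddMonoid fun h => AddMonoidHom.mk' (fun a : 𝒜 h =>
      DirectSum.toAddMonoid fun g => (DirectSum.of D.V (h + g)).comp
        (AddMonoidHom.mk' (D.act rfl a) (D.act_add rfl a)))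
    (fun a b => by ext g x; simp [D.add_act])).comp
    (DirectSum.decomposeAddEquiv 𝒜).toAddMonoidHom

theorem actHom_of {h g g' : G} (e : h + g = g') {a : A} (ha : a ∈ 𝒜 h) (x : D.V g) :
    D.actHom a (DirectSum.of D.V g x) = DirectSum.of D.V g' (D.act e ⟨a, ha⟩ x) := by
  subst e
  simp [actHom, DirectSum.decompose_of_mem 𝒜 ha]

/-- The direct sum of the components. -/
def Carrier : Type u := DirectSum G D.V

instance : AddCommGroup D.Carrier := inferInstanceAs (AddCommGroup (DirectSum G D.V))

instance : Module A D.Carrier where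
  smul a x := D.actHom a x
  one_smul x := by
    change D.actHom 1 x = x
    induction x using DirectSum.induction_on with
    | zero => exact map_zero _
    | of g x => rw [D.actHom_of (zero_add g) SetLike.GradedOne.one_mem, D.one_act]
    | add x y hx hy => exact (map_add _ _ _).trans (congrArg₂ _ hx hy)
  mul_smul a b x := by
    change D.actHom (a * b) x = D.actHom a (D.actHom b x)
    induction x using DirectSum.induction_on with
    | zero => simp only [map_zero]
    | add x y hx hy => simp only [map_add, hx, hy]
    | of g x =>
      induction a using alg_induction 𝒜 with
      | zero => simp
      | add a a' h h' => simp only [add_mul, map_add, AddMonoidHom.add_apply, h, h']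
      | homogeneous i a ha =>
        induction b using alg_induction 𝒜 with
        | zero => simp
        | add b b' h h' => simp only [mul_add, map_add, AddMonoidHom.add_apply, h, h']
        | homogeneous j b hb =>
          rw [D.actHom_of rfl hb, D.actHom_of (add_assoc i j g).symm ha,
            D.actHom_of rfl (SetLike.GradedMul.mul_mem ha hb)]
          exact congrArg _ (D.mul_act rfl (add_assoc i j g).symm rfl ⟨a, ha⟩ ⟨b, hb⟩ x)
  smul_zero a := map_zero (D.actHom a)
  smul_add a := map_add (D.actHom a)
  add_smul a b f := congrArg (fun t => t f) (map_add D.actHom a b)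
  zero_smul f := congrArg (fun t => t f) (map_zero D.actHom)

/-- The graded module with the given components. -/
def toGrMod : GrMod 𝒜 where
  carrier := D.Carrier
  gr g := (DirectSum.of D.V g).range
  isInternal := isInternal_of_proj (M := DirectSum G D.V) _
    (fun g => (DirectSum.of D.V g).comp (DFinsupp.evalAddMonoidHom g))
    (by
      rintro g _ ⟨x, rfl⟩
      exact congrArg (DirectSum.of D.V g) (DirectSum.of_eq_same g x))
    (by
      rintro g h _ ⟨x, rfl⟩ hgh
      exact (congrArg (DirectSum.of D.V g) (DirectSum.of_eq_of_ne h g x hgh.symm)).trans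
        (map_zero _))
    (fun x => by
      induction x using DirectSum.induction_on with
      | zero => exact zero_mem _
      | of g x => exact AddSubgroup.subset_closure ⟨g, x, rfl⟩
      | add x y hx hy => exact add_mem hx hy)
  smul_mem := by
    rintro g h a _ ha ⟨x, rfl⟩
    exact ⟨_, (D.actHom_of rfl ha x).symm⟩

/-- The inclusion of a component. -/
def ι (g : G) : D.V g →+ D.toGrMod := DirectSum.of D.V g

theorem ι_mem (g : G) (x : D.V g) : D.ι g x ∈ D.toGrMod.gr g := ⟨x, rfl⟩

theorem exists_ι_eq {g : G} {x : D.toGrMod} (hx : x ∈ D.toGrMod.gr g) : ∃ y, D.ι g y = x := hx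

theorem ι_injective (g : G) : Function.Injective (D.ι g) := DirectSum.of_injective g

theorem smul_ι {h g g' : G} (e : h + g = g') {a : A} (ha : a ∈ 𝒜 h) (x : D.V g) :
    a • D.ι g x = D.ι g' (D.act e ⟨a, ha⟩ x) := D.actHom_of e ha x

/-- The component of degree `g` of the associated graded module. -/
def grEquiv (g : G) : D.V g ≃+ D.toGrMod.gr g :=
  AddEquiv.ofBijective ((D.ι g).codRestrict _ (D.ι_mem g))
    ⟨fun _ _ h => D.ι_injective g (congrArg Subtype.val h),
      fun ⟨_, hx⟩ => ⟨hx.choose, Subtype.ext hx.choose_spec⟩⟩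

@[simp] theorem grEquiv_coe (g : G) (x : D.V g) : (D.grEquiv g x : D.toGrMod) = D.ι g x := rfl

theorem ι_grEquiv_symm (g : G) (x : D.toGrMod.gr g) : D.ι g ((D.grEquiv g).symm x) = x :=
  congrArg Subtype.val ((D.grEquiv g).apply_symm_apply x)

theorem grEquiv_symm_ι (g : G) (x : D.V g) (hx : D.ι g x ∈ D.toGrMod.gr g) :
    (D.grEquiv g).symm ⟨D.ι g x, hx⟩ = x := (D.grEquiv g).symm_apply_apply x

variable {D}

/-- A morphism into the graded module with given components. -/
def lift {M : GrMod 𝒜} (f : ∀ g, M.gr g →+ D.V g)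
    (hf : ∀ h g a (ha : a ∈ 𝒜 h) x (hx : x ∈ M.gr g),
      f (h + g) ⟨a • x, M.smul_mem ha hx⟩ = D.act rfl ⟨a, ha⟩ (f g ⟨x, hx⟩)) : M ⟶ D.toGrMod :=
  homMk (fun g => (D.grEquiv g).toAddMonoidHom.comp (f g)) fun h g a ha x hx => by
    simp [hf h g a ha x hx, D.smul_ι rfl ha]

theorem lift_of_mem {M : GrMod 𝒜} (f : ∀ g, M.gr g →+ D.V g) (hf) {g : G} {x : M}
    (hx : x ∈ M.gr g) : (lift f hf).lin x = D.ι g (f g ⟨x, hx⟩) := homMk_of_mem _ _ hx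

/-- A linear map from the graded module with given components. -/
def descLin {N : Type*} [AddCommGroup N] [Module A N] (f : ∀ g, D.V g →+ N)
    (hf : ∀ h g a (ha : a ∈ 𝒜 h) (x : D.V g), f (h + g) (D.act rfl ⟨a, ha⟩ x) = a • f g x) :
    D.toGrMod →ₗ[A] N :=
  D.toGrMod.linMk (fun g => (f g).comp (D.grEquiv g).symm.toAddMonoidHom) (by
    rintro h g a ha _ ⟨x, rfl⟩
    have e : (⟨a • D.ι g x, D.toGrMod.smul_mem ha (D.ι_mem g x)⟩ :
        D.toGrMod.gr (h + g)) = D.grEquiv _ (D.act rfl ⟨a, ha⟩ x) :=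
      Subtype.ext (D.smul_ι rfl ha x)
    have e' : (⟨D.ι g x, D.ι_mem g x⟩ : D.toGrMod.gr g) = D.grEquiv _ x := rfl
    change f _ ((D.grEquiv _).symm ⟨a • D.ι g x, _⟩) = a • f _ ((D.grEquiv _).symm ⟨D.ι g x, _⟩)
    rw [e, e', AddEquiv.symm_apply_apply, AddEquiv.symm_apply_apply, hf])

theorem descLin_ι {N : Type*} [AddCommGroup N] [Module A N] (f : ∀ g, D.V g →+ N) (hf) {g : G}
    (x : D.V g) : descLin f hf (D.ι g x) = f g x :=
  (linMk_of_mem _ _ _ (D.ι_mem g x)).trans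
    (congrArg (f g) ((D.grEquiv g).symm_apply_apply x))

/-- A morphism from the graded module with given components. -/
def desc {N : GrMod 𝒜} (f : ∀ g, D.V g →+ N) (hm : ∀ g x, f g x ∈ N.gr g)
    (hf : ∀ h g a (ha : a ∈ 𝒜 h) (x : D.V g), f (h + g) (D.act rfl ⟨a, ha⟩ x) = a • f g x) :
    D.toGrMod ⟶ N where
  lin := descLin f hf
  map_mem := by
    rintro g _ ⟨x, rfl⟩
    exact (congrArg (· ∈ N.gr g) (descLin_ι f hf x)).mpr (hm g x)

theorem desc_ι {N : GrMod 𝒜} (f : ∀ g, D.V g →+ N) (hm) (hf) {g : G} (x : D.V g) :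
    (desc f hm hf).lin (D.ι g x) = f g x := descLin_ι f hf x

theorem hom_ext {N : GrMod 𝒜} {f f' : D.toGrMod ⟶ N}
    (h : ∀ g x, f.lin (D.ι g x) = f'.lin (D.ι g x)) : f = f' :=
  hom_ext_gr (by rintro g _ ⟨x, rfl⟩; exact h g x)

end Components

end GrMod

/-! ### Baer's criterion for graded modules -/

namespace GrMod

variable {𝒜 : G → Submodule k A} [GradedAlgebra 𝒜]

/-- An element of `A`, as an element of `A[g]`. -/
def toShift (𝒜 : G → Submodule k A) [GradedAlgebra 𝒜] (g : G) (a : A) :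
    (regularModule 𝒜).shift g := a

/-- An element of `A[g]`, as an element of `A`. -/
def ofShift {g : G} (x : (regularModule 𝒜).shift g) : A := x

/-- The morphism `A[g] ⟶ M` which maps `1` to a given element of degree `-g`. -/
def ofElem {M : GrMod 𝒜} {g j : G} (e : g + j = 0) {m : M} (hm : m ∈ M.gr j) :
    (regularModule 𝒜).shift g ⟶ M where
  lin := LinearMap.toSpanSingleton A M m
  map_mem {t x} hx := M.smul_mem' (h := t + g) (by rw [add_assoc, e, add_zero]) hx hm

theorem lin_regular {M : GrMod 𝒜} {g : G} (f : (regularModule 𝒜).shift g ⟶ M)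
    (x : (regularModule 𝒜).shift g) : f.lin x = ofShift x • f.lin (toShift 𝒜 g 1) :=
  (congrArg f.lin (mul_one (ofShift x)).symm).trans (f.lin.map_smul (ofShift x) (toShift 𝒜 g 1))

theorem one_mem_shift (g : G) {j : G} (e : g + j = 0) :
    toShift 𝒜 g 1 ∈ ((regularModule 𝒜).shift g).gr j := by
  have : (1 : A) ∈ 𝒜 (j + g) := by
    rw [add_comm, e]; exact SetLike.GradedOne.one_mem
  exact this

/-- A partial morphism of graded modules: the domain is graded, and degrees are preserved. -/
structure IsGradedPMap {Y E : GrMod 𝒜} (p : Y →ₗ.[A] E) : Prop where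
  proj_mem : ∀ g, ∀ x ∈ p.domain, Y.proj g x ∈ p.domain
  map_mem : ∀ g, ∀ x : p.domain, (x : Y) ∈ Y.gr g → p x ∈ E.gr g

/-- This is the enlargement step for Zorn's lemma. The rules `p` and `y ↦ e` glue because they agree
on the multiples of `y` in the domain of `p`, and the result is graded because `y` and `e` are
homogeneous of the same degree. -/
theorem isGradedPMap_sup_span {Y E : GrMod 𝒜} {p : Y →ₗ.[A] E} (hp : IsGradedPMap p) {j : G}
    {y : Y} (hy : y ∈ Y.gr j) {e : E} (he : e ∈ E.gr j)
    (h : ∀ a : A, ∀ ha : a • y ∈ p.domain, p ⟨a • y, ha⟩ = a • e) :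
    ∃ q, IsGradedPMap q ∧ p ≤ q ∧ y ∈ q.domain := by
  -- Well defined: if `c • y = 0`, then `c • y` lies in the domain of `p`, and `h` gives `c • e = p
  -- 0 = 0`.
  let q₀ : Y →ₗ.[A] E := LinearPMap.mkSpanSingleton' y e fun c hc => by
    have h1 : c • y ∈ p.domain := by rw [hc]; exact zero_mem _
    rw [RingHom.id_apply, ← h c h1]
    exact (congrArg p (Subtype.ext hc)).trans p.map_zero
  have hq₀ : ∀ (c : A) (hc : c • y ∈ q₀.domain), q₀ ⟨c • y, hc⟩ = c • e := fun c hc =>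
    LinearPMap.mkSpanSingleton'_apply _ _ _ c hc
  have H : ∀ (x : p.domain) (z : q₀.domain), (x : Y) = z → p x = q₀ z := by
    rintro ⟨x, hx⟩ ⟨z, hz⟩ (rfl : x = z)
    obtain ⟨c, rfl⟩ := Submodule.mem_span_singleton.1 hz
    rw [h c hx, hq₀]
  have hs : ∀ (x : Y) (hx : x ∈ p.domain) (c : A) (hz : x + c • y ∈ (p.sup q₀ H).domain),
      p.sup q₀ H ⟨x + c • y, hz⟩ = p ⟨x, hx⟩ + c • e := fun x hx c hz => by
    have hc : c • y ∈ q₀.domain := Submodule.mem_span_singleton.2 ⟨c, rfl⟩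
    exact (LinearPMap.sup_apply H ⟨x, hx⟩ ⟨c • y, hc⟩ ⟨x + c • y, hz⟩ rfl).trans
      (congrArg _ (hq₀ c hc))
  have hd : ∀ z, z ∈ (p.sup q₀ H).domain ↔ ∃ x ∈ p.domain, ∃ c : A, x + c • y = z := fun z => by
    refine Submodule.mem_sup.trans ⟨?_, ?_⟩
    · rintro ⟨x, hx, _, hz, rfl⟩
      obtain ⟨c, rfl⟩ := Submodule.mem_span_singleton.1 hz
      exact ⟨x, hx, c, rfl⟩
    · rintro ⟨x, hx, c, rfl⟩
      exact ⟨x, hx, _, Submodule.mem_span_singleton.2 ⟨c, rfl⟩, rfl⟩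
  have e0 : -j + j = 0 := neg_add_cancel j
  -- The multiples of `y` are the image of `A[-j]`, so projecting `c • y` amounts to replacing `c`
  -- by one of its homogeneous components.
  have hproj : ∀ g (x : Y) (c : A), Y.proj g (x + c • y) =
      Y.proj g x + ofShift (((regularModule 𝒜).shift (-j)).proj g (toShift 𝒜 (-j) c)) • y := fun g x c => by
    rw [map_add]
    exact congrArg _ (lin_proj (ofElem e0 hy) g (toShift 𝒜 (-j) c)).symm
  refine ⟨p.sup q₀ H, ⟨fun g z hz => ?_, fun g z hz => ?_⟩, LinearPMap.left_le_sup p q₀ H, ?_⟩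
  · obtain ⟨x, hx, c, rfl⟩ := (hd z).1 hz
    rw [hproj]
    exact (hd _).2 ⟨_, hp.proj_mem g x hx, _, rfl⟩
  · obtain ⟨z, hz'⟩ := z
    obtain ⟨x, hx, c, rfl⟩ := (hd z).1 hz'
    have key : x + c • y = Y.proj g x + ofShift (((regularModule 𝒜).shift (-j)).proj g (toShift 𝒜 (-j) c)) • y := by
      rw [← hproj, Y.proj_same hz]
    have hz'' := hz'
    rw [key] at hz''
    rw [show (⟨x + c • y, hz'⟩ : (p.sup q₀ H).domain) = ⟨_, hz''⟩ from Subtype.ext key,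
      hs _ (hp.proj_mem g x hx)]
    exact add_mem (hp.map_mem g _ (Y.proj_mem g x))
      ((ofElem e0 he).map_mem (((regularModule 𝒜).shift (-j)).proj_mem g (toShift 𝒜 (-j) c)))
  · exact (hd y).2 ⟨0, zero_mem _, 1, by rw [one_smul, zero_add]⟩

theorem exists_isGradedPMap_of_chain {Y E : GrMod 𝒜} {c : Set (Y →ₗ.[A] E)}
    (hc : ∀ p ∈ c, IsGradedPMap p) (hchain : IsChain (· ≤ ·) c) (hne : c.Nonempty) :
    ∃ q, IsGradedPMap q ∧ ∀ p ∈ c, p ≤ q := by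
  have hdir := hchain.directedOn
  refine ⟨LinearPMap.sSup c hdir, ⟨fun g x hx => ?_, ?_⟩, fun p hp => LinearPMap.le_sSup hdir hp⟩
  · obtain ⟨p, hp, hx⟩ := (LinearPMap.mem_domain_sSup_iff hne hdir).1 hx
    exact (LinearPMap.le_sSup hdir hp).1 ((hc p hp).proj_mem g x hx)
  · rintro g ⟨x, hx⟩ hxg
    obtain ⟨p, hp, hx'⟩ := (LinearPMap.mem_domain_sSup_iff hne hdir).1 hx
    have := (LinearPMap.le_sSup hdir hp).2 (x := ⟨x, hx'⟩) (y := ⟨x, hx⟩) rfl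
    rw [← this]
    exact (hc p hp).map_mem g _ hxg

/-- Baer's criterion for graded modules. -/
theorem injective_of_baer (E : GrMod 𝒜) (h : ∀ (g : G) (X : GrMod 𝒜)
    (f : X ⟶ (regularModule 𝒜).shift g) (_ : Function.Injective f.lin) (w : X ⟶ E),
    ∃ v, f ≫ v = w) : Injective E where
  factors {X Y} w i _ := by
    have hi : Function.Injective i.lin := injective_of_mono
    let p₀ : Y →ₗ.[A] E :=
      ⟨LinearMap.range i.lin, w.lin.comp (LinearEquiv.ofInjective i.lin hi).symm.toLinearMap⟩
    have hp₀ : ∀ (x : X) (hx : i.lin x ∈ p₀.domain), p₀ ⟨i.lin x, hx⟩ = w.lin x := fun x hx =>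
      congrArg w.lin ((LinearEquiv.ofInjective i.lin hi).symm_apply_apply x)
    have g₀ : IsGradedPMap p₀ := by
      refine ⟨?_, ?_⟩
      · rintro g _ ⟨x, rfl⟩
        exact ⟨X.proj g x, lin_proj i g x⟩
      · rintro g ⟨_, ⟨x, rfl⟩⟩ hx
        exact (congrArg (· ∈ E.gr g) (hp₀ x ⟨x, rfl⟩)).mpr
          (w.map_mem (mem_gr_of_injective hi hx))
    obtain ⟨p, hp, hmax⟩ := zorn_le_nonempty₀ {p | IsGradedPMap p}
      (fun c hc hchain y hy => exists_isGradedPMap_of_chain hc hchain ⟨y, hy⟩) p₀ g₀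
    have hg : IsGradedPMap p := hmax.1
    have htop : ∀ y, y ∈ p.domain := by
      have hom : ∀ j, ∀ y ∈ Y.gr j, y ∈ p.domain := by
        intro j y hy
        have e0 : -j + j = 0 := neg_add_cancel j
        let f := ofElem e0 hy
        -- `I` is the graded left ideal of all `a` with `a • y` in the domain, shifted so that `1`
        -- has the degree `j` of `y`. If `v` extends `a ↦ p (a • y)` to `A[-j]`, then `v 1` is an
        -- admissible value at `y`, and maximality of `p` puts `y` in its domain.
        let I : GrMod 𝒜 := ((regularModule 𝒜).shift (-j)).ofSub (p.domain.comap f.lin)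
          fun g x hx => by
            rw [Submodule.mem_comap, lin_proj]
            exact hg.proj_mem g _ hx
        let ι : I ⟶ (regularModule 𝒜).shift (-j) := ⟨(p.domain.comap f.lin).subtype, fun h => h⟩
        let w' : I ⟶ E := ⟨p.toFun.comp (LinearMap.restrict (p := p.domain.comap f.lin)
          (q := p.domain) f.lin fun _ hx => hx),
          fun {g} x hx => hg.map_mem g _ (f.map_mem hx)⟩
        obtain ⟨v, hv⟩ := h (-j) I ι Subtype.val_injective w'
        obtain ⟨q, hq, hpq, hyq⟩ := isGradedPMap_sup_span hg hy
          (v.map_mem (one_mem_shift (-j) e0)) fun a ha =>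
            (congr_lin hv (⟨a, ha⟩ : p.domain.comap f.lin)).symm.trans
              (lin_regular v (toShift 𝒜 (-j) a))
        exact (hmax.2 hq hpq).1 hyq
      intro y
      obtain ⟨s, hs⟩ := Y.sum_proj y
      rw [hs]
      exact sum_mem fun g _ => hom g _ (Y.proj_mem g y)
    refine ⟨⟨p.toFun.comp (LinearMap.codRestrict p.domain LinearMap.id htop),
      fun {g} x hx => hg.map_mem g ⟨x, htop x⟩ hx⟩, ?_⟩
    ext x
    refine (hp.2 (x := ⟨i.lin x, x, rfl⟩) (y := ⟨i.lin x, htop _⟩) rfl).symm.trans ?_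
    exact hp₀ x _

end GrMod

/-! ### Exact adjunctions, `Ext` and derived functors -/

section Adjunction

universe w w' v₁ v₂ u₁ u₂

open Abelian

variable {C : Type u₁} [Category.{v₁} C] [Abelian C] {D : Type u₂} [Category.{v₂} D] [Abelian D]

section

variable {L : C ⥤ D} {R : D ⥤ C} (adj : L ⊣ R) [R.Additive]
  [PreservesFiniteLimits R] [PreservesFiniteColimits R] [HasExt.{w} C] [HasExt.{w'} D]

/-- The map `Ext^n(L X, N) → Ext^n(X, R N)` associated with an adjunction. -/
def adjExt (X : C) (N : D) (n : ℕ) : Ext.{w'} (L.obj X) N n →+ Ext.{w} X (R.obj N) n :=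
  ((Ext.mk₀ (adj.unit.app X)).precomp (R.obj N) (zero_add n)).comp (R.mapExtAddHom (L.obj X) N n)

theorem adjExt_apply (X : C) (N : D) (n : ℕ) (x : Ext.{w'} (L.obj X) N n) :
    adjExt adj X N n x =
      (Ext.mk₀ (adj.unit.app X)).comp (x.mapExactFunctor R) (zero_add n) := rfl

theorem adjExt_comp {X : C} {N N' : D} {n m p : ℕ} (x : Ext.{w'} (L.obj X) N n)
    (y : Ext.{w'} N N' m) (e : n + m = p) :
    adjExt adj X N' p (x.comp y e) = (adjExt adj X N n x).comp (y.mapExactFunctor R) e := by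
  rw [adjExt_apply, adjExt_apply, Ext.mapExactFunctor_comp,
    Ext.comp_assoc (a₁₂ := n) (h := by omega)]

theorem adjExt_comp_mk₀ {X : C} {N N' : D} {n : ℕ} (x : Ext.{w'} (L.obj X) N n) (f : N ⟶ N') :
    adjExt adj X N' n (x.comp (Ext.mk₀ f) (add_zero n)) =
      (adjExt adj X N n x).comp (Ext.mk₀ (R.map f)) (add_zero n) := by
  rw [adjExt_comp, Ext.mapExactFunctor_mk₀]

-- Dimension shifting in `N`. Degree zero is the adjunction on morphisms. For an embedding of `N` in
-- an injective, `R` keeps the sequence exact and its middle term injective, so both connecting maps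
-- are surjective and bijectivity for the cokernel in degree `n` gives it for `N` in degree `n + 1`.
attribute [local instance] Ext.subsingleton_of_injective in
theorem adjExt_bijective [EnoughInjectives D] [R.PreservesInjectiveObjects] (X : C) (N : D)
    (n : ℕ) : Function.Bijective (adjExt.{w, w'} adj X N n) := by
  induction n generalizing N with
  | zero =>
    have : ⇑(adjExt adj X N 0) =
        Ext.homEquiv₀.symm ∘ (adj.homEquiv X N) ∘ Ext.homEquiv₀ := by
      ext x
      obtain ⟨f, rfl⟩ := Ext.homEquiv₀.symm.surjective x
      have hf : Ext.homEquiv₀ (Ext.mk₀ f) = f := Ext.homEquiv₀.apply_symm_apply f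
      simp [adjExt_apply, Ext.mapExactFunctor_mk₀, Adjunction.homEquiv_unit, hf]
    rw [this]
    exact Ext.homEquiv₀.symm.bijective.comp ((adj.homEquiv X N).bijective.comp
      Ext.homEquiv₀.bijective)
  | succ n hn =>
    let I : InjectivePresentation N := Classical.arbitrary _
    let S := ShortComplex.mk _ _ (cokernel.condition I.f)
    have : Injective (S.map R).X₂ := Functor.PreservesInjectiveObjects.injective_obj I.injective
    have hS : S.ShortExact := { exact := ShortComplex.exact_cokernel I.f }
    exact AddMonoidHom.bijective_of_surjective_of_bijective_of_right_exact
      ((Ext.mk₀ S.g).postcomp (L.obj X) (add_zero n)) (hS.extClass.postcomp (L.obj X) rfl)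
      ((Ext.mk₀ (R.map S.g)).postcomp X (add_zero n))
      ((hS.map_of_exact R).extClass.postcomp X rfl)
      (adjExt adj X S.X₂ n) (adjExt adj X S.X₃ n) (adjExt adj X S.X₁ (n + 1))
      (by ext x; exact (adjExt_comp_mk₀ adj x S.g).symm)
      (by
        ext x
        refine ((adjExt_comp adj x hS.extClass rfl).trans ?_).symm
        rw [Ext.mapExactFunctor_extClass]
        rfl)
      ((ShortComplex.ab_exact_iff_function_exact _).mp
        (Ext.covariant_sequence_exact₃' (L.obj X) hS n (n + 1) rfl))
      ((ShortComplex.ab_exact_iff_function_exact _).mp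
        (Ext.covariant_sequence_exact₃' X (hS.map_of_exact R) n (n + 1) rfl))
      (hn _).surjective (hn _)
      (fun x₁ ↦ Ext.covariant_sequence_exact₁ _ hS x₁ (by subsingleton) rfl)
      (fun y₁ ↦ Ext.covariant_sequence_exact₁ _ (hS.map_of_exact R) y₁ (by subsingleton) rfl)

end

section

variable {L : C ⥤ D} {R : D ⥤ C} (adj : L ⊣ R) [R.Additive]
  [PreservesFiniteLimits R] [PreservesFiniteColimits R]
  [EnoughInjectives D] [R.PreservesInjectiveObjects]

include adj

theorem hasInjectiveDimensionLT_of_adj (N : D) (n : ℕ) [HasInjectiveDimensionLT N n] :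
    HasInjectiveDimensionLT (R.obj N) n := by
  let := HasExt.standard C
  let := HasExt.standard D
  rw [hasInjectiveDimensionLT_iff]
  intro i hi X e
  obtain ⟨x, rfl⟩ := (adjExt_bijective adj X N i).2 e
  rw [x.eq_zero_of_hasInjectiveDimensionLT n hi, map_zero]

theorem hasProjectiveDimensionLT_of_adj (X : C) (n : ℕ) [HasProjectiveDimensionLT X n] :
    HasProjectiveDimensionLT (L.obj X) n := by
  let := HasExt.standard C
  let := HasExt.standard D
  rw [hasProjectiveDimensionLT_iff]
  intro i hi N e
  apply (adjExt_bijective adj X N i).1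
  rw [map_zero]
  exact Ext.eq_zero_of_hasProjectiveDimensionLT _ n hi

end

end Adjunction

section RightDerived

universe v₁ v₂ v₃ v₄ u₁ u₂ u₃ u₄

variable {C : Type u₁} [Category.{v₁} C] [Abelian C] {D : Type u₂} [Category.{v₂} D] [Abelian D]

/-- The image of an injective resolution under an exact functor which preserves injectives. -/
def injectiveResolutionMap (K : C ⥤ D) [K.Additive] [PreservesFiniteLimits K]
    [PreservesFiniteColimits K] [K.PreservesInjectiveObjects] {X : C}
    (I : InjectiveResolution X) : InjectiveResolution (K.obj X) where
  cocomplex := (K.mapHomologicalComplex _).obj I.cocomplex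
  injective n := K.injective_obj_of_injective (I.injective n)
  ι := ((HomologicalComplex.singleMapHomologicalComplex K (ComplexShape.up ℕ) 0).inv.app X) ≫
    (K.mapHomologicalComplex _).map I.ι
  quasiIso := by
    have : QuasiIso ((K.mapHomologicalComplex (ComplexShape.up ℕ)).map I.ι) := inferInstance
    infer_instance

/-- `K` carries an injective resolution of `X` to one of `K X`, and `e` identifies the two resulting
complexes. Hence the `n`-th derived functor of `T` at `K X` is `K` of that of `S` at `X`; the
reflection of zero objects gives the equivalence. -/
theorem isZero_rightDerived_obj_iff (K : C ⥤ D) [K.Additive] [PreservesFiniteLimits K]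
    [PreservesFiniteColimits K] [K.PreservesInjectiveObjects] [HasInjectiveResolutions C]
    [HasInjectiveResolutions D] (S : C ⥤ C) (T : D ⥤ D) [S.Additive] [T.Additive]
    (e : K ⋙ T ≅ S ⋙ K) (hK : ∀ X, IsZero (K.obj X) → IsZero X) (n : ℕ) (X : C) :
    IsZero ((T.rightDerived n).obj (K.obj X)) ↔ IsZero ((S.rightDerived n).obj X) := by
  let I := injectiveResolution X
  let e₁ := (injectiveResolutionMap K I).isoRightDerivedObj T n
  let e₂ := I.isoRightDerivedObj S n
  let e₃ : (T.mapHomologicalComplex _).obj ((K.mapHomologicalComplex _).obj I.cocomplex) ≅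
      (K.mapHomologicalComplex _).obj ((S.mapHomologicalComplex _).obj I.cocomplex) :=
    HomologicalComplex.Hom.isoOfComponents (fun i => e.app (I.cocomplex.X i))
      (fun i j _ => (e.hom.naturality (I.cocomplex.d i j)).symm)
  let e₄ := (HomologicalComplex.homologyFunctor D (ComplexShape.up ℕ) n).mapIso e₃
  let e₅ : ((K.mapHomologicalComplex _).obj ((S.mapHomologicalComplex _).obj
      I.cocomplex)).homology n ≅ K.obj (((S.mapHomologicalComplex _).obj
      I.cocomplex).homology n) :=
    (((S.mapHomologicalComplex _).obj I.cocomplex).sc n).mapHomologyIso K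
  rw [(e₁ ≪≫ e₄ ≪≫ e₅).isZero_iff, e₂.isZero_iff]
  exact ⟨hK _, fun h => K.map_isZero h⟩

end RightDerived

/-! ### Auxiliary facts on regular and trivial modules -/

namespace GrMod

variable {𝒜 : G → Submodule k A} [GradedAlgebra 𝒜]

theorem Components.grEquiv_symm_smul (D : Components 𝒜) {h g g' : G} (e : h + g = g') {a : A}
    (ha : a ∈ 𝒜 h) {x : D.toGrMod} (hx : x ∈ D.toGrMod.gr g)
    (hx' : a • x ∈ D.toGrMod.gr g') :
    (D.grEquiv g').symm ⟨a • x, hx'⟩ = D.act e ⟨a, ha⟩ ((D.grEquiv g).symm ⟨x, hx⟩) := by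
  obtain ⟨y, rfl⟩ := D.exists_ι_eq hx
  rw [AddEquiv.symm_apply_eq]
  exact Subtype.ext ((D.smul_ι e ha y).trans
    (congrArg (fun z => D.ι g' (D.act e ⟨a, ha⟩ z)) (D.grEquiv_symm_ι g y hx).symm))

/-- `M[0] ≅ M`. -/
def shiftZeroIso (M : GrMod 𝒜) : M.shift 0 ≅ M where
  hom := ⟨LinearMap.id, fun {g x} hx => by
    have hx' : (show M from x) ∈ M.gr (g + 0) := hx
    rw [add_zero] at hx'; exact hx'⟩
  inv := ⟨LinearMap.id, fun {g x} hx => by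
    have hx' : (show M from x) ∈ M.gr (g + 0) := by rw [add_zero]; exact hx
    exact hx'⟩
  hom_inv_id := rfl
  inv_hom_id := rfl

theorem shift_hom_ext {M : GrMod 𝒜} {g : G} {f f' : (regularModule 𝒜).shift g ⟶ M}
    (h : f.lin (toShift 𝒜 g 1) = f'.lin (toShift 𝒜 g 1)) : f = f' := by
  ext x
  rw [lin_regular f, lin_regular f', h]

theorem rightMul_one {g h g' : G} (e : g + h = g') {a : A} (ha : a ∈ 𝒜 h) :
    (rightMul e ha).lin (toShift 𝒜 g 1) = toShift 𝒜 g' a := one_mul a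

/-- The class of an element of `A` in the trivial module. -/
def trivialMk (𝒜 : G → Submodule k A) [GradedAlgebra 𝒜] (a : A) : trivialModule 𝒜 :=
  (augmentationIdeal 𝒜).mkQ a

theorem trivialMk_eq_zero {a : A} : trivialMk 𝒜 a = 0 ↔ a ∈ augmentationIdeal 𝒜 :=
  Submodule.Quotient.mk_eq_zero _

theorem trivialMk_mem {g : G} {a : A} (ha : a ∈ 𝒜 g) : trivialMk 𝒜 a ∈ (trivialModule 𝒜).gr g :=
  ⟨a, ha, rfl⟩

theorem exists_trivialMk_eq {g : G} {x : trivialModule 𝒜} (hx : x ∈ (trivialModule 𝒜).gr g) :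
    ∃ a ∈ 𝒜 g, trivialMk 𝒜 a = x := hx

theorem smul_trivialMk (a b : A) : a • trivialMk 𝒜 b = trivialMk 𝒜 (a * b) := rfl

theorem trivialMk_surjective : Function.Surjective (trivialMk 𝒜) := Submodule.mkQ_surjective _

/-- The morphism from the trivial module corresponding to an element of degree `0` which is
annihilated by the augmentation ideal. -/
def ofTrivial {M : GrMod 𝒜} {m : M} (hm : m ∈ M.gr 0) (h : ∀ a ∈ augmentationIdeal 𝒜, a • m = 0) :
    trivialModule 𝒜 ⟶ M where
  lin := (augmentationIdeal 𝒜).liftQ (LinearMap.toSpanSingleton A M m) h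
  map_mem := by
    rintro g _ ⟨a, ha, rfl⟩
    exact M.smul_mem' (add_zero g) ha hm

/-- All three factors are taken homogeneous because twisted isomorphisms are multiplicative only for
a homogeneous right factor. No case for negation is needed: the sign is absorbed into the left
factor. -/
theorem augmentationIdeal_induction {motive : A → Prop} (zero : motive 0)
    (add : ∀ a b, motive a → motive b → motive (a + b))
    (mul : ∀ (i j l : G) (a b c : A), a ∈ 𝒜 i → b ∈ 𝒜 j → c ∈ 𝒜 l → j ≠ 0 → motive (a * b * c))
    {a : A} (ha : a ∈ augmentationIdeal 𝒜) : motive a := by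
  have neg : ∀ i j l : G, ∀ a b c : A, a ∈ 𝒜 i → b ∈ 𝒜 j → c ∈ 𝒜 l → j ≠ 0 →
      motive (-(a * b * c)) := fun i j l a b c ha hb hc hj => by
    rw [← neg_mul, ← neg_mul]
    exact mul i j l _ b c (neg_mem ha) hb hc hj
  replace ha := TwoSidedIdeal.mem_span_iff_mem_addSubgroup_closure.1 (TwoSidedIdeal.mem_asIdeal.1 ha)
  rw [← AddSubgroup.mem_toAddSubmonoid, AddSubgroup.closure_toAddSubmonoid] at ha
  -- `ε` will be the identity or the negation, since as an additive monoid the closure is generated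
  -- by the products and their negatives.
  have key : ∀ (ε : A → A), (∀ x y, ε (x + y) = ε x + ε y) → ε 0 = 0 → (∀ i j l : G, ∀ a b c : A,
      a ∈ 𝒜 i → b ∈ 𝒜 j → c ∈ 𝒜 l → j ≠ 0 → motive (ε (a * b * c))) → ∀ r : A, ∀ j : G, j ≠ 0 →
      ∀ b ∈ 𝒜 j, ∀ s : A, motive (ε (r * b * s)) := by
    intro ε hε hε0 H r j hj b hb s
    induction r using alg_induction 𝒜 with
    | zero => rw [zero_mul, zero_mul, hε0]; exact zero
    | add r r' h h' => rw [add_mul, add_mul, hε]; exact add _ _ h h'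
    | homogeneous i r hr =>
      induction s using alg_induction 𝒜 with
      | zero => rw [mul_zero, hε0]; exact zero
      | add s s' h h' => rw [mul_add, hε]; exact add _ _ h h'
      | homogeneous l s hs => exact H i j l r b s hr hb hs hj
  induction ha using AddSubmonoid.closure_induction with
  | zero => exact zero
  | add x y _ _ hx hy => exact add x y hx hy
  | mem x hx =>
    rcases hx with hx | hx
    · obtain ⟨_, ⟨r, -, b, ⟨j, hj, hb⟩, rfl⟩, s, -, rfl⟩ := hx
      exact key id (fun _ _ => rfl) rfl mul r j hj b hb s
    · obtain ⟨_, ⟨r, -, b, ⟨j, hj, hb⟩, rfl⟩, s, -, hx⟩ := Set.mem_neg.1 hx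
      have := key (fun x => -x) (fun x y => neg_add x y) neg_zero neg r j hj b hb s
      rw [← neg_neg x, ← hx]
      exact this

theorem mul_mem_augmentationIdeal (a c : A) {b : A} {j : G} (hj : j ≠ 0) (hb : b ∈ 𝒜 j) :
    a * b * c ∈ augmentationIdeal 𝒜 :=
  Ideal.mul_mem_right c _ (Ideal.mul_mem_left _ a
    (TwoSidedIdeal.mem_asIdeal.2 (TwoSidedIdeal.subset_span ⟨j, hj, hb⟩)))

theorem op_mem_augmentationIdeal {a : A} :
    MulOpposite.op a ∈ augmentationIdeal (opGrading 𝒜) ↔ a ∈ augmentationIdeal 𝒜 := by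
  constructor
  · intro h
    refine augmentationIdeal_induction (motive := fun x : Aᵐᵒᵖ => x.unop ∈ augmentationIdeal 𝒜)
      (zero_mem _) (fun _ _ => add_mem) ?_ h
    intro i j l a b c _ hb _ hj
    rw [MulOpposite.unop_mul, MulOpposite.unop_mul, ← mul_assoc]
    exact mul_mem_augmentationIdeal _ _ hj (mem_opGrading.1 hb)
  · intro h
    refine augmentationIdeal_induction
      (motive := fun x => MulOpposite.op x ∈ augmentationIdeal (opGrading 𝒜))
      (zero_mem _) (fun _ _ => add_mem) ?_ h
    intro i j l a b c _ hb _ hj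
    rw [MulOpposite.op_mul, MulOpposite.op_mul, ← mul_assoc]
    exact mul_mem_augmentationIdeal _ _ hj (mem_opGrading.2 hb)

end GrMod

open GrMod

/-! ### Twisted isomorphisms of graded algebras -/

variable {B : Type u} [Ring B] [Algebra k B]

/-- A twisted isomorphism between two graded algebras. -/
structure TwistedIso (ℬ : G → Submodule k B) (𝒜 : G → Submodule k A) where
  θ : G → B ≃+ A
  mem_iff : ∀ (g : G) {h : G} {b : B}, θ g b ∈ 𝒜 h ↔ b ∈ ℬ h
  map_mul : ∀ (g : G) {h : G} (b : B) {b' : B}, b' ∈ ℬ h → θ g (b * b') = θ (h + g) b * θ g b'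
  map_one : ∀ g, θ g 1 = 1

namespace TwistedIso

variable {ℬ : G → Submodule k B} {𝒜 : G → Submodule k A}

/-- The inverse of a twisted isomorphism. -/
def symm (T : TwistedIso ℬ 𝒜) : TwistedIso 𝒜 ℬ where
  θ g := (T.θ g).symm
  mem_iff g h a := by rw [← T.mem_iff g, AddEquiv.apply_symm_apply]
  map_mul g h a a' ha' := by
    rw [AddEquiv.symm_apply_eq, T.map_mul g (h := h), AddEquiv.apply_symm_apply,
      AddEquiv.apply_symm_apply]
    rw [← T.mem_iff g, AddEquiv.apply_symm_apply]
    exact ha'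
  map_one g := by rw [AddEquiv.symm_apply_eq, T.map_one]

variable [GradedAlgebra ℬ] [GradedAlgebra 𝒜] (T : TwistedIso ℬ 𝒜)

/-- The components of the twist of a graded module. -/
def comp (M : GrMod 𝒜) : Components ℬ where
  V g := M.gr g
  -- The index of `θ` is the degree of the module element acted upon; the rule for `θ g (b * b')` is
  -- then exactly associativity of the action.
  act {_ g _} e b x := ⟨T.θ g b • (x : M), M.smul_mem' e ((T.mem_iff g).2 b.2) x.2⟩
  act_add e b x y := Subtype.ext (smul_add _ _ _)
  add_act {_ g _} e b b' x := Subtype.ext (by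
    change T.θ g (b + b') • (x : M) = T.θ g b • (x : M) + T.θ g b' • (x : M)
    rw [map_add, add_smul])
  one_act {g} x := Subtype.ext (by
    change T.θ g 1 • (x : M) = x
    rw [T.map_one, one_smul])
  mul_act {i h g g' g''} e e' e'' b b' x := Subtype.ext (by
    change T.θ g (b * b') • (x : M) = T.θ g' b • T.θ g b' • (x : M)
    rw [T.map_mul g b b'.2, e, mul_smul])

/-- The twist of a morphism. -/
def map {M N : GrMod 𝒜} (f : M ⟶ N) : (T.comp M).toGrMod ⟶ (T.comp N).toGrMod :=
  Components.desc (D := T.comp M)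
    (fun g => ((T.comp N).ι g).comp
      ((f.lin.toAddMonoidHom.comp (M.gr g).subtype).codRestrict (N.gr g) fun x => f.map_mem x.2))
    (fun g x => (T.comp N).ι_mem g _)
    (fun h g b hb x => by
      refine Eq.trans ?_ ((T.comp N).smul_ι rfl hb _).symm
      exact congrArg ((T.comp N).ι (h + g)) (Subtype.ext (f.lin.map_smul _ _)))

theorem map_ι {M N : GrMod 𝒜} (f : M ⟶ N) {g : G} (x : M.gr g) :
    (T.map f).lin ((T.comp M).ι g x) = (T.comp N).ι g ⟨f.lin x, f.map_mem x.2⟩ :=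
  Components.desc_ι (D := T.comp M) _ _ _ x

/-- The twist functor. -/
def functor : GrMod 𝒜 ⥤ GrMod ℬ where
  obj M := (T.comp M).toGrMod
  map f := T.map f
  map_id M := Components.hom_ext fun g x => T.map_ι (𝟙 M) x
  map_comp {M N P} f f' := Components.hom_ext fun g x => by
    refine (T.map_ι (f ≫ f') x).trans ?_
    refine Eq.trans ?_ (congrArg (T.map f').lin (T.map_ι f x)).symm
    exact (T.map_ι f' ⟨f.lin (show M.gr g from x).1, f.map_mem x.2⟩).symm

theorem functor_map_ι {M N : GrMod 𝒜} (f : M ⟶ N) {g : G} (x : M.gr g) :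
    (T.functor.map f).lin ((T.comp M).ι g x) = (T.comp N).ι g ⟨f.lin x, f.map_mem x.2⟩ :=
  T.map_ι f x

theorem ι_inj {M : GrMod 𝒜} {g : G} {x y : M.gr g} (h : (T.comp M).ι g x = (T.comp M).ι g y) :
    (x : M) = y := congrArg Subtype.val ((T.comp M).ι_injective g h)

instance : T.functor.Faithful where
  map_injective {M N} f f' h := hom_ext_gr fun g x hx => by
    have := congr_lin h ((T.comp M).ι g ⟨x, hx⟩)
    exact T.ι_inj ((T.functor_map_ι f ⟨x, hx⟩).symm.trans (this.trans
      (T.functor_map_ι f' ⟨x, hx⟩)))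

instance : T.functor.Full where
  map_surjective {M N} f := by
    refine ⟨homMk (fun g => ((T.comp N).grEquiv g).symm.toAddMonoidHom.comp
      ((((f.lin.toAddMonoidHom).comp ((T.comp M).ι g))).codRestrict ((T.comp N).toGrMod.gr g)
        fun x => f.map_mem ((T.comp M).ι_mem g x))) ?_, ?_⟩
    · intro h g a ha x hx
      -- Every homogeneous `a` acts on the component of degree `g` as some homogeneous `b` does on
      -- the twist, so linearity over `B` gives linearity over `A`.
      obtain ⟨b, rfl⟩ := (T.θ g).surjective a
      have hb := (T.mem_iff g).1 ha
      have := (T.comp N).grEquiv_symm_smul rfl hb (f.map_mem ((T.comp M).ι_mem g ⟨x, hx⟩))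
        ((T.comp N).toGrMod.smul_mem hb (f.map_mem ((T.comp M).ι_mem g ⟨x, hx⟩)))
      refine Eq.trans ?_ (congrArg Subtype.val this)
      refine congrArg Subtype.val (congrArg ((T.comp N).grEquiv (h + g)).symm (Subtype.ext ?_))
      refine Eq.trans ?_ (f.lin.map_smul b ((T.comp M).ι g ⟨x, hx⟩))
      exact congrArg f.lin ((T.comp M).smul_ι rfl hb ⟨x, hx⟩).symm
    · refine Components.hom_ext fun g x => ?_
      refine (T.functor_map_ι _ x).trans ?_
      refine Eq.trans ?_ ((T.comp N).ι_grEquiv_symm g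
        ⟨_, f.map_mem ((T.comp M).ι_mem g x)⟩)
      exact congrArg _ (Subtype.ext (homMk_of_mem _ _ x.2))

/-- Twisting `N` by the inverse family and then by `T`, an element `b` acts on `N_g` through `θ_g⁻¹
(θ_g b) = b`. -/
instance : T.functor.EssSurj where
  mem_essImage N := by
    let M : GrMod 𝒜 := T.symm.functor.obj N
    let f : T.functor.obj M ⟶ N := Components.desc (D := T.comp M)
      (fun g => (N.gr g).subtype.comp ((T.symm.comp N).grEquiv g).symm.toAddMonoidHom)
      (fun g x => Subtype.prop _)
      (fun h g b hb x => by
        refine (congrArg Subtype.val ((T.symm.comp N).grEquiv_symm_smul rfl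
          ((T.mem_iff g).2 hb) x.2 ((T.symm.comp N).toGrMod.smul_mem
          ((T.mem_iff g).2 hb) x.2))).trans ?_
        change (T.θ g).symm (T.θ g b) • _ = _
        rw [AddEquiv.symm_apply_apply]
        rfl)
    have hf : ∀ g x, f.lin ((T.comp M).ι g x) = 
        ((show N.gr g from ((T.symm.comp N).grEquiv g).symm x) : N) :=
      fun g x => Components.desc_ι (D := T.comp M) _ _ _ x
    have : IsIso f := isIso_of_bijective (bijective_of_gr f
      (by
        rintro g _ ⟨x, rfl⟩ hx
        have h0 : ((T.symm.comp N).grEquiv g).symm x = 0 :=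
          Subtype.ext ((hf g x).symm.trans hx)
        have h1 := ((T.symm.comp N).grEquiv g).symm.injective (h0.trans (map_zero _).symm)
        exact (congrArg ((T.comp M).ι g) h1).trans (map_zero _))
      (fun g y hy => ⟨(T.comp M).ι g ((T.symm.comp N).grEquiv g ⟨y, hy⟩),
        (hf g _).trans (congrArg Subtype.val
          (((T.symm.comp N).grEquiv g).symm_apply_apply ⟨y, hy⟩))⟩))
    exact ⟨M, ⟨asIso f⟩⟩

instance : T.functor.IsEquivalence where

instance : T.functor.Additive where
  map_add {M N f f'} := Components.hom_ext fun g x => by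
    refine (T.functor_map_ι _ x).trans ?_
    refine Eq.trans ?_ (congrArg₂ (· + ·) (T.functor_map_ι f x).symm (T.functor_map_ι f' x).symm)
    exact map_add ((T.comp N).ι g) ⟨f.lin (show M.gr g from x).1, f.map_mem x.2⟩
      ⟨f'.lin (show M.gr g from x).1, f'.map_mem x.2⟩

end TwistedIso

/-! ### Comparison of dimensions -/

section Dimensions

universe w₁ w₂ w₃ w₄

variable {C : Type w₁} [Category.{w₂} C] [Abelian C] {D : Type w₃} [Category.{w₄} D] [Abelian D]

theorem injectiveDimension_le_of_forall {X : C} {Y : D}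
    (h : ∀ n, HasInjectiveDimensionLT Y n → HasInjectiveDimensionLT X n) :
    injectiveDimension X ≤ injectiveDimension Y :=
  sInf_le_sInf fun _ hn i hi => h i (hn i hi)

theorem projectiveDimension_le_of_forall {X : C} {Y : D}
    (h : ∀ n, HasProjectiveDimensionLT Y n → HasProjectiveDimensionLT X n) :
    projectiveDimension X ≤ projectiveDimension Y :=
  sInf_le_sInf fun _ hn i hi => h i (hn i hi)

variable (e : C ≌ D) [EnoughInjectives C] [EnoughInjectives D] [e.functor.Additive]

/-- Both functors of an equivalence are exact right adjoints preserving injectives, so neither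
raises the injective dimension. -/
theorem injectiveDimension_obj_of_equivalence (X : C) :
    injectiveDimension (e.functor.obj X) = injectiveDimension X := by
  have : e.inverse.Additive := inferInstance
  have : e.symm.inverse.Additive := inferInstanceAs e.functor.Additive
  refine le_antisymm (injectiveDimension_le_of_forall fun n _ =>
    hasInjectiveDimensionLT_of_adj e.symm.toAdjunction X n)
    (injectiveDimension_le_of_forall fun n _ => ?_)
  have : HasInjectiveDimensionLT ((e.functor ⋙ e.inverse).obj X) n :=
    hasInjectiveDimensionLT_of_adj e.toAdjunction (e.functor.obj X) n
  exact hasInjectiveDimensionLT_of_iso (e.unitIso.app X).symm n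

theorem projectiveDimension_obj_of_equivalence (X : C) :
    projectiveDimension (e.functor.obj X) = projectiveDimension X := by
  have : e.inverse.Additive := inferInstance
  have : e.symm.inverse.Additive := inferInstanceAs e.functor.Additive
  refine le_antisymm (projectiveDimension_le_of_forall fun n _ =>
    hasProjectiveDimensionLT_of_adj e.toAdjunction X n)
    (projectiveDimension_le_of_forall fun n _ => ?_)
  have : HasProjectiveDimensionLT ((e.functor ⋙ e.inverse).obj X) n :=
    hasProjectiveDimensionLT_of_adj e.symm.toAdjunction (e.functor.obj X) n
  exact hasProjectiveDimensionLT_of_iso (e.unitIso.app X).symm n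

end Dimensions

/-! ### Comparison of torsion functors -/

namespace GrMod

section

variable {𝒜 : G → Submodule k A} [GradedAlgebra 𝒜]

theorem le_of_gr {M : GrMod 𝒜} {S S' : Submodule A M} (hS : ∀ g, ∀ x ∈ S, M.proj g x ∈ S)
    (h : ∀ g, ∀ x ∈ M.gr g, x ∈ S → x ∈ S') : S ≤ S' := fun x hx => by
  obtain ⟨s, hs⟩ := M.sum_proj x
  rw [hs]
  exact sum_mem fun g _ => h g _ (M.proj_mem g x) (hS g x hx)

theorem forall_smul_eq_zero {I : Ideal A} (hI : I.IsHomogeneous 𝒜) {M : Type*} [AddCommGroup M]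
    [Module A M] {x : M}
    (h : ∀ g, ∀ a ∈ 𝒜 g, a ∈ I → a • x = 0) : ∀ a ∈ I, a • x = 0 := fun a ha => by
  classical
  rw [← DirectSum.sum_support_decompose 𝒜 a, Finset.sum_smul]
  exact Finset.sum_eq_zero fun g _ => h g _ (SetLike.coe_mem _) (hI g ha)

/-- The inclusion of the torsion submodule. -/
def torsionι (𝔞 : Ideal A) [𝔞.IsTwoSided] (h𝔞 : 𝔞.IsHomogeneous 𝒜) (M : GrMod 𝒜) :
    (torsion 𝔞 h𝔞).obj M ⟶ M := ⟨(torsionSubmodule 𝔞 M).subtype, fun h => h⟩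

theorem torsionι_injective (𝔞 : Ideal A) [𝔞.IsTwoSided] (h𝔞 : 𝔞.IsHomogeneous 𝒜) (M : GrMod 𝒜) :
    Function.Injective (torsionι 𝔞 h𝔞 M).lin := Subtype.val_injective

theorem mem_torsionSubmodule_iff {𝔞 : Ideal A} [𝔞.IsTwoSided] (h𝔞 : 𝔞.IsHomogeneous 𝒜)
    {M : GrMod 𝒜} {x : M} : x ∈ torsionSubmodule 𝔞 M ↔
      ∃ n : ℕ, ∀ g, ∀ a ∈ 𝒜 g, a ∈ 𝔞 ^ n → a • x = 0 :=
  ⟨fun ⟨n, h⟩ => ⟨n, fun _ a _ ha => h a ha⟩,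
    fun ⟨n, h⟩ => ⟨n, forall_smul_eq_zero (isHomogeneous_pow h𝔞 n) h⟩⟩

theorem proj_mem_range {M N : GrMod 𝒜} (f : M ⟶ N) (g : G) (x : N)
    (hx : x ∈ LinearMap.range f.lin) : N.proj g x ∈ LinearMap.range f.lin := by
  obtain ⟨y, rfl⟩ := hx
  exact ⟨M.proj g y, lin_proj f g y⟩

/-- Two injective morphisms with the same range have isomorphic sources. -/
def isoOfRange {M M' N : GrMod 𝒜} (f : M ⟶ N) (f' : M' ⟶ N) (hf : Function.Injective f.lin)
    (hf' : Function.Injective f'.lin) (h : LinearMap.range f.lin = LinearMap.range f'.lin) :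
    M ≅ M' where
  hom := liftMono hf' f fun x => h ▸ ⟨x, rfl⟩
  inv := liftMono hf f' fun x => h ▸ ⟨x, rfl⟩
  hom_inv_id := by
    have := mono_of_injective hf
    rw [← cancel_mono f, Category.assoc, liftMono_comp, liftMono_comp, Category.id_comp]
  inv_hom_id := by
    have := mono_of_injective hf'
    rw [← cancel_mono f', Category.assoc, liftMono_comp, liftMono_comp, Category.id_comp]

theorem isoOfRange_hom_comp {M M' N : GrMod 𝒜} (f : M ⟶ N) (f' : M' ⟶ N)
    (hf : Function.Injective f.lin) (hf' : Function.Injective f'.lin)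
    (h : LinearMap.range f.lin = LinearMap.range f'.lin) :
    (isoOfRange f f' hf hf' h).hom ≫ f' = f := liftMono_comp _ _ _

end

variable {H : Type} [AddCommGroup H] [DecidableEq H] {B : Type u} [Ring B] [Algebra k B]

variable {𝒜 : G → Submodule k A} [GradedAlgebra 𝒜] {ℬ : H → Submodule k B} [GradedAlgebra ℬ]

/-- A criterion for a functor to commute with torsion functors. -/
def torsionCompIso (K : GrMod 𝒜 ⥤ GrMod ℬ) {𝔞 : Ideal A} [𝔞.IsTwoSided]
    (h𝔞 : 𝔞.IsHomogeneous 𝒜) {𝔟 : Ideal B} [𝔟.IsTwoSided] (h𝔟 : 𝔟.IsHomogeneous ℬ)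
    (inj : ∀ M, Function.Injective (K.map (torsionι 𝔞 h𝔞 M)).lin)
    (range : ∀ M, ∀ h, ∀ y ∈ (K.obj M).gr h, y ∈ torsionSubmodule 𝔟 (K.obj M) ↔
      y ∈ LinearMap.range (K.map (torsionι 𝔞 h𝔞 M)).lin) :
    K ⋙ torsion 𝔟 h𝔟 ≅ torsion 𝔞 h𝔞 ⋙ K :=
  have hr : ∀ M, LinearMap.range (torsionι 𝔟 h𝔟 (K.obj M)).lin =
      LinearMap.range (K.map (torsionι 𝔞 h𝔞 M)).lin := fun M =>
    (Submodule.range_subtype _).trans (le_antisymm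
      (le_of_gr (proj_mem_torsionSubmodule 𝔟 h𝔟 _) fun g x hx h => (range M g x hx).1 h)
      (le_of_gr (proj_mem_range _) fun g x hx h => (range M g x hx).2 h))
  NatIso.ofComponents (fun M => isoOfRange (torsionι 𝔟 h𝔟 (K.obj M)) (K.map (torsionι 𝔞 h𝔞 M))
    (torsionι_injective _ _ _) (inj M) (hr M)) fun {M N} f => by
      have := mono_of_injective (inj N)
      rw [← cancel_mono (K.map (torsionι 𝔞 h𝔞 N)), Category.assoc, Category.assoc,
        isoOfRange_hom_comp]
      have e : (torsion 𝔞 h𝔞 ⋙ K).map f ≫ K.map (torsionι 𝔞 h𝔞 N) =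
          K.map (torsionι 𝔞 h𝔞 M) ≫ K.map f := by
        rw [Functor.comp_map, ← K.map_comp, ← K.map_comp]
        rfl
      rw [e, ← Category.assoc, isoOfRange_hom_comp]
      rfl

end GrMod

open GrMod Abelian

/-- Isomorphic objects have isomorphic `Ext` groups. -/
def extCongr {C : Type*} [Category C] [Abelian C] [HasExt C] {X X' Y Y' : C} (e : X ≅ X')
    (f : Y ≅ Y') (n : ℕ) : Ext X Y n ≃+ Ext X' Y' n where
  toFun x := (Ext.mk₀ e.inv).comp (x.comp (Ext.mk₀ f.hom) (add_zero n)) (zero_add n)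
  invFun x := (Ext.mk₀ e.hom).comp (x.comp (Ext.mk₀ f.inv) (add_zero n)) (zero_add n)
  left_inv x := by simp
  right_inv x := by simp
  map_add' x y := by simp

theorem GrMod.exists_mem_gr_of_mem_range {𝒜 : G → Submodule k A} {M N : GrMod 𝒜} {f : M ⟶ N} {g : G}
    {y : N} (hy : y ∈ N.gr g) (h : y ∈ LinearMap.range f.lin) : ∃ x ∈ M.gr g, f.lin x = y := by
  obtain ⟨x, rfl⟩ := h
  exact ⟨M.proj g x, M.proj_mem g x, by rw [lin_proj, N.proj_same hy]⟩

namespace TwistedIso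

variable {B : Type u} [Ring B] [Algebra k B] {ℬ : G → Submodule k B} {𝒜 : G → Submodule k A}
  [GradedAlgebra ℬ] [GradedAlgebra 𝒜] (T : TwistedIso ℬ 𝒜)

/-! ### Invariance under twists -/

/-- For homogeneous factors, `θ_g (a b c)` is `θ_{j+l+g} (a) θ_{l+g} (b) θ_g (c)`, whose middle
factor still has the nonzero degree `j`. -/
theorem mem_augmentationIdeal_of_mem (g : G) {b : B} (hb : b ∈ augmentationIdeal ℬ) :
    T.θ g b ∈ augmentationIdeal 𝒜 := by
  refine augmentationIdeal_induction (motive := fun b => T.θ g b ∈ augmentationIdeal 𝒜)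
    (by rw [map_zero]; exact zero_mem _) (fun a b ha hb => by rw [map_add]; exact add_mem ha hb)
    ?_ hb
  intro i j l a b c _ hb hc hj
  rw [T.map_mul g _ hc, T.map_mul _ a hb]
  exact mul_mem_augmentationIdeal _ _ hj ((T.mem_iff _).2 hb)

/-- The index of `θ` on the left factor changes with the degree of the right one, so the induction
is uniform in `g` and the right factor is split into components. -/
theorem mem_augmentationIdeal_pow_of_mem (n : ℕ) (g : G) {b : B}
    (hb : b ∈ augmentationIdeal ℬ ^ n) : T.θ g b ∈ augmentationIdeal 𝒜 ^ n := by
  classical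
  induction n generalizing b g with
  | zero => rw [Submodule.pow_zero, Ideal.one_eq_top]; trivial
  | succ n ih =>
    rw [Submodule.pow_succ] at hb ⊢
    induction hb using Submodule.mul_induction_on' with
    | add x _ y _ hx hy => rw [map_add]; exact add_mem hx hy
    | mem_mul_mem x hx y hy =>
      rw [← DirectSum.sum_support_decompose ℬ y, Finset.mul_sum, map_sum]
      refine sum_mem fun h _ => ?_
      rw [T.map_mul g x (SetLike.coe_mem _)]
      exact Submodule.mul_mem_mul (ih _ hx)
        (T.mem_augmentationIdeal_of_mem g (augmentationIdeal_isHomogeneous ℬ h hy))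

theorem mem_augmentationIdeal_pow_iff (n : ℕ) (g : G) {b : B} :
    T.θ g b ∈ augmentationIdeal 𝒜 ^ n ↔ b ∈ augmentationIdeal ℬ ^ n := by
  refine ⟨fun h => ?_, T.mem_augmentationIdeal_pow_of_mem n g⟩
  have : T.symm.θ g (T.θ g b) ∈ augmentationIdeal ℬ ^ n :=
    T.symm.mem_augmentationIdeal_pow_of_mem n g h
  rwa [show T.symm.θ g (T.θ g b) = b from (T.θ g).symm_apply_apply b] at this

theorem mem_augmentationIdeal_iff (g : G) {b : B} :
    T.θ g b ∈ augmentationIdeal 𝒜 ↔ b ∈ augmentationIdeal ℬ := by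
  have := T.mem_augmentationIdeal_pow_iff 1 g (b := b)
  rwa [Submodule.pow_one, Submodule.pow_one] at this

/-- The inclusion of a homogeneous component in the twist of a graded module. -/
def inc (M : GrMod 𝒜) (g : G) : M.gr g →+ T.functor.obj M := (T.comp M).ι g

theorem inc_mem {M : GrMod 𝒜} {g : G} (x : M.gr g) : T.inc M g x ∈ (T.functor.obj M).gr g :=
  (T.comp M).ι_mem g x

theorem inc_injective (M : GrMod 𝒜) (g : G) : Function.Injective (T.inc M g) :=
  (T.comp M).ι_injective g

theorem exists_inc_eq {M : GrMod 𝒜} {g : G} {y : T.functor.obj M}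
    (hy : y ∈ (T.functor.obj M).gr g) : ∃ x : M.gr g, T.inc M g x = y := hy

theorem smul_inc {M : GrMod 𝒜} {h g g' : G} (e : h + g = g') {b : B} (hb : b ∈ ℬ h) (x : M.gr g) :
    b • T.inc M g x = T.inc M g' ⟨T.θ g b • (x : M), M.smul_mem' e ((T.mem_iff g).2 hb) x.2⟩ :=
  (T.comp M).smul_ι e hb x

theorem functor_map_inc {M N : GrMod 𝒜} (f : M ⟶ N) {g : G} (x : M.gr g) :
    (T.functor.map f).lin (T.inc M g x) = T.inc N g ⟨f.lin x, f.map_mem x.2⟩ :=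
  T.map_ι f x

theorem smul_inc_eq_zero_iff {M : GrMod 𝒜} {g h : G} {b : B} (hb : b ∈ ℬ h) (x : M.gr g) :
    b • T.inc M g x = 0 ↔ T.θ g b • (x : M) = 0 := by
  rw [T.smul_inc rfl hb, map_eq_zero_iff _ (T.inc_injective M _), Subtype.ext_iff]
  rfl

/-- On the component of degree `g`, being killed by `b` means being killed by `θ_g b`, and `θ_g`
matches the homogeneous elements of the powers of the two augmentation ideals. -/
theorem inc_mem_torsionSubmodule_iff {M : GrMod 𝒜} {g : G} (x : M.gr g) :
    T.inc M g x ∈ torsionSubmodule (augmentationIdeal ℬ) (T.functor.obj M) ↔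
      (x : M) ∈ torsionSubmodule (augmentationIdeal 𝒜) M := by
  rw [mem_torsionSubmodule_iff (augmentationIdeal_isHomogeneous ℬ),
    mem_torsionSubmodule_iff (augmentationIdeal_isHomogeneous 𝒜)]
  refine exists_congr fun n => forall_congr' fun h => ⟨fun H a ha ha' => ?_, fun H b hb hb' => ?_⟩
  · obtain ⟨b, rfl⟩ := (T.θ g).surjective a
    have hb := (T.mem_iff g).1 ha
    exact (T.smul_inc_eq_zero_iff hb x).1
      (H b hb ((T.mem_augmentationIdeal_pow_iff n g).1 ha'))
  · exact (T.smul_inc_eq_zero_iff hb x).2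
      (H _ ((T.mem_iff g).2 hb) ((T.mem_augmentationIdeal_pow_iff n g).2 hb'))

theorem functor_map_injective {M N : GrMod 𝒜} {f : M ⟶ N} (hf : Function.Injective f.lin) :
    Function.Injective (T.functor.map f).lin := by
  have := mono_of_injective hf
  exact injective_of_mono

/-- Twists commute with torsion. -/
def functorTorsionIso : T.functor ⋙ torsion _ (augmentationIdeal_isHomogeneous ℬ) ≅
    torsion _ (augmentationIdeal_isHomogeneous 𝒜) ⋙ T.functor :=
  torsionCompIso T.functor (augmentationIdeal_isHomogeneous 𝒜) (augmentationIdeal_isHomogeneous ℬ)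
    (fun M => T.functor_map_injective (torsionι_injective _ _ _)) fun M g y hy => by
      obtain ⟨x, rfl⟩ := T.exists_inc_eq hy
      refine (T.inc_mem_torsionSubmodule_iff x).trans ⟨fun h => ?_, fun h => ?_⟩
      · exact ⟨T.inc _ g ⟨⟨x, h⟩, x.2⟩, T.functor_map_inc (torsionι _ _ M) _⟩
      · obtain ⟨z, hz, hz'⟩ := exists_mem_gr_of_mem_range hy h
        obtain ⟨w, rfl⟩ := T.exists_inc_eq hz
        have := T.inc_injective M g ((T.functor_map_inc _ w).symm.trans hz')
        rw [← this]
        exact w.1.2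

instance : T.functor.asEquivalence.functor.Additive := inferInstanceAs T.functor.Additive

theorem isZero_localCohomology_iff (n : ℕ) (M : GrMod 𝒜) :
    IsZero ((localCohomology _ (augmentationIdeal_isHomogeneous ℬ) n).obj (T.functor.obj M)) ↔
      IsZero ((localCohomology _ (augmentationIdeal_isHomogeneous 𝒜) n).obj M) :=
  isZero_rightDerived_obj_iff T.functor _ _ T.functorTorsionIso
    (fun X hX => by
      rw [IsZero.iff_id_eq_zero] at hX ⊢
      apply T.functor.map_injective
      rw [T.functor.map_id, hX, Functor.map_zero]) n M

theorem one_mem_shift_neg (𝒜 : G → Submodule k A) [GradedAlgebra 𝒜] (g : G) :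
    toShift 𝒜 g 1 ∈ ((regularModule 𝒜).shift g).gr (-g) := one_mem_shift g (add_neg_cancel g)

/-- The comparison morphism of the shifts of the regular modules. -/
def shiftHom (g : G) : (regularModule ℬ).shift g ⟶ T.functor.obj ((regularModule 𝒜).shift g) :=
  ofElem (add_neg_cancel g) (T.inc_mem ⟨toShift 𝒜 g 1, one_mem_shift_neg 𝒜 g⟩)

/-- The index is `-g` because the generator `1` of `A[g]` lies in degree `-g`. -/
theorem shiftHom_apply (g : G) {t : G} {b : B} (hb : b ∈ ℬ (t + g))
    (hb' : toShift 𝒜 g (T.θ (-g) b) ∈ ((regularModule 𝒜).shift g).gr t) :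
    (T.shiftHom g).lin (toShift ℬ g b) = T.inc _ t ⟨toShift 𝒜 g (T.θ (-g) b), hb'⟩ := by
  refine (T.smul_inc (g' := t) (by abel) hb _).trans (congrArg (T.inc _ t) (Subtype.ext ?_))
  exact mul_one (T.θ (-g) b)

instance (g : G) : IsIso (T.shiftHom g) := by
  refine isIso_of_bijective (bijective_of_gr _ (fun t x hx h0 => ?_) fun t y hy => ?_)
  · have h1 := (T.shiftHom_apply g (t := t) (b := ofShift x) hx ((T.mem_iff _).2 hx)).symm.trans h0
    have h2 := congrArg Subtype.val ((map_eq_zero_iff _ (T.inc_injective _ _)).1 h1)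
    exact (map_eq_zero_iff (T.θ (-g)) (T.θ (-g)).injective).1 h2
  · obtain ⟨x, rfl⟩ := T.exists_inc_eq hy
    obtain ⟨b, hb⟩ := (T.θ (-g)).surjective (ofShift x.1)
    have hb' : b ∈ ℬ (t + g) := (T.mem_iff (-g)).1 (by rw [hb]; exact x.2)
    refine ⟨toShift ℬ g b, (T.shiftHom_apply g hb' ((T.mem_iff _).2 hb')).trans
      (congrArg (T.inc _ t) (Subtype.ext hb))⟩

/-- Right multiplication by `b` corresponds to that by `θ_{-g'} b`, with an index depending on the
target shift. Hence the right actions on graded `Ext` agree only after a degree-dependent twist. -/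
theorem rightMul_shiftHom {g h g' : G} (e : g + h = g') {b : B} (hb : b ∈ ℬ h) :
    rightMul e hb ≫ T.shiftHom g' =
      T.shiftHom g ≫ T.functor.map (rightMul e ((T.mem_iff (-g')).2 hb)) := by
  refine shift_hom_ext ?_
  have e' : -g + g' = h := by rw [← e]; abel
  have hb1 : b ∈ ℬ (-g + g') := by rw [e']; exact hb
  refine (congrArg (T.shiftHom g').lin (rightMul_one e hb)).trans ?_
  refine (T.shiftHom_apply g' hb1 ((T.mem_iff _).2 hb1)).trans ?_
  refine Eq.trans ?_ (congrArg (T.functor.map (rightMul e ((T.mem_iff (-g')).2 hb))).lin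
    (one_smul B (T.inc _ (-g) ⟨toShift 𝒜 g 1, one_mem_shift_neg 𝒜 g⟩))).symm
  refine Eq.trans ?_ (T.functor_map_inc _ _).symm
  exact congrArg (T.inc _ (-g)) (Subtype.ext (one_mul (T.θ (-g') b)).symm)

/-- The comparison morphism of the trivial modules. -/
def trivialHom : trivialModule ℬ ⟶ T.functor.obj (trivialModule 𝒜) :=
  ofTrivial (T.inc_mem ⟨trivialMk 𝒜 1, trivialMk_mem SetLike.GradedOne.one_mem⟩)
    (forall_smul_eq_zero (augmentationIdeal_isHomogeneous ℬ) fun g a ha ha' => by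
      rw [T.smul_inc_eq_zero_iff ha, smul_trivialMk, mul_one, trivialMk_eq_zero]
      exact T.mem_augmentationIdeal_of_mem 0 ha')

theorem trivialHom_mk {t : G} {b : B} (hb : b ∈ ℬ t) :
    T.trivialHom.lin (trivialMk ℬ b) =
      T.inc _ t ⟨trivialMk 𝒜 (T.θ 0 b), trivialMk_mem ((T.mem_iff 0).2 hb)⟩ := by
  refine (T.smul_inc (g' := t) (add_zero t) hb _).trans (congrArg (T.inc _ t) (Subtype.ext ?_))
  exact (smul_trivialMk _ _).trans (congrArg _ (mul_one _))

instance : IsIso T.trivialHom := by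
  refine isIso_of_bijective (bijective_of_gr _ (fun t x hx h0 => ?_) fun t y hy => ?_)
  · obtain ⟨b, hb, rfl⟩ := exists_trivialMk_eq hx
    have h2 := congrArg Subtype.val ((map_eq_zero_iff _ (T.inc_injective _ _)).1
      ((T.trivialHom_mk hb).symm.trans h0))
    exact trivialMk_eq_zero.2 ((T.mem_augmentationIdeal_iff 0).1 (trivialMk_eq_zero.1 h2))
  · obtain ⟨⟨x, hx⟩, rfl⟩ := T.exists_inc_eq hy
    obtain ⟨a, ha, rfl⟩ := exists_trivialMk_eq hx
    obtain ⟨b, rfl⟩ := (T.θ 0).surjective a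
    exact ⟨trivialMk ℬ b, T.trivialHom_mk ((T.mem_iff 0).1 ha)⟩

/-- The comparison of the graded `Ext` groups. -/
def gradedExtEquiv (i : ℕ) (g : G) : gradedExt 𝒜 i g ≃+ gradedExt ℬ i g :=
  (AddEquiv.ofBijective (T.functor.mapExtAddHom (trivialModule 𝒜) ((regularModule 𝒜).shift g) i)
    (Functor.mapExt_bijective_of_preservesInjectiveObjects _ _ _ _)).trans
  (extCongr (asIso T.trivialHom).symm (asIso (T.shiftHom g)).symm i)

theorem gradedExtEquiv_apply (i : ℕ) (g : G) (x : gradedExt 𝒜 i g) :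
    T.gradedExtEquiv i g x = (Ext.mk₀ T.trivialHom).comp
      ((x.mapExactFunctor T.functor).comp (Ext.mk₀ (inv (T.shiftHom g))) (add_zero i))
      (zero_add i) := rfl

theorem gradedExtEquiv_smul (i : ℕ) {g h g' : G} (e : g + h = g') {b : B} (hb : b ∈ ℬ h)
    (x : gradedExt 𝒜 i g) :
    T.gradedExtEquiv i g' (gradedExtSMul i e ((T.mem_iff (-g')).2 hb) x) =
      gradedExtSMul i e hb (T.gradedExtEquiv i g x) := by
  have e' : T.functor.map (rightMul e ((T.mem_iff (-g')).2 hb)) ≫ inv (T.shiftHom g') =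
      inv (T.shiftHom g) ≫ rightMul e hb := by
    rw [IsIso.comp_inv_eq, Category.assoc, rightMul_shiftHom, IsIso.inv_hom_id_assoc]
  rw [gradedExtEquiv_apply, gradedExtEquiv_apply, gradedExtSMul, gradedExtSMul,
    Ext.mapExactFunctor_comp, Ext.mapExactFunctor_mk₀, Ext.comp_assoc_of_third_deg_zero,
    Ext.comp_assoc_of_third_deg_zero, Ext.comp_assoc_of_third_deg_zero,
    Ext.mk₀_comp_mk₀, Ext.mk₀_comp_mk₀, e']

/-- The comparison of the trivial modules of the opposite algebras. -/
def opTrivialEquiv (s : G) : trivialModule (opGrading ℬ) ≃+ trivialModule (opGrading 𝒜) :=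
  QuotientAddGroup.congr (augmentationIdeal (opGrading ℬ)).toAddSubgroup
    (augmentationIdeal (opGrading 𝒜)).toAddSubgroup
    ((MulOpposite.opAddEquiv.symm.trans (T.θ s)).trans MulOpposite.opAddEquiv) (by
      ext x
      obtain ⟨a, rfl⟩ := MulOpposite.op_surjective x
      obtain ⟨b, rfl⟩ := (T.θ s).surjective a
      refine ⟨?_, fun h => ⟨MulOpposite.op b, op_mem_augmentationIdeal.2
        ((T.mem_augmentationIdeal_iff s).1 (op_mem_augmentationIdeal.1 h)), rfl⟩⟩
      rintro ⟨c, hc, hc'⟩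
      obtain ⟨c, rfl⟩ := MulOpposite.op_surjective c
      rw [← hc']
      exact op_mem_augmentationIdeal.2
        (T.mem_augmentationIdeal_of_mem s (op_mem_augmentationIdeal.1 hc)))

theorem opTrivialEquiv_mk (s : G) (b : B) :
    T.opTrivialEquiv s (trivialMk _ (MulOpposite.op b)) =
      trivialMk _ (MulOpposite.op (T.θ s b)) := rfl

theorem opTrivialEquiv_mem (s : G) {g : G} {x : trivialModule (opGrading ℬ)} :
    T.opTrivialEquiv s x ∈ (trivialModule (opGrading 𝒜)).gr g ↔
      x ∈ (trivialModule (opGrading ℬ)).gr g := by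
  constructor
  · intro h
    obtain ⟨a, ha, h'⟩ := exists_trivialMk_eq h
    obtain ⟨b, hb⟩ := (T.θ s).surjective a.unop
    have : x = trivialMk _ (MulOpposite.op b) := (T.opTrivialEquiv s).injective
      (by rw [← h', opTrivialEquiv_mk, hb]; rfl)
    rw [this]
    exact trivialMk_mem (mem_opGrading.2 ((T.mem_iff s).1 (hb ▸ mem_opGrading.1 ha)))
  · intro h
    obtain ⟨a, ha, rfl⟩ := exists_trivialMk_eq h
    exact trivialMk_mem (mem_opGrading.2 ((T.mem_iff s).2 (mem_opGrading.1 ha)))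

/-- With `s = -g'` and `g + h = g'` the index `h + s` is `-g`. The identifications with index `-g`
in degree `g` thus intertwine `b` with `θ_{-g'} b`, which is precisely how `b` acts on `Ext` across
the equivalence. -/
theorem opTrivialEquiv_smul (s : G) {h : G} {b : B} (hb : b ∈ ℬ h)
    (x : trivialModule (opGrading ℬ)) :
    T.opTrivialEquiv s (MulOpposite.op b • x) =
      MulOpposite.op (T.θ s b) • T.opTrivialEquiv (h + s) x := by
  obtain ⟨c, rfl⟩ := trivialMk_surjective x
  obtain ⟨c, rfl⟩ := MulOpposite.op_surjective c
  rw [smul_trivialMk, ← MulOpposite.op_mul, opTrivialEquiv_mk, opTrivialEquiv_mk, smul_trivialMk,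
    T.map_mul s c hb, MulOpposite.op_mul]

/-- The comparison of the components of the trivial modules of the opposite algebras. -/
def opTrivialGrEquiv (s ℓ g : G) : ((trivialModule (opGrading ℬ)).shift ℓ).gr g ≃+
    ((trivialModule (opGrading 𝒜)).shift ℓ).gr g :=
  AddEquiv.ofBijective
    (((T.opTrivialEquiv s).toAddMonoidHom.comp (AddSubgroup.subtype
      ((trivialModule (opGrading ℬ)).gr (g + ℓ)))).codRestrict
      ((trivialModule (opGrading 𝒜)).gr (g + ℓ)) fun x => (T.opTrivialEquiv_mem s).2 x.2)
    ⟨fun x y h => Subtype.ext ((T.opTrivialEquiv s).injective (congrArg Subtype.val h)),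
      fun ⟨y, hy⟩ => by
        obtain ⟨x, rfl⟩ := (T.opTrivialEquiv s).surjective y
        exact ⟨⟨x, (T.opTrivialEquiv_mem s).1 hy⟩, rfl⟩⟩

include T

theorem injectiveDimension_regularModule :
    injectiveDimension (regularModule ℬ) = injectiveDimension (regularModule 𝒜) := by
  rw [← injectiveDimension_eq_of_iso (shiftZeroIso (regularModule 𝒜)),
    ← injectiveDimension_eq_of_iso (shiftZeroIso (regularModule ℬ)),
    injectiveDimension_eq_of_iso (asIso (T.shiftHom 0))]
  exact injectiveDimension_obj_of_equivalence T.functor.asEquivalence _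

/-- The component of degree `g` of the given isomorphism is corrected by `θ_{-g}` on the trivial
right module, which absorbs the twist of the right action on `Ext`. Neither the dimension nor the
shift changes. -/
theorem isLeftASGorensteinWith {n : ℕ} {ℓ : G} (h : IsLeftASGorensteinWith 𝒜 n ℓ) :
    IsLeftASGorensteinWith ℬ n ℓ where
  injectiveDimension_eq := T.injectiveDimension_regularModule.trans h.injectiveDimension_eq
  ext_eq_zero i hi g := by
    have := h.ext_eq_zero i hi g
    exact (T.gradedExtEquiv i g).symm.toEquiv.subsingleton
  ext_iso := by
    obtain ⟨e, he⟩ := h.ext_iso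
    refine ⟨fun g => ((T.gradedExtEquiv n g).symm.trans (e g)).trans
      (T.opTrivialGrEquiv (-g) ℓ g).symm, ?_⟩
    intro g h g' hg b hb x
    obtain ⟨x, rfl⟩ := (T.gradedExtEquiv n g).surjective x
    rw [← T.gradedExtEquiv_smul]
    simp only [AddEquiv.trans_apply, AddEquiv.symm_apply_apply]
    obtain ⟨y, hy⟩ := (T.opTrivialGrEquiv (-g) ℓ g).surjective (e g x)
    rw [← hy, AddEquiv.symm_apply_apply]
    apply (T.opTrivialEquiv (-g')).injective
    refine (congrArg Subtype.val ((T.opTrivialGrEquiv (-g') ℓ g').apply_symm_apply _)).trans ?_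
    refine (he g h g' hg _ _ x).trans ?_
    refine Eq.trans ?_ (T.opTrivialEquiv_smul (-g') hb _).symm
    rw [← hy, show h + -g' = -g by rw [← hg]; abel]
    rfl

theorem gradedGlobalDimension_le : gradedGlobalDimension 𝒜 ≤ gradedGlobalDimension ℬ :=
  iSup_le fun M => by
    rw [← projectiveDimension_obj_of_equivalence T.functor.asEquivalence M]
    exact le_iSup (fun M : GrMod ℬ => projectiveDimension M) _

theorem gradedGlobalDimension_eq : gradedGlobalDimension ℬ = gradedGlobalDimension 𝒜 :=
  le_antisymm T.symm.gradedGlobalDimension_le T.gradedGlobalDimension_le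

theorem isZero_localCohomology_regularModule_iff (n : ℕ) :
    IsZero ((localCohomology _ (augmentationIdeal_isHomogeneous ℬ) n).obj (regularModule ℬ)) ↔
      IsZero ((localCohomology _ (augmentationIdeal_isHomogeneous 𝒜) n).obj (regularModule 𝒜)) := by
  refine Iff.trans ?_ (T.isZero_localCohomology_iff n (regularModule 𝒜))
  exact ((localCohomology _ (augmentationIdeal_isHomogeneous ℬ) n).mapIso
    ((shiftZeroIso (regularModule ℬ)).symm ≪≫ asIso (T.shiftHom 0) ≪≫
      T.functor.mapIso (shiftZeroIso (regularModule 𝒜)))).isZero_iff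

theorem isASGorenstein (T' : TwistedIso (opGrading ℬ) (opGrading 𝒜)) (h : IsASGorenstein 𝒜) :
    IsASGorenstein ℬ := by
  obtain ⟨n, ℓ, h, h'⟩ := h
  exact ⟨n, ℓ, T.isLeftASGorensteinWith h, T'.isLeftASGorensteinWith h'⟩

theorem isASGorenstein_iff (T' : TwistedIso (opGrading ℬ) (opGrading 𝒜)) :
    IsASGorenstein 𝒜 ↔ IsASGorenstein ℬ :=
  ⟨T.isASGorenstein T', T.symm.isASGorenstein T'.symm⟩

theorem isASRegular_iff (T' : TwistedIso (opGrading ℬ) (opGrading 𝒜)) :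
    IsASRegular 𝒜 ↔ IsASRegular ℬ := by
  rw [IsASRegular, IsASRegular, T.isASGorenstein_iff T', T.gradedGlobalDimension_eq,
    T'.gradedGlobalDimension_eq]

theorem isASCohenMacaulay_iff (T' : TwistedIso (opGrading ℬ) (opGrading 𝒜)) :
    IsASCohenMacaulay 𝒜 ↔ IsASCohenMacaulay ℬ := by
  simp only [IsASCohenMacaulay, T.isZero_localCohomology_regularModule_iff,
    T'.isZero_localCohomology_regularModule_iff]

end TwistedIso

/-! ### Twisting systems as twisted isomorphisms, for the algebra and its opposite. -/

namespace NormalizedLeftTwistingSystem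

variable {𝒜 : G → Submodule k A} [GradedAlgebra 𝒜] (T : NormalizedLeftTwistingSystem 𝒜)

theorem τ_mem_iff (g : G) {h : G} {a : A} : T.τ g a ∈ 𝒜 h ↔ a ∈ 𝒜 h := by
  refine ⟨fun H => ?_, T.map_mem g h a⟩
  obtain ⟨b, hb, hb'⟩ := T.exists_map_eq g H
  rwa [← (T.τ g).injective hb']

/-- The twisted isomorphism defined by a twisting system. -/
def twistedIso : TwistedIso T.twistGrading 𝒜 where
  θ g := (T.τ g).toAddEquiv
  mem_iff g _ _ := T.τ_mem_iff g
  map_mul g {h} b b' hb' := by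
    refine (congrArg (T.τ g) (T.mul_of_mem (show A from b) (g' := h) hb')).trans ?_
    exact T.map_mul' g (show A from b) hb'
  map_one g := T.apply_one g

theorem τ_symm_mem (g : G) {h : G} {a : A} (ha : a ∈ 𝒜 h) : (T.τ g).symm a ∈ 𝒜 h := by
  rw [← T.τ_mem_iff g, LinearEquiv.apply_symm_apply]
  exact ha

/-- The map acting on the component of degree `g'` as `τ_{-g-g'}`. -/
def opHom (g : G) : A →+ A :=
  (regularModule 𝒜).addMk fun g' => (T.τ (-g - g')).toAddEquiv.toAddMonoidHom.comp
    (AddSubgroup.subtype ((regularModule 𝒜).gr g'))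

theorem opHom_of_mem (g : G) {g' : G} {a : A} (ha : a ∈ 𝒜 g') :
    T.opHom g a = T.τ (-g - g') a :=
  (regularModule 𝒜).addMk_of_mem _ ha

/-- The map acting on the component of degree `g'` as the inverse of `τ_{-g-g'}`. -/
def opInv (g : G) : A →+ A :=
  (regularModule 𝒜).addMk fun g' => (T.τ (-g - g')).symm.toAddEquiv.toAddMonoidHom.comp
    (AddSubgroup.subtype ((regularModule 𝒜).gr g'))

theorem opInv_of_mem (g : G) {g' : G} {a : A} (ha : a ∈ 𝒜 g') :
    T.opInv g a = (T.τ (-g - g')).symm a :=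
  (regularModule 𝒜).addMk_of_mem _ ha

/-- The map acting on the component of degree `g'` as `τ_{-g-g'}`, as an isomorphism. -/
def opEquiv (g : G) : A ≃+ A :=
  { T.opHom g with
    invFun := T.opInv g
    left_inv := fun a => by
      change T.opInv g (T.opHom g a) = a
      induction a using alg_induction 𝒜 with
      | zero => simp
      | add a b ha hb => rw [map_add, map_add, ha, hb]
      | homogeneous h a ha =>
        rw [T.opHom_of_mem g ha, T.opInv_of_mem g (T.map_mem _ _ _ ha),
          LinearEquiv.symm_apply_apply]
    right_inv := fun a => by
      change T.opHom g (T.opInv g a) = a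
      induction a using alg_induction 𝒜 with
      | zero => simp
      | add a b ha hb => rw [map_add, map_add, ha, hb]
      | homogeneous h a ha =>
        rw [T.opInv_of_mem g ha, T.opHom_of_mem g (T.τ_symm_mem _ ha),
          LinearEquiv.apply_symm_apply] }

theorem opEquiv_of_mem (g : G) {g' : G} {a : A} (ha : a ∈ 𝒜 g') :
    T.opEquiv g a = T.τ (-g - g') a := T.opHom_of_mem g ha

theorem opEquiv_mem_iff (g : G) {h : G} {a : A} : T.opEquiv g a ∈ 𝒜 h ↔ a ∈ 𝒜 h := by
  refine ⟨fun H => ?_, fun H => by rw [T.opEquiv_of_mem g H]; exact T.map_mem _ _ _ H⟩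
  rw [← (T.opEquiv g).symm_apply_apply a]
  change T.opInv g _ ∈ 𝒜 h
  rw [T.opInv_of_mem g H]
  exact T.τ_symm_mem _ H

/-- For `b` of degree `j`, the twisting identity turns `τ_{-g-h-j} (τ_j (a) b)` into `τ_{-g-h} (a)
τ_{-g-h-j} (b)`. The two occurrences of `j` cancel in the first factor, which is what dictates the
index `-g - g'`. -/
theorem opEquiv_mul (g : G) {h : G} {a : A} (ha : a ∈ 𝒜 h) (b : A) :
    T.opEquiv g (T.mulAux b a) = T.opEquiv g a * T.opEquiv (h + g) b := by
  induction b using alg_induction 𝒜 with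
  | zero => simp
  | add b c hb hc => rw [map_add, AddMonoidHom.add_apply, map_add, map_add, hb, hc, mul_add]
  | homogeneous j b hb =>
    have e : j + (-g - (h + j)) = -g - h := by abel
    rw [T.opEquiv_of_mem g ha, T.opEquiv_of_mem _ hb, T.opEquiv_of_mem g (T.mulAux_mem ha hb),
      T.mulAux_of_mem hb, T.map_mul' _ a hb, e]
    congr 3
    abel

/-- The twisted isomorphism between the opposite algebras defined by a twisting system. -/
def opTwistedIso : TwistedIso (opGrading T.twistGrading) (opGrading 𝒜) where
  θ g := (MulOpposite.opAddEquiv.symm.trans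
    (show T.Twist ≃+ A from T.opEquiv g)).trans MulOpposite.opAddEquiv
  mem_iff g h b := by
    rw [mem_opGrading, mem_opGrading]
    exact T.opEquiv_mem_iff g
  map_mul g h b b' hb' := congrArg MulOpposite.op
    (T.opEquiv_mul g (mem_opGrading.1 hb') (show A from b.unop))
  map_one g := congrArg MulOpposite.op
    ((T.opEquiv_of_mem g SetLike.GradedOne.one_mem).trans (T.apply_one _))

theorem isASCohenMacaulay_iff : IsASCohenMacaulay 𝒜 ↔ IsASCohenMacaulay T.twistGrading :=
  T.twistedIso.isASCohenMacaulay_iff T.opTwistedIso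

theorem isASGorenstein_iff : IsASGorenstein 𝒜 ↔ IsASGorenstein T.twistGrading :=
  T.twistedIso.isASGorenstein_iff T.opTwistedIso

theorem isASRegular_iff : IsASRegular 𝒜 ↔ IsASRegular T.twistGrading :=
  T.twistedIso.isASRegular_iff T.opTwistedIso

end NormalizedLeftTwistingSystem

/-! ### Coarsening of gradings -/

section Coarsening

variable {H : Type} [AddCommGroup H] [DecidableEq H]

/-- A coarsening of a `G`-grading to an `H`-grading. -/
structure Coarsening (𝒜 : G → Submodule k A) (ℬ : H → Submodule k A) where
  φ : G →+ H
  le : ∀ g, 𝒜 g ≤ ℬ (φ g)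

/-- The space of functions on the grading group with values in a module, with the action of
homogeneous elements given by action on values together with translation. -/
def GradedFun (_ : G → Submodule k A) (Y : Type u) : Type u := G → Y

namespace GradedFun

variable (𝒜 : G → Submodule k A) [GradedAlgebra 𝒜] (Y : Type u) [AddCommGroup Y] [Module A Y]

instance : AddCommGroup (GradedFun 𝒜 Y) := inferInstanceAs (AddCommGroup (G → Y))

/-- The action of `A` on functions. -/
def actHom : A →+ (G → Y) →+ (G → Y) :=
  (DirectSum.toAddMonoid fun i => AddMonoidHom.mk' (fun a : 𝒜 i =>
      AddMonoidHom.mk' (fun y g => (a : A) • y (g - i)) (fun x y => by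
        ext g; exact smul_add _ _ _))
    (fun a b => by ext y g; exact add_smul _ _ _)).comp
    (DirectSum.decomposeAddEquiv 𝒜).toAddMonoidHom

variable {𝒜} {Y}

theorem actHom_of_mem {i : G} {a : A} (ha : a ∈ 𝒜 i) (y : G → Y) (g : G) :
    actHom 𝒜 Y a y g = a • y (g - i) := by
  simp [actHom, DirectSum.decompose_of_mem 𝒜 ha]

theorem actHom_one (y : G → Y) : actHom 𝒜 Y 1 y = y := by
  ext g
  rw [actHom_of_mem SetLike.GradedOne.one_mem, one_smul, sub_zero]

theorem actHom_mul (a b : A) (y : G → Y) :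
    actHom 𝒜 Y (a * b) y = actHom 𝒜 Y a (actHom 𝒜 Y b y) := by
  induction a using GrMod.alg_induction 𝒜 with
  | zero => simp
  | add a a' h h' => simp only [add_mul, map_add, AddMonoidHom.add_apply, h, h']
  | homogeneous i a ha =>
    induction b using GrMod.alg_induction 𝒜 with
    | zero => simp
    | add b b' h h' => simp only [mul_add, map_add, AddMonoidHom.add_apply, h, h']
    | homogeneous j b hb =>
      ext g
      rw [actHom_of_mem (SetLike.GradedMul.mul_mem ha hb), actHom_of_mem ha, actHom_of_mem hb,
        mul_smul, sub_sub]

instance : Module A (GradedFun 𝒜 Y) where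
  smul a y := actHom 𝒜 Y a y
  one_smul := actHom_one
  mul_smul := actHom_mul
  smul_zero a := map_zero (actHom 𝒜 Y a)
  smul_add a := map_add (actHom 𝒜 Y a)
  add_smul a b f := congrArg (fun t => t f) (map_add (actHom 𝒜 Y) a b)
  zero_smul f := congrArg (fun t => t f) (map_zero (actHom 𝒜 Y))

/-- The value of a function. -/
def eval (g : G) : GradedFun 𝒜 Y →+ Y := Pi.evalAddMonoidHom (fun _ => Y) g

theorem ext {x y : GradedFun 𝒜 Y} (h : ∀ g, eval g x = eval g y) : x = y := funext h

theorem eval_smul {i g g' : G} (e : i + g = g') {a : A} (ha : a ∈ 𝒜 i) (y : GradedFun 𝒜 Y) :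
    eval g' (a • y) = a • eval g y := by
  subst e
  refine (actHom_of_mem ha y (i + g)).trans ?_
  rw [add_sub_cancel_left]
  rfl

/-- The function with given values. -/
def mk (𝒜 : G → Submodule k A) (f : G → Y) : GradedFun 𝒜 Y := f

@[simp] theorem eval_mk (f : G → Y) (g : G) : eval g (mk 𝒜 f) = f g := rfl

end GradedFun

namespace Coarsening

open GrMod

variable {𝒜 : G → Submodule k A} [GradedAlgebra 𝒜] {ℬ : H → Submodule k A} [GradedAlgebra ℬ]
  (c : Coarsening 𝒜 ℬ)

include c in
-- A coarsening only provides inclusions, so the fact that `ℬ h` is spanned by the `𝒜 g` with `φ g =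
-- h` is recovered by projecting fine components to coarse degree `h`.
theorem induction {h : H} {motive : A → Prop} (zero : motive 0)
    (homogeneous : ∀ g, c.φ g = h → ∀ a ∈ 𝒜 g, motive a)
    (add : ∀ a b, motive a → motive b → motive (a + b)) {a : A} (ha : a ∈ ℬ h) : motive a := by
  classical
  have key : ∀ b : A, motive (GradedRing.proj ℬ h b) := by
    intro b
    induction b using alg_induction 𝒜 with
    | zero => rw [map_zero]; exact zero
    | add b b' hb hb' => rw [map_add]; exact add _ _ hb hb'
    | homogeneous g b hb =>
      by_cases e : c.φ g = h
      · rw [GradedRing.proj_apply, DirectSum.decompose_of_mem_same ℬ (e ▸ c.le g hb)]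
        exact homogeneous g e b hb
      · rw [GradedRing.proj_apply, DirectSum.decompose_of_mem_ne ℬ (c.le g hb) e]
        exact zero
  have := key a
  rwa [GradedRing.proj_apply, DirectSum.decompose_of_mem_same ℬ ha] at this

/-- The components of the coarsening of a graded module. -/
def gr (M : GrMod 𝒜) (h : H) : AddSubgroup M :=
  AddSubgroup.closure {x | ∃ g, c.φ g = h ∧ x ∈ M.gr g}

theorem mem_gr {M : GrMod 𝒜} {g : G} {x : M} (hx : x ∈ M.gr g) : x ∈ c.gr M (c.φ g) :=
  AddSubgroup.subset_closure ⟨g, rfl, hx⟩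

theorem gr_induction {M : GrMod 𝒜} {h : H} {motive : M → Prop} (zero : motive 0)
    (homogeneous : ∀ g, c.φ g = h → ∀ x ∈ M.gr g, motive x)
    (add : ∀ x y, motive x → motive y → motive (x + y)) {x : M} (hx : x ∈ c.gr M h) :
    motive x := by
  rw [gr, ← AddSubgroup.mem_toAddSubmonoid, AddSubgroup.closure_toAddSubmonoid] at hx
  induction hx using AddSubmonoid.closure_induction with
  | zero => exact zero
  | add x y _ _ hx hy => exact add x y hx hy
  | mem x hx =>
    rcases hx with ⟨g, hg, hx⟩ | ⟨g, hg, hx⟩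
    · exact homogeneous g hg x hx
    · exact homogeneous g hg x ((neg_neg x) ▸ neg_mem hx)

/-- The projection onto a component of the coarsening of a graded module. -/
def projHom (M : GrMod 𝒜) (h : H) : M →+ M :=
  M.addMk fun g => if c.φ g = h then (M.gr g).subtype else 0

theorem projHom_of_mem (M : GrMod 𝒜) (h : H) {g : G} {x : M} (hx : x ∈ M.gr g) :
    c.projHom M h x = if c.φ g = h then x else 0 := by
  rw [projHom, addMk_of_mem M _ hx]
  split_ifs <;> rfl

/-- The coarsening of a graded module. -/
def obj (M : GrMod 𝒜) : GrMod ℬ where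
  carrier := M
  gr h := c.gr M h
  isInternal := isInternal_of_proj _
    (c.projHom M)
    (fun h x hx => by
      refine c.gr_induction (motive := fun x => c.projHom M h x = x) (map_zero _)
        (fun g hg x hx => ?_) (fun x y hx hy => by rw [map_add, hx, hy]) hx
      rw [c.projHom_of_mem M h hx, if_pos hg])
    (fun h h' x hx hne => by
      have hz : c.projHom M h x + 0 = 0 := by
        refine c.gr_induction (motive := fun x => c.projHom M h x + 0 = 0)
          (by rw [map_zero, add_zero])
          (fun g hg x hx => ?_) (fun x y hx hy => ?_) hx
        · rw [c.projHom_of_mem M h hx, if_neg (by rw [hg]; exact hne), add_zero]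
        · rw [add_zero] at *
          rw [map_add, hx, hy, add_zero]
      rwa [add_zero] at hz)
    (fun x => by
      induction x using M.induction with
      | zero => exact zero_mem _
      | add x y hx hy => exact add_mem hx hy
      | homogeneous g x hx => exact AddSubgroup.subset_closure ⟨c.φ g, c.mem_gr hx⟩)
  smul_mem {h h' a x} ha hx := by
    refine c.gr_induction (motive := fun x => a • x ∈ c.gr M (h + h')) ?_ ?_ ?_ hx
    · rw [smul_zero]; exact zero_mem _
    · rintro g rfl x hx
      refine c.induction (motive := fun a => a • x ∈ c.gr M (h + c.φ g)) ?_ ?_ ?_ ha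
      · rw [zero_smul]; exact zero_mem _
      · rintro i rfl a ha
        rw [← map_add]
        exact c.mem_gr (M.smul_mem ha hx)
      · intro a b ha hb
        rw [add_smul]
        exact add_mem ha hb
    · intro x y hx hy
      rw [smul_add]
      exact add_mem hx hy

/-- A linear map which preserves degrees up to coarsening. -/
def homMk {M : GrMod 𝒜} {N : GrMod ℬ} (f : M →ₗ[A] N)
    (hf : ∀ g, ∀ x ∈ M.gr g, f x ∈ N.gr (c.φ g)) : c.obj M ⟶ N where
  lin := f
  map_mem {h x} hx := by
    refine c.gr_induction (motive := fun x => f x ∈ N.gr h) ?_ ?_ ?_ hx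
    · rw [map_zero]; exact zero_mem _
    · rintro g rfl x hx; exact hf g x hx
    · intro x y hx hy; rw [map_add]; exact add_mem hx hy

/-- The coarsening functor. -/
def U : GrMod 𝒜 ⥤ GrMod ℬ where
  obj := c.obj
  map {M N} f := c.homMk (N := c.obj N) f.lin fun _ _ hx => c.mem_gr (f.map_mem hx)

instance : c.U.Additive where

theorem exact_of_shortExact {C D : Type*} [Category C] [Abelian C] [Category D] [Abelian D]
    (F : C ⥤ D) [F.Additive]
    (h : ∀ S : ShortComplex C, S.ShortExact → (S.map F).ShortExact) :
    PreservesFiniteLimits F ∧ PreservesFiniteColimits F :=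
  (F.exact_tfae.out 0 3 rfl rfl).1 h

theorem U_exact : PreservesFiniteLimits c.U ∧ PreservesFiniteColimits c.U := by
  refine exact_of_shortExact _ fun S hS => ?_
  have := hS.mono_f
  have := hS.epi_g
  exact shortExact_mk (S := S.map c.U) (injective_of_mono (f := S.f))
    (surjective_of_epi (f := S.g)) fun x hx => hS.exists_lin_eq (x := x) hx

instance : PreservesFiniteLimits c.U := c.U_exact.1
instance : PreservesFiniteColimits c.U := c.U_exact.2

/-- The components of the refinement of a graded module. -/
def comp (N : GrMod ℬ) : Components 𝒜 where
  V g := N.gr (c.φ g)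
  act {h g g'} e a x := ⟨(a : A) • (x : N), N.smul_mem' (by rw [← e, map_add]) (c.le h a.2) x.2⟩
  act_add _ _ _ _ := Subtype.ext (smul_add _ _ _)
  add_act _ _ _ _ := Subtype.ext (add_smul _ _ _)
  one_act _ := Subtype.ext (one_smul _ _)
  mul_act _ _ _ _ _ _ := Subtype.ext (mul_smul _ _ _)

/-- The inclusion of a component in the refinement of a graded module. -/
def ι (N : GrMod ℬ) (g : G) : N.gr (c.φ g) →+ (c.comp N).toGrMod := (c.comp N).ι g

/-- A morphism from the refinement of a graded module. -/
def desc {N : GrMod ℬ} {Y : GrMod 𝒜} (f : ∀ g, N.gr (c.φ g) →+ Y) (hm : ∀ g x, f g x ∈ Y.gr g)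
    (hf : ∀ (h g : G) (a : A) (_ : a ∈ 𝒜 h) (x : N) (hx : x ∈ N.gr (c.φ g))
      (hx' : a • x ∈ N.gr (c.φ (h + g))), f (h + g) ⟨a • x, hx'⟩ = a • f g ⟨x, hx⟩) :
    (c.comp N).toGrMod ⟶ Y :=
  Components.desc (D := c.comp N) f hm fun h g a ha x => hf h g a ha x.1 x.2 _

theorem desc_ι {N : GrMod ℬ} {Y : GrMod 𝒜} (f : ∀ g, N.gr (c.φ g) →+ Y) (hm) (hf) {g : G}
    (x : N.gr (c.φ g)) : (c.desc f hm hf).lin (c.ι N g x) = f g x :=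
  Components.desc_ι (D := c.comp N) _ _ _ x

/-- The refinement of a morphism. -/
def map {N N' : GrMod ℬ} (f : N ⟶ N') : (c.comp N).toGrMod ⟶ (c.comp N').toGrMod :=
  c.desc (fun g => (c.ι N' g).comp
      ((f.lin.toAddMonoidHom.comp (N.gr (c.φ g)).subtype).codRestrict (N'.gr (c.φ g))
        fun x => f.map_mem x.2))
    (fun g x => (c.comp N').ι_mem g _)
    (fun h g a ha x hx hx' => by
      refine Eq.trans ?_ ((c.comp N').smul_ι rfl ha _).symm
      exact congrArg ((c.comp N').ι (h + g)) (Subtype.ext (f.lin.map_smul _ _)))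

theorem map_ι {N N' : GrMod ℬ} (f : N ⟶ N') {g : G} (x : N.gr (c.φ g)) :
    (c.map f).lin (c.ι N g x) = c.ι N' g ⟨f.lin x, f.map_mem x.2⟩ := c.desc_ι _ _ _ x

/-- The refinement functor. -/
def R : GrMod ℬ ⥤ GrMod 𝒜 where
  obj N := (c.comp N).toGrMod
  map f := c.map f
  map_id N := Components.hom_ext fun g x => c.map_ι (𝟙 N) x
  map_comp {N N' N''} f f' := Components.hom_ext fun g x => by
    refine (c.map_ι (f ≫ f') x).trans ?_
    refine Eq.trans ?_ (congrArg (c.map f').lin (c.map_ι f x)).symm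
    exact (c.map_ι f' ⟨f.lin (show N.gr (c.φ g) from x).1, f.map_mem x.2⟩).symm

theorem ι_mem {N : GrMod ℬ} {g : G} (x : N.gr (c.φ g)) : c.ι N g x ∈ (c.R.obj N).gr g :=
  (c.comp N).ι_mem g x

theorem ι_injective (N : GrMod ℬ) (g : G) : Function.Injective (c.ι N g) :=
  (c.comp N).ι_injective g

theorem exists_ι_eq {N : GrMod ℬ} {g : G} {y : c.R.obj N} (hy : y ∈ (c.R.obj N).gr g) :
    ∃ x : N.gr (c.φ g), c.ι N g x = y := hy

theorem smul_ι {N : GrMod ℬ} {h g g' : G} (e : h + g = g') {a : A} (ha : a ∈ 𝒜 h)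
    (x : N.gr (c.φ g)) : (a • (show c.R.obj N from c.ι N g x) : c.R.obj N) =
      c.ι N g' ⟨a • (x : N), N.smul_mem' (by rw [← e, map_add]) (c.le h ha) x.2⟩ :=
  (c.comp N).smul_ι e ha x

theorem R_map_ι {N N' : GrMod ℬ} (f : N ⟶ N') {g : G} (x : N.gr (c.φ g)) :
    (c.R.map f).lin (c.ι N g x) = c.ι N' g ⟨f.lin x, f.map_mem x.2⟩ := c.map_ι f x

theorem R_hom_ext {N : GrMod ℬ} {Y : GrMod 𝒜} {f f' : c.R.obj N ⟶ Y}
    (h : ∀ g (x : N.gr (c.φ g)), f.lin (c.ι N g x) = f'.lin (c.ι N g x)) : f = f' :=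
  Components.hom_ext (D := c.comp N) h

instance : c.R.Additive where
  map_add {M N f f'} := c.R_hom_ext fun g x => by
    refine (c.R_map_ι _ x).trans ?_
    refine Eq.trans ?_ (congrArg₂ (· + ·) (c.R_map_ι f x).symm (c.R_map_ι f' x).symm)
    exact map_add (c.ι N g) ⟨f.lin x, f.map_mem x.2⟩ ⟨f'.lin x, f'.map_mem x.2⟩

end Coarsening

end Coarsening

section Coarsening

variable {H : Type} [AddCommGroup H] [DecidableEq H]

namespace Coarsening

open GrMod

variable {𝒜 : G → Submodule k A} [GradedAlgebra 𝒜] {ℬ : H → Submodule k A} [GradedAlgebra ℬ]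
  (c : Coarsening 𝒜 ℬ)

/-! #### The adjunction between coarsening and refinement -/

/-- The linear map `⨁_g N_{φ g} → N`. -/
def sum (N : GrMod ℬ) : c.R.obj N →ₗ[A] N :=
  Components.descLin (D := c.comp N) (fun g => (N.gr (c.φ g)).subtype) fun _ _ _ _ _ => rfl

theorem sum_ι {N : GrMod ℬ} {g : G} (x : N.gr (c.φ g)) : c.sum N (c.ι N g x) = x :=
  Components.descLin_ι (D := c.comp N) _ _ x

/-- A morphism to the refinement of a graded module. -/
def toR {M : GrMod 𝒜} {N : GrMod ℬ} (f : c.U.obj M ⟶ N) : M ⟶ c.R.obj N :=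
  Components.lift (D := c.comp N)
    (fun g => (f.lin.toAddMonoidHom.comp (M.gr g).subtype).codRestrict (N.gr (c.φ g))
      fun x => f.map_mem (c.mem_gr x.2))
    fun _ _ a _ x _ => Subtype.ext (f.lin.map_smul a x)

theorem toR_of_mem {M : GrMod 𝒜} {N : GrMod ℬ} (f : c.U.obj M ⟶ N) {g : G} {x : M}
    (hx : x ∈ M.gr g) : (c.toR f).lin x = c.ι N g ⟨f.lin (show c.U.obj M from x),
      f.map_mem (c.mem_gr hx)⟩ :=
  Components.lift_of_mem (D := c.comp N) _ _ hx

/-- A morphism from the coarsening of a graded module. -/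
def ofR {M : GrMod 𝒜} {N : GrMod ℬ} (f : M ⟶ c.R.obj N) : c.U.obj M ⟶ N :=
  c.homMk ((c.sum N).comp f.lin) fun g x hx => by
    obtain ⟨y, hy⟩ := c.exists_ι_eq (f.map_mem hx)
    have : c.sum N (f.lin x) = y := by rw [← hy]; exact c.sum_ι y
    exact (congrArg (· ∈ N.gr (c.φ g)) this).mpr y.2

theorem U_hom_ext {M : GrMod 𝒜} {N : GrMod ℬ} {f f' : c.U.obj M ⟶ N}
    (h : ∀ g, ∀ x ∈ M.gr g, f.lin (show c.U.obj M from x) = f'.lin (show c.U.obj M from x)) :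
    f = f' := by
  ext x
  change M at x
  induction x using M.induction with
  | zero => exact (map_zero f.lin).trans (map_zero f'.lin).symm
  | homogeneous g x hx => exact h g x hx
  | add x y hx hy =>
    exact (map_add f.lin x y).trans ((congrArg₂ (· + ·) hx hy).trans (map_add f'.lin x y).symm)

/-- Refinement is right adjoint to coarsening. -/
def adjUR : c.U ⊣ c.R :=
  Adjunction.mkOfHomEquiv
    { homEquiv := fun M N =>
        { toFun := c.toR
          invFun := c.ofR
          left_inv := fun f => c.U_hom_ext fun g x hx => by
            refine (congrArg (c.sum N) (c.toR_of_mem f hx)).trans (c.sum_ι _)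
          right_inv := fun f => hom_ext_gr fun g x hx => by
            obtain ⟨y, hy⟩ := c.exists_ι_eq (f.map_mem hx)
            refine (c.toR_of_mem (c.ofR f) hx).trans (Eq.trans ?_ hy)
            refine congrArg (c.ι N g) (Subtype.ext ?_)
            refine (congrArg (c.sum N) hy).symm.trans (c.sum_ι y) }
      homEquiv_naturality_left_symm := fun f g => rfl
      homEquiv_naturality_right := fun {M N N'} f g => hom_ext_gr fun i x hx => by
        refine (c.toR_of_mem (f ≫ g) hx).trans ?_
        refine Eq.trans ?_ (congrArg (c.R.map g).lin (c.toR_of_mem f hx)).symm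
        exact (c.R_map_ι g ⟨f.lin (show c.U.obj M from x), f.map_mem (c.mem_gr hx)⟩).symm }

/-! #### The product functor -/

/-- The carrier of the product functor: homogeneous families with support in finitely many
fibres of the coarsening. -/
def prodSubmodule (Y : GrMod 𝒜) : Submodule A (GradedFun 𝒜 Y) where
  carrier := {y | (∀ g, GradedFun.eval g y ∈ Y.gr g) ∧
    ∃ s : Finset H, ∀ g, c.φ g ∉ s → GradedFun.eval g y = 0}
  zero_mem' := ⟨fun g => zero_mem _, ∅, fun g _ => rfl⟩
  add_mem' := by
    rintro x y ⟨hx, s, hs⟩ ⟨hy, t, ht⟩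
    refine ⟨fun g => by rw [map_add]; exact add_mem (hx g) (hy g), s ∪ t, fun g hg => ?_⟩
    rw [Finset.mem_union, not_or] at hg
    rw [map_add, hs g hg.1, ht g hg.2, add_zero]
  smul_mem' a y := by
    classical
    rintro ⟨hy, s, hs⟩
    induction a using alg_induction 𝒜 with
    | zero =>
      rw [zero_smul]
      exact ⟨fun g => zero_mem _, ∅, fun g _ => rfl⟩
    | homogeneous i a ha =>
      have e : ∀ g, GradedFun.eval g (a • y) = a • GradedFun.eval (g - i) y := fun g =>
        GradedFun.eval_smul (by abel) ha y
      refine ⟨fun g => ?_, s.image (c.φ i + ·), fun g hg => ?_⟩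
      · rw [e]; exact Y.smul_mem' (by abel) ha (hy _)
      · rw [e, hs, smul_zero]
        intro h
        exact hg (Finset.mem_image.2 ⟨_, h, by rw [map_sub]; abel⟩)
    | add a b ha hb =>
      obtain ⟨ha, t, ht⟩ := ha
      obtain ⟨hb, t', ht'⟩ := hb
      rw [add_smul]
      refine ⟨fun g => by rw [map_add]; exact add_mem (ha g) (hb g), t ∪ t', fun g hg => ?_⟩
      rw [Finset.mem_union, not_or] at hg
      rw [map_add, ht g hg.1, ht' g hg.2, add_zero]

/-- The value of a family at a given index. -/
def eval (Y : GrMod 𝒜) (g : G) : c.prodSubmodule Y →+ Y :=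
  (GradedFun.eval g).comp (c.prodSubmodule Y).subtype.toAddMonoidHom

theorem eval_mem {Y : GrMod 𝒜} (g : G) (y : c.prodSubmodule Y) : c.eval Y g y ∈ Y.gr g := y.2.1 g

theorem eval_ext {Y : GrMod 𝒜} {x y : c.prodSubmodule Y} (h : ∀ g, c.eval Y g x = c.eval Y g y) :
    x = y := Subtype.ext (GradedFun.ext h)

theorem eval_smul {Y : GrMod 𝒜} {i g g' : G} (e : i + g = g') {a : A} (ha : a ∈ 𝒜 i)
    (y : c.prodSubmodule Y) : c.eval Y g' (a • y) = a • c.eval Y g y :=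
  GradedFun.eval_smul e ha y.1

/-- The family with given values in one fibre. -/
def mkFibre (Y : GrMod 𝒜) (h : H) (f : G → Y) (hf : ∀ g, f g ∈ Y.gr g)
    (hf' : ∀ g, c.φ g ≠ h → f g = 0) : c.prodSubmodule Y :=
  ⟨GradedFun.mk 𝒜 f, hf, {h}, fun g hg => hf' g (by simpa using hg)⟩

theorem eval_mkFibre (Y : GrMod 𝒜) (h : H) (f : G → Y) (hf) (hf') (g : G) :
    c.eval Y g (c.mkFibre Y h f hf hf') = f g := rfl

/-- The restriction of a family to a fibre. -/
def fibreProj (Y : GrMod 𝒜) (h : H) : c.prodSubmodule Y →+ c.prodSubmodule Y :=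
  AddMonoidHom.mk' (fun y => c.mkFibre Y h (fun g => if c.φ g = h then c.eval Y g y else 0)
    (fun g => by
      split_ifs
      · exact c.eval_mem g y
      · exact zero_mem _)
    (fun g hg => if_neg hg)) fun x y => c.eval_ext fun g => by
      rw [map_add, eval_mkFibre, eval_mkFibre, eval_mkFibre]
      split_ifs
      · rw [map_add]
      · rw [add_zero]

theorem eval_fibreProj {Y : GrMod 𝒜} (h : H) (y : c.prodSubmodule Y) (g : G) :
    c.eval Y g (c.fibreProj Y h y) = if c.φ g = h then c.eval Y g y else 0 := rfl

/-- The components of the product of a graded module over the fibres of a coarsening. -/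
def fibre (Y : GrMod 𝒜) (h : H) : AddSubgroup (c.prodSubmodule Y) where
  carrier := {y | ∀ g, c.φ g ≠ h → c.eval Y g y = 0}
  zero_mem' g _ := map_zero _
  add_mem' hx hy g hg := by rw [map_add, hx g hg, hy g hg, add_zero]
  neg_mem' hx g hg := by rw [map_neg, hx g hg, neg_zero]

/-- The product of the components of a graded module over the fibres of a coarsening. -/
def prodObj (Y : GrMod 𝒜) : GrMod ℬ where
  carrier := c.prodSubmodule Y
  gr := c.fibre Y
  isInternal := isInternal_of_proj _ (c.fibreProj Y)
    (fun h y hy => c.eval_ext fun g => by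
      rw [eval_fibreProj]
      split_ifs with hg
      · rfl
      · exact (hy g hg).symm)
    (fun h h' y hy hne => c.eval_ext fun g => by
      rw [eval_fibreProj, map_zero]
      split_ifs with hg
      · exact hy g (by rw [hg]; exact hne.symm)
      · rfl)
    (fun y => by
      obtain ⟨s, hs⟩ := y.2.2
      have : y = ∑ h ∈ s, c.fibreProj Y h y := c.eval_ext fun g => by
        rw [map_sum]
        simp only [eval_fibreProj]
        rw [Finset.sum_ite_eq]
        split_ifs with hg
        · rfl
        · exact hs g hg
      rw [this]
      exact sum_mem fun h _ => AddSubgroup.subset_closure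
        ⟨h, fun g hg => (c.eval_fibreProj h y g).trans (if_neg hg)⟩)
  smul_mem {h h' a y} ha hy := by
    refine c.induction (motive := fun a => a • y ∈ c.fibre Y (h + h')) ?_ ?_ ?_ ha
    · rw [zero_smul]; exact zero_mem _
    · rintro i rfl a ha g hg
      rw [c.eval_smul (sub_add_cancel g i ▸ add_comm i (g - i)) ha, hy, smul_zero]
      intro e
      exact hg (by rw [← e, map_sub]; abel)
    · intro a b ha hb
      rw [add_smul]
      exact add_mem ha hb

theorem eval_proj {Y : GrMod 𝒜} (h : H) (y : c.prodObj Y) (g : G) :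
    c.eval Y g ((c.prodObj Y).proj h y) = if c.φ g = h then c.eval Y g y else 0 := by
  induction y using (c.prodObj Y).induction with
  | zero =>
    rw [map_zero]
    split_ifs
    · rfl
    · exact map_zero (c.eval Y g)
  | add x y hx hy =>
    rw [map_add]
    refine (map_add (c.eval Y g) _ _).trans ((congrArg₂ (· + ·) hx hy).trans ?_)
    split_ifs
    · exact (map_add (c.eval Y g) x y).symm
    · rw [add_zero]
  | homogeneous h' y hy =>
    by_cases e : h' = h
    · subst e
      rw [(c.prodObj Y).proj_same hy]
      split_ifs with hg
      · rfl
      · exact hy g hg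
    · rw [(c.prodObj Y).proj_ne hy e]
      split_ifs with hg
      · exact (map_zero _).trans (hy g (by rw [hg]; exact Ne.symm e)).symm
      · exact map_zero _

theorem map_smul_of_eval {M : Type*} [AddCommGroup M] [Module A M] {Y : GrMod 𝒜}
    (F : M →+ c.prodSubmodule Y) (hF : ∀ (i g : G) (a : A) (_ : a ∈ 𝒜 i) (x : M),
      c.eval Y (i + g) (F (a • x)) = a • c.eval Y g (F x)) (a : A) (x : M) :
    F (a • x) = a • F x := by
  induction a using alg_induction 𝒜 with
  | zero => rw [zero_smul, zero_smul, map_zero]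
  | add a b ha hb => rw [add_smul, add_smul, map_add, ha, hb]
  | homogeneous i a ha =>
    refine c.eval_ext fun g => ?_
    obtain ⟨g', rfl⟩ : ∃ g', i + g' = g := ⟨g - i, by abel⟩
    rw [hF i g' a ha, c.eval_smul rfl ha]

/-- The application of a morphism to all members of a family. -/
def prodHom {Y Y' : GrMod 𝒜} (f : Y ⟶ Y') : c.prodSubmodule Y →+ c.prodSubmodule Y' :=
  AddMonoidHom.mk' (fun y => ⟨GradedFun.mk 𝒜 fun g => f.lin (c.eval Y g y),
      fun g => f.map_mem (c.eval_mem g y), y.2.2.choose, fun g hg =>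
        (congrArg f.lin (y.2.2.choose_spec g hg)).trans (map_zero _)⟩)
    fun x y => c.eval_ext fun g =>
      (congrArg f.lin (map_add (c.eval Y g) x y)).trans (map_add _ _ _)

theorem eval_prodHom {Y Y' : GrMod 𝒜} (f : Y ⟶ Y') (y : c.prodSubmodule Y) (g : G) :
    c.eval Y' g (c.prodHom f y) = f.lin (c.eval Y g y) := rfl

/-- The functoriality of the product. -/
def prodMap {Y Y' : GrMod 𝒜} (f : Y ⟶ Y') : c.prodObj Y ⟶ c.prodObj Y' where
  lin :=
    { c.prodHom f with
      map_smul' := c.map_smul_of_eval (c.prodHom f) fun i g a ha x => by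
        rw [eval_prodHom, eval_prodHom, c.eval_smul rfl ha, map_smul] }
  map_mem {h y} hy g hg := (congrArg f.lin (hy g hg)).trans (map_zero _)

theorem eval_prodMap {Y Y' : GrMod 𝒜} (f : Y ⟶ Y') (y : c.prodObj Y) (g : G) :
    c.eval Y' g ((c.prodMap f).lin y) = f.lin (c.eval Y g y) := rfl

/-- The product functor. -/
def P : GrMod 𝒜 ⥤ GrMod ℬ where
  obj := c.prodObj
  map f := c.prodMap f

/-- Products of exact sequences of abelian groups are exact, and this is applied to the families
over each fibre. -/
theorem P_exact : PreservesFiniteLimits c.P ∧ PreservesFiniteColimits c.P := by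
  have : c.P.Additive := { map_add := fun {_ _ _ _} => rfl }
  refine exact_of_shortExact _ fun S hS => ?_
  have := hS.mono_f
  have := hS.epi_g
  have inj := injective_of_mono (f := S.f)
  refine shortExact_mk ?_ ?_ ?_
  · refine (injective_iff_map_eq_zero _).2 fun y hy => c.eval_ext fun g => ?_
    exact inj (((c.eval_prodMap S.f y g).symm.trans (congrArg (c.eval S.X₂ g) hy)).trans
      (map_zero S.f.lin).symm)
  · refine surjective_of_gr _ fun h z hz => ?_
    choose y hy hy' using fun g => exists_mem_gr_of_surjective (surjective_of_epi (f := S.g))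
      (c.eval_mem (Y := S.X₃) g z)
    classical
    -- Preimages chosen off the fibre of `h` are replaced by zero, to keep the support in a single
    -- fibre.
    refine ⟨c.mkFibre S.X₂ h (fun g => if c.φ g = h then y g else 0) (fun g => ?_)
      (fun g hg => if_neg hg), c.eval_ext fun g => ?_⟩
    · split_ifs
      · exact hy g
      · exact zero_mem _
    · refine (c.eval_prodMap S.g _ g).trans ?_
      rw [eval_mkFibre]
      split_ifs with hg
      · exact hy' g
      · exact (map_zero _).trans (hz g hg).symm
  · intro y hy
    have h0 : ∀ g, S.g.lin (c.eval S.X₂ g y) = 0 := fun g =>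
      (c.eval_prodMap S.g y g).symm.trans (congrArg (c.eval S.X₃ g) hy)
    choose x hx using fun g => hS.exists_lin_eq (h0 g)
    refine ⟨⟨GradedFun.mk 𝒜 x, fun g => mem_gr_of_injective inj ?_, y.2.2.choose, fun g hg => ?_⟩,
      c.eval_ext hx⟩
    · exact (congrArg (· ∈ S.X₂.gr g) (hx g)).mpr (c.eval_mem g y)
    · exact inj ((hx g).trans ((y.2.2.choose_spec g hg).trans (map_zero _).symm))

instance : c.P.Additive where
instance : PreservesFiniteLimits c.P := c.P_exact.1
instance : PreservesFiniteColimits c.P := c.P_exact.2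

end Coarsening

end Coarsening

section Coarsening

variable {H : Type} [AddCommGroup H] [DecidableEq H]

theorem GrMod.exists_finset_proj {𝒜 : G → Submodule k A} (M : GrMod 𝒜) (x : M) :
    ∃ s : Finset G, ∀ g, g ∉ s → M.proj g x = 0 := by
  obtain ⟨s, hs⟩ := M.sum_proj x
  refine ⟨s, fun g hg => ?_⟩
  rw [hs, map_sum]
  exact Finset.sum_eq_zero fun h hh => M.proj_ne (M.proj_mem h x) fun e => hg (e ▸ hh)

namespace Coarsening

open GrMod

variable {𝒜 : G → Submodule k A} [GradedAlgebra 𝒜] {ℬ : H → Submodule k A} [GradedAlgebra ℬ]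
  (c : Coarsening 𝒜 ℬ)

/-! #### The adjunction between refinement and products -/

/-- The additive map underlying `toP`. -/
def toPHom {N : GrMod ℬ} {Y : GrMod 𝒜} (f : c.R.obj N ⟶ Y) : N →+ c.prodSubmodule Y :=
  AddMonoidHom.mk' (fun n => ⟨GradedFun.mk 𝒜 fun g =>
      f.lin (c.ι N g ⟨N.proj (c.φ g) n, N.proj_mem _ n⟩),
      fun g => f.map_mem (c.ι_mem _), (N.exists_finset_proj n).choose, fun g hg => by
        have e : (⟨N.proj (c.φ g) n, N.proj_mem _ n⟩ : N.gr (c.φ g)) = 0 :=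
          Subtype.ext ((N.exists_finset_proj n).choose_spec _ hg)
        rw [GradedFun.eval_mk, e, map_zero]
        exact map_zero f.lin⟩)
    fun x y => c.eval_ext fun g => by
      have e : (⟨N.proj (c.φ g) (x + y), N.proj_mem _ _⟩ : N.gr (c.φ g)) =
          ⟨N.proj (c.φ g) x, N.proj_mem _ x⟩ + ⟨N.proj (c.φ g) y, N.proj_mem _ y⟩ :=
        Subtype.ext (map_add _ _ _)
      refine (congrArg (fun t => f.lin (c.ι N g t)) e).trans ?_
      refine (congrArg f.lin (map_add (c.ι N g) _ _)).trans ?_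
      exact map_add f.lin _ _

theorem eval_toPHom {N : GrMod ℬ} {Y : GrMod 𝒜} (f : c.R.obj N ⟶ Y) (n : N) (g : G) :
    c.eval Y g (c.toPHom f n) = f.lin (c.ι N g ⟨N.proj (c.φ g) n, N.proj_mem _ n⟩) := rfl

/-- A morphism to the product of a graded module. -/
def toP {N : GrMod ℬ} {Y : GrMod 𝒜} (f : c.R.obj N ⟶ Y) : N ⟶ c.P.obj Y where
  lin :=
    { c.toPHom f with
      map_smul' := c.map_smul_of_eval (c.toPHom f) fun i g a ha n => by
        rw [eval_toPHom, eval_toPHom]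
        refine Eq.trans ?_ (f.lin.map_smul a _)
        refine congrArg f.lin (Eq.trans ?_ (c.smul_ι rfl ha _).symm)
        exact congrArg (c.ι N (i + g)) (Subtype.ext
          (N.proj_smul (map_add c.φ i g).symm (c.le i ha) n)) }
  map_mem {h n} hn g hg := by
    have e : (⟨N.proj (c.φ g) n, N.proj_mem _ n⟩ : N.gr (c.φ g)) = 0 :=
      Subtype.ext (N.proj_ne hn (Ne.symm hg))
    exact (congrArg (fun t => f.lin (c.ι N g t)) e).trans
      ((congrArg f.lin (map_zero (c.ι N g))).trans (map_zero f.lin))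

theorem eval_toP {N : GrMod ℬ} {Y : GrMod 𝒜} (f : c.R.obj N ⟶ Y) (n : N) (g : G) :
    c.eval Y g ((c.toP f).lin n) = f.lin (c.ι N g ⟨N.proj (c.φ g) n, N.proj_mem _ n⟩) := rfl

/-- A morphism from the refinement of a graded module. -/
def ofP {N : GrMod ℬ} {Y : GrMod 𝒜} (f : N ⟶ c.P.obj Y) : c.R.obj N ⟶ Y :=
  c.desc (fun g => ((c.eval Y g).comp f.lin.toAddMonoidHom).comp (N.gr (c.φ g)).subtype)
    (fun g _ => c.eval_mem g _)
    (fun h g a ha x _ _ =>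
      (congrArg (c.eval Y (h + g)) (f.lin.map_smul a x)).trans (c.eval_smul rfl ha _))

theorem ofP_ι {N : GrMod ℬ} {Y : GrMod 𝒜} (f : N ⟶ c.P.obj Y) {g : G} (x : N.gr (c.φ g)) :
    (c.ofP f).lin (c.ι N g x) = c.eval Y g (f.lin (x : N)) := c.desc_ι _ _ _ x

theorem toP_ofP {N : GrMod ℬ} {Y : GrMod 𝒜} (f : N ⟶ c.P.obj Y) : c.toP (c.ofP f) = f := by
  ext n
  refine c.eval_ext fun g => (c.eval_toP _ n g).trans ((c.ofP_ι f _).trans ?_)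
  refine (congrArg (c.eval Y g) (lin_proj f (c.φ g) n)).trans ?_
  exact (c.eval_proj (c.φ g) (f.lin n) g).trans (if_pos rfl)

theorem ofP_toP {N : GrMod ℬ} {Y : GrMod 𝒜} (f : c.R.obj N ⟶ Y) : c.ofP (c.toP f) = f :=
  c.R_hom_ext fun g x => (c.ofP_ι _ x).trans ((c.eval_toP f (x : N) g).trans
    (congrArg (fun t => f.lin (c.ι N g t)) (Subtype.ext (N.proj_same x.2))))

/-- The product functor is right adjoint to refinement. -/
def adjRP : c.R ⊣ c.P :=
  Adjunction.mkOfHomEquiv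
    { homEquiv := fun N Y =>
        { toFun := c.toP
          invFun := c.ofP
          left_inv := c.ofP_toP
          right_inv := c.toP_ofP }
      homEquiv_naturality_left_symm := fun {N N' Y} f g => c.R_hom_ext fun i x => by
        refine (c.ofP_ι (f ≫ g) x).trans ?_
        refine Eq.trans ?_ (congrArg (c.ofP g).lin (c.R_map_ι f x)).symm
        exact (c.ofP_ι g ⟨f.lin x, f.map_mem x.2⟩).symm
      homEquiv_naturality_right := fun f g => rfl }

instance : c.R.IsRightAdjoint := ⟨_, ⟨c.adjUR⟩⟩
instance : c.R.IsLeftAdjoint := ⟨_, ⟨c.adjRP⟩⟩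

instance : PreservesFiniteLimits c.R where
  preservesFiniteLimits _ _ _ := inferInstance
instance : PreservesFiniteColimits c.R where
  preservesFiniteColimits _ _ _ := inferInstance

/-- The left adjoint `U` of `R` is exact, and so is the left adjoint `R` of `P`. Coarsening itself
need not preserve injectives, which is why the comparisons below go through `R` and `P`. -/
instance : c.R.PreservesInjectiveObjects :=
  Functor.preservesInjectiveObjects_of_adjunction_of_preservesMonomorphisms c.adjUR

instance : c.P.PreservesInjectiveObjects :=
  Functor.preservesInjectiveObjects_of_adjunction_of_preservesMonomorphisms c.adjRP

/-! #### Relations between the three functors -/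

/-- The additive map `y ↦ (y_g)_g`. -/
def projFamily (Y : GrMod 𝒜) : Y →+ c.prodSubmodule Y := by
  classical
  exact AddMonoidHom.mk' (fun y => ⟨GradedFun.mk 𝒜 fun g => Y.proj g y, fun g => Y.proj_mem g y,
      (Y.exists_finset_proj y).choose.image c.φ, fun g hg =>
        (Y.exists_finset_proj y).choose_spec g fun h => hg (Finset.mem_image_of_mem _ h)⟩)
    fun x y => c.eval_ext fun g => map_add (Y.proj g) x y

theorem eval_projFamily {Y : GrMod 𝒜} (y : Y) (g : G) :
    c.eval Y g (c.projFamily Y y) = Y.proj g y := rfl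

/-- The comparison of coarsening and products. -/
def UToP (Y : GrMod 𝒜) : c.U.obj Y ⟶ c.P.obj Y :=
  c.homMk (M := Y) (N := c.P.obj Y)
    { c.projFamily Y with
      map_smul' := c.map_smul_of_eval (c.projFamily Y) fun i g a ha y => by
        rw [eval_projFamily, eval_projFamily, Y.proj_smul rfl ha] }
    fun g y hy g' hg' => (c.eval_projFamily y g').trans
      (Y.proj_ne hy fun e => hg' (congrArg c.φ e.symm))

theorem eval_UToP {Y : GrMod 𝒜} (y : Y) (g : G) :
    c.eval Y g ((c.UToP Y).lin y) = Y.proj g y := rfl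

/-- A graded module is locally finite over a coarsening if only finitely many components
in any fibre are nonzero. -/
def LocallyFinite (Y : GrMod 𝒜) : Prop := ∀ h, {g | c.φ g = h ∧ Y.gr g ≠ ⊥}.Finite

variable {c} in
-- Over each fibre only finitely many components are nonzero, so their product is their sum: a
-- family over `h` comes from the finite sum of its members.
theorem LocallyFinite.isIso_UToP {Y : GrMod 𝒜} (hY : c.LocallyFinite Y) : IsIso (c.UToP Y) := by
  refine isIso_of_bijective ⟨(injective_iff_map_eq_zero _).2 fun y hy =>
    Y.eq_zero_of_proj fun g => (c.eval_UToP y g).symm.trans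
      ((congrArg (c.eval Y g) hy).trans (map_zero _)), surjective_of_gr _ fun h y hy => ?_⟩
  refine ⟨(∑ g ∈ (hY h).toFinset, c.eval Y g y : Y), c.eval_ext fun g => ?_⟩
  refine (c.eval_UToP _ g).trans ?_
  rw [map_sum, Finset.sum_eq_single g, Y.proj_same (c.eval_mem g y)]
  · intro g' _ hg'
    exact Y.proj_ne (c.eval_mem g' y) hg'
  · intro hg
    rw [Y.proj_same (c.eval_mem g y)]
    by_contra h0
    apply hg
    rw [Set.Finite.mem_toFinset]
    refine ⟨?_, fun hb => h0 ?_⟩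
    · by_contra hg'
      exact h0 (hy g hg')
    · exact (AddSubgroup.mem_bot).1 (hb ▸ c.eval_mem g y)

/-- The retraction of the unit of the adjunction between coarsening and refinement. -/
def projDesc (Y : GrMod 𝒜) : c.R.obj (c.U.obj Y) ⟶ Y :=
  c.desc (N := c.U.obj Y) (fun g => (Y.proj g).comp (AddSubgroup.subtype (c.gr Y (c.φ g))))
    (fun g _ => Y.proj_mem g _) (fun _ _ _ ha x _ _ => Y.proj_smul rfl ha x)

theorem projDesc_ι {Y : GrMod 𝒜} {g : G} (x : (c.U.obj Y).gr (c.φ g)) :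
    (c.projDesc Y).lin (c.ι (c.U.obj Y) g x) = Y.proj g (show Y from x.1) :=
  c.desc_ι (N := c.U.obj Y) _ _ _ x

/-- A graded module is a retract of the refinement of its coarsening. -/
def retractRU (Y : GrMod 𝒜) : Retract Y (c.R.obj (c.U.obj Y)) where
  i := c.toR (𝟙 _)
  r := c.projDesc Y
  retract := hom_ext_gr fun g x hx => by
    refine (congrArg (c.projDesc Y).lin (c.toR_of_mem (𝟙 _) hx)).trans ?_
    exact (c.projDesc_ι _).trans (Y.proj_same hx)

/-! #### Regular and trivial modules -/

/-- The coarsening of the regular module. -/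
def regularIso : c.U.obj (regularModule 𝒜) ≅ regularModule ℬ where
  hom := c.homMk (M := regularModule 𝒜) (N := regularModule ℬ) LinearMap.id fun g x hx => c.le g hx
  inv :=
    { lin := LinearMap.id
      map_mem := fun {h x} hx => c.induction
        (motive := fun x => x ∈ c.gr (regularModule 𝒜) h) (zero_mem _)
        (by rintro g rfl x hx; exact c.mem_gr (M := regularModule 𝒜) hx)
        (fun x y hx hy => add_mem hx hy) hx }
  hom_inv_id := rfl
  inv_hom_id := rfl

/-- The only possible discrepancy comes from elements of nonzero fine degree and zero coarse degree,
which `hpos` excludes. -/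
theorem augmentationIdeal_eq (hpos : ∀ g, g ≠ 0 → c.φ g = 0 → 𝒜 g = ⊥) :
    augmentationIdeal 𝒜 = augmentationIdeal ℬ := by
  apply le_antisymm
  · intro a ha
    refine augmentationIdeal_induction (motive := fun a => a ∈ augmentationIdeal ℬ)
      (zero_mem _) (fun _ _ => add_mem) ?_ ha
    intro i j l a b d _ hb _ hj
    by_cases h : c.φ j = 0
    · rw [hpos j hj h, Submodule.mem_bot] at hb
      rw [hb, mul_zero, zero_mul]
      exact zero_mem _
    · exact mul_mem_augmentationIdeal _ _ h (c.le j hb)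
  · intro a ha
    refine augmentationIdeal_induction (motive := fun a => a ∈ augmentationIdeal 𝒜)
      (zero_mem _) (fun _ _ => add_mem) ?_ ha
    intro i j l a b d _ hb _ hj
    refine c.induction (motive := fun b => a * b * d ∈ augmentationIdeal 𝒜) ?_ ?_ ?_ hb
    · rw [mul_zero, zero_mul]; exact zero_mem _
    · rintro g rfl b hb
      exact mul_mem_augmentationIdeal _ _ (fun h => hj (by rw [h, map_zero])) hb
    · intro x y hx hy
      rw [mul_add, add_mul]
      exact add_mem hx hy

/-- The opposite of a coarsening. -/
def op : Coarsening (opGrading 𝒜) (opGrading ℬ) where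
  φ := c.φ
  le g _ ha := mem_opGrading.2 (c.le g (mem_opGrading.1 ha))

/-- The coarsening by a group morphism. -/
def regrade (𝒜 : G → Submodule k A) (φ : G →+ H) : Coarsening 𝒜 (regrade 𝒜 φ) where
  φ := φ
  le _ _ ha := mem_regrade ha

end Coarsening

end Coarsening

section Coarsening

variable {H : Type} [AddCommGroup H] [DecidableEq H]

open GrMod

/-- A graded algebra is left noetherian in the graded sense if its homogeneous left ideals are
finitely generated. -/
def IsGradedNoetherian (𝒜 : G → Submodule k A) [GradedAlgebra 𝒜] : Prop :=
  ∀ I : Ideal A, I.IsHomogeneous 𝒜 → I.FG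

namespace GrMod

variable {𝒜 : G → Submodule k A}

theorem injective_shift (E : GrMod 𝒜) [Injective E] (g : G) : Injective (E.shift g) where
  factors {X Y} F i _ := by
    let i' : X.shift (-g) ⟶ Y.shift (-g) := ⟨i.lin, fun h => i.map_mem h⟩
    let F' : X.shift (-g) ⟶ E := ⟨F.lin, fun {t x} hx => by
      have h : F.lin (show X from x) ∈ E.gr (t + -g + g) := F.map_mem (show _ ∈ X.gr (t + -g) from hx)
      rw [neg_add_cancel_right] at h
      exact h⟩
    have : Mono i' := mono_of_injective (f := i') (injective_of_mono (f := i))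
    let v := Injective.factorThru F' i'
    refine ⟨⟨v.lin, fun {t y} hy => ?_⟩, ?_⟩
    · have hy' : y ∈ Y.gr (t + g + -g) := by rw [add_neg_cancel_right]; exact hy
      exact v.map_mem (g := t + g) (m := y) hy'
    · ext x
      exact congr_lin (Injective.comp_factorThru F' i') x

/-- The test modules of Baer's criterion are thus finitely generated, which makes direct sums of
injectives injective. -/
theorem finite_of_injective [GradedAlgebra 𝒜] (h𝒜 : IsGradedNoetherian 𝒜) {X : GrMod 𝒜} {g : G}
    (f : X ⟶ (regularModule 𝒜).shift g) (hf : Function.Injective f.lin) : Module.Finite A X := by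
  let I : Ideal A := LinearMap.range f.lin
  have hI : I.IsHomogeneous 𝒜 := by
    rintro i _ ⟨x, rfl⟩
    induction x using X.induction with
    | zero =>
      refine (congrArg (fun a : A => (DirectSum.decompose 𝒜 a i : A) ∈ I) (map_zero f.lin)).mpr ?_
      exact (congrArg (fun d : DirectSum G fun g => 𝒜 g => (d i : A) ∈ I)
        (DirectSum.decompose_zero 𝒜)).mpr (zero_mem I)
    | add x y hx hy =>
      refine (congrArg (fun a : A => (DirectSum.decompose 𝒜 a i : A) ∈ I)
        (map_add f.lin x y)).mpr ?_
      exact (congrArg (fun d : DirectSum G fun g => 𝒜 g => (d i : A) ∈ I)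
        (DirectSum.decompose_add 𝒜 (show A from f.lin x) (show A from f.lin y))).mpr (add_mem hx hy)
    | homogeneous j x hx =>
      have hx' : (show A from f.lin x) ∈ 𝒜 (j + g) := f.map_mem hx
      by_cases e : j + g = i
      · subst e
        exact (congrArg (· ∈ I) (DirectSum.decompose_of_mem_same 𝒜 hx')).mpr ⟨x, rfl⟩
      · exact (congrArg (· ∈ I) (DirectSum.decompose_of_mem_ne 𝒜 hx' e)).mpr (zero_mem I)
  have : Module.Finite A (LinearMap.range f.lin) := Module.Finite.iff_fg.2 (h𝒜 I hI)
  exact Module.Finite.equiv (LinearEquiv.ofInjective f.lin hf).symm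

end GrMod

namespace Coarsening

variable {𝒜 : G → Submodule k A} [GradedAlgebra 𝒜] {ℬ : H → Submodule k A} [GradedAlgebra ℬ]
  (c : Coarsening 𝒜 ℬ)

/-! #### Injective dimension -/

variable {c} in
-- Neither `P` nor `R` raises the injective dimension. One inequality follows from `U Y ≅ P Y`, the
-- other since `Y` is a retract of `R U Y`.
theorem LocallyFinite.injectiveDimension_eq {Y : GrMod 𝒜} (hY : c.LocallyFinite Y) :
    injectiveDimension (c.U.obj Y) = injectiveDimension Y := by
  have := hY.isIso_UToP
  refine le_antisymm (injectiveDimension_le_of_forall fun n _ => ?_)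
    (injectiveDimension_le_of_forall fun n _ => ?_)
  · have := hasInjectiveDimensionLT_of_adj c.adjRP Y n
    exact hasInjectiveDimensionLT_of_iso (asIso (c.UToP Y)).symm n
  · have := hasInjectiveDimensionLT_of_adj c.adjUR (c.U.obj Y) n
    exact (c.retractRU Y).hasInjectiveDimensionLT n

theorem injectiveDimension_regularModule (h : c.LocallyFinite (regularModule 𝒜)) :
    injectiveDimension (regularModule ℬ) = injectiveDimension (regularModule 𝒜) :=
  (injectiveDimension_eq_of_iso c.regularIso.symm).trans h.injectiveDimension_eq

/-! #### Local cohomology -/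

theorem mem_torsion_U_iff (he : augmentationIdeal 𝒜 = augmentationIdeal ℬ) {M : GrMod 𝒜} {x : M} :
    (show c.U.obj M from x) ∈ torsionSubmodule (augmentationIdeal ℬ) (c.U.obj M) ↔
      x ∈ torsionSubmodule (augmentationIdeal 𝒜) M := by
  change (∃ n : ℕ, ∀ a ∈ augmentationIdeal ℬ ^ n, a • x = 0) ↔
    ∃ n : ℕ, ∀ a ∈ augmentationIdeal 𝒜 ^ n, a • x = 0
  have e : ∀ n, augmentationIdeal 𝒜 ^ n = augmentationIdeal ℬ ^ n := fun n => by rw [he]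
  simp only [e]

/-- Coarsening commutes with torsion. -/
def torsionUIso (he : augmentationIdeal 𝒜 = augmentationIdeal ℬ) :
    c.U ⋙ torsion _ (augmentationIdeal_isHomogeneous ℬ) ≅
      torsion _ (augmentationIdeal_isHomogeneous 𝒜) ⋙ c.U :=
  torsionCompIso c.U (augmentationIdeal_isHomogeneous 𝒜) (augmentationIdeal_isHomogeneous ℬ)
    (fun M => torsionι_injective (augmentationIdeal 𝒜) (augmentationIdeal_isHomogeneous 𝒜) M)
    fun M h y _ => (c.mem_torsion_U_iff he (x := (show M from y))).trans
      ⟨fun hy => ⟨⟨y, hy⟩, rfl⟩, by rintro ⟨z, rfl⟩; exact z.2⟩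

theorem mem_torsion_R_iff (he : augmentationIdeal 𝒜 = augmentationIdeal ℬ) {N : GrMod ℬ} {g : G}
    (x : N.gr (c.φ g)) : (show c.R.obj N from c.ι N g x) ∈
      torsionSubmodule (augmentationIdeal 𝒜) (c.R.obj N) ↔
      (x : N) ∈ torsionSubmodule (augmentationIdeal ℬ) N := by
  have e : ∀ n, augmentationIdeal 𝒜 ^ n = augmentationIdeal ℬ ^ n := fun n => by rw [he]
  refine (mem_torsionSubmodule_iff (augmentationIdeal_isHomogeneous 𝒜)).trans ?_
  refine exists_congr fun n => ⟨fun h => ?_, fun h i a ha ha' => ?_⟩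
  · rw [← e]
    refine forall_smul_eq_zero (isHomogeneous_pow (augmentationIdeal_isHomogeneous 𝒜) n)
      fun i a ha ha' => ?_
    have h1 := (c.smul_ι rfl ha x).symm.trans (h i a ha ha')
    exact congrArg Subtype.val ((map_eq_zero_iff _ (c.ι_injective N (i + g))).1 h1)
  · refine (c.smul_ι rfl ha x).trans ?_
    refine (congrArg (c.ι N (i + g)) (Subtype.ext (h a (e n ▸ ha')))).trans (map_zero _)

theorem R_map_injective {N N' : GrMod ℬ} {f : N ⟶ N'} (hf : Function.Injective f.lin) :
    Function.Injective (c.R.map f).lin := by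
  have := mono_of_injective hf
  exact injective_of_mono

/-- Refinement commutes with torsion. -/
def torsionRIso (he : augmentationIdeal 𝒜 = augmentationIdeal ℬ) :
    c.R ⋙ torsion _ (augmentationIdeal_isHomogeneous 𝒜) ≅
      torsion _ (augmentationIdeal_isHomogeneous ℬ) ⋙ c.R :=
  torsionCompIso c.R (augmentationIdeal_isHomogeneous ℬ) (augmentationIdeal_isHomogeneous 𝒜)
    (fun N => c.R_map_injective (torsionι_injective _ _ _)) fun N g y hy => by
      obtain ⟨x, rfl⟩ := c.exists_ι_eq hy
      refine (c.mem_torsion_R_iff he x).trans ⟨fun h => ?_, fun h => ?_⟩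
      · exact ⟨c.ι _ g ⟨⟨x, h⟩, x.2⟩, c.R_map_ι (torsionι _ _ N) _⟩
      · obtain ⟨z, hz, hz'⟩ := exists_mem_gr_of_mem_range hy h
        obtain ⟨w, rfl⟩ := c.exists_ι_eq hz
        have := c.ι_injective N g ((c.R_map_ι _ w).symm.trans hz')
        rw [← this]
        exact w.1.2

/-- Surjectivity of `φ` makes every component of `N` appear in `R N`. -/
theorem isZero_of_isZero_R (hφ : Function.Surjective c.φ) {N : GrMod ℬ} (h : IsZero (c.R.obj N)) :
    IsZero N := by
  have key : ∀ i, ∀ x ∈ N.gr i, x = 0 := by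
    intro i x hx
    obtain ⟨g, rfl⟩ := hφ i
    have h1 : c.ι N g ⟨x, hx⟩ = 0 := by
      have := congr_lin ((IsZero.iff_id_eq_zero _).1 h) (c.ι N g ⟨x, hx⟩)
      exact this
    exact congrArg Subtype.val ((map_eq_zero_iff _ (c.ι_injective N g)).1 h1)
  rw [IsZero.iff_id_eq_zero]
  exact hom_ext_gr fun g x hx => key g x hx

theorem isZero_of_isZero_RU {Y : GrMod 𝒜} (h : IsZero (c.R.obj (c.U.obj Y))) : IsZero Y := by
  rw [IsZero.iff_id_eq_zero, ← (c.retractRU Y).retract, h.eq_zero_of_tgt (c.retractRU Y).i,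
    zero_comp]

/-- The projection of the refinement of the coarsening to a shift. -/
def projShift (Y : GrMod 𝒜) (h : G) : c.R.obj (c.U.obj Y) ⟶ Y.shift h :=
  c.desc (N := c.U.obj Y) (Y := Y.shift h)
    (fun g => (Y.proj (g + h)).comp (AddSubgroup.subtype (c.gr Y (c.φ g))))
    (fun g _ => Y.proj_mem (g + h) _)
    (fun i g _ ha x _ _ => Y.proj_smul (add_assoc i g h).symm ha x)

/-- The inclusion of a shift in the refinement of the coarsening. -/
def inclShift (Y : GrMod 𝒜) {h : G} (hh : c.φ h = 0) : Y.shift h ⟶ c.R.obj (c.U.obj Y) :=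
  c.toR (c.homMk (M := Y.shift h) (N := c.U.obj Y) LinearMap.id fun g x hx => by
    have := c.mem_gr (M := Y) (g := g + h) hx
    rw [map_add, hh, add_zero] at this
    exact this)

/-- In degree `g`, `R U Y` is the sum of the `Y_{g+h}` with `φ h = 0`, so `R U Y` is the direct sum
of the shifts `Y[h]`. This computes the idempotent of one summand. -/
theorem inclShift_projShift {Y : GrMod 𝒜} {h : G} (hh : c.φ h = 0) {g : G}
    (x : (c.U.obj Y).gr (c.φ g)) :
    (c.inclShift Y hh).lin ((c.projShift Y h).lin (c.ι (c.U.obj Y) g x)) =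
      c.ι (c.U.obj Y) g ⟨Y.proj (g + h) (show Y from x.1), by
        have := c.mem_gr (Y.proj_mem (g + h) (show Y from x.1))
        rw [map_add, hh, add_zero] at this
        exact this⟩ := by
  refine (congrArg (c.inclShift Y hh).lin (c.desc_ι (N := c.U.obj Y) (Y := Y.shift h)
    _ _ _ x)).trans ?_
  exact c.toR_of_mem (M := Y.shift h) (N := c.U.obj Y) _ (Y.proj_mem (g + h) (show Y from x.1))

/-- The sum of finitely many of the idempotents defined by `inclShift` and `projShift`. -/
def shiftSum (Y : GrMod 𝒜) (s : Finset {h : G // c.φ h = 0}) :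
    c.R.obj (c.U.obj Y) ⟶ c.R.obj (c.U.obj Y) :=
  ∑ h ∈ s, c.projShift Y h.1 ≫ c.inclShift Y h.2

theorem _root_.GrMod.sum_lin {M N : GrMod 𝒜} {σ : Type*} (s : Finset σ) (f : σ → (M ⟶ N)) (x : M) :
    (∑ i ∈ s, f i).lin x = ∑ i ∈ s, (f i).lin x := by
  classical
  induction s using Finset.induction_on with
  | empty => rfl
  | insert i s hi ih =>
    rw [Finset.sum_insert hi, Finset.sum_insert hi, ← ih]
    rfl

/-- An element meets only finitely many summands `Y[h]`. Allowing all larger sets `t` makes it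
possible to treat several elements with one set. -/
theorem exists_shiftSum_eq {Y : GrMod 𝒜} (z : c.R.obj (c.U.obj Y)) :
    ∃ s, ∀ t, s ⊆ t → (c.shiftSum Y t).lin z = z := by
  classical
  induction z using (c.R.obj (c.U.obj Y)).induction with
  | zero => exact ⟨∅, fun t _ => map_zero _⟩
  | add x y hx hy =>
    obtain ⟨s, hs⟩ := hx
    obtain ⟨t, ht⟩ := hy
    exact ⟨s ∪ t, fun w hw => by rw [map_add, hs w (Finset.union_subset_left hw),
      ht w (Finset.union_subset_right hw)]⟩
  | homogeneous g z hz =>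
    obtain ⟨x, rfl⟩ := c.exists_ι_eq hz
    let X : {h : G // c.φ h = 0} → (c.U.obj Y).gr (c.φ g) := fun h =>
      ⟨Y.proj (g + h) (show Y from x.1), by
        have := c.mem_gr (Y.proj_mem (g + h) (show Y from x.1))
        rw [map_add, h.2, add_zero] at this
        exact this⟩
    have key : ∃ s : Finset {h : G // c.φ h = 0}, ∀ t, s ⊆ t →
        ∑ h ∈ t, Y.proj (g + h) (show Y from x.1) = (show Y from x.1) := by
      refine c.gr_induction (M := Y) (h := c.φ g) (motive := fun x => ∃ s : Finset {h : G // c.φ h = 0},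
        ∀ t, s ⊆ t → ∑ h ∈ t, Y.proj (g + h) x = x) ⟨∅, fun t _ => by simp⟩ ?_ ?_ x.2
      · intro i hi x hx
        refine ⟨{⟨i - g, by rw [map_sub, hi, sub_self]⟩}, fun t ht => ?_⟩
        rw [Finset.sum_eq_single ⟨i - g, by rw [map_sub, hi, sub_self]⟩, add_sub_cancel,
          Y.proj_same hx]
        · intro h _ hne
          refine Y.proj_ne hx fun e => hne (Subtype.ext ?_)
          exact eq_sub_of_add_eq' e.symm
        · intro h
          exact absurd (ht (Finset.mem_singleton_self _)) h
      · rintro x y ⟨s, hs⟩ ⟨t, ht⟩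
        refine ⟨s ∪ t, fun w hw => ?_⟩
        simp only [map_add, Finset.sum_add_distrib]
        rw [hs w (Finset.union_subset_left hw), ht w (Finset.union_subset_right hw)]
    obtain ⟨s, hs⟩ := key
    refine ⟨s, fun t ht => ?_⟩
    have e1 : (c.shiftSum Y t).lin (c.ι (c.U.obj Y) g x) = c.ι (c.U.obj Y) g (∑ h ∈ t, X h) := by
      refine (sum_lin t _ _).trans ((Finset.sum_congr rfl fun h _ => ?_).trans
        (map_sum (c.ι (c.U.obj Y) g) X t).symm)
      exact c.inclShift_projShift h.2 x
    refine e1.trans (congrArg (c.ι (c.U.obj Y) g) (Subtype.ext ?_))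
    refine Eq.trans ?_ (hs t ht)
    exact map_sum (AddSubgroup.subtype ((c.U.obj Y).gr (c.φ g))) X t

/-- In Baer's criterion the source `X` of `w` is finitely generated, so `w` lands in finitely many
of the summands `E[h]`. These are injective and `w` is extended summand by summand. -/
theorem injective_RU (h𝒜 : IsGradedNoetherian 𝒜) (E : GrMod 𝒜) [Injective E] :
    Injective (c.R.obj (c.U.obj E)) := by
  classical
  refine injective_of_baer _ fun g X f hf w => ?_
  have : Module.Finite A X := finite_of_injective h𝒜 f hf
  obtain ⟨S, hS⟩ := Module.Finite.fg_top (R := A) (M := X)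
  choose F hF using fun z => c.exists_shiftSum_eq (Y := E) z
  let s := S.biUnion fun x => F (w.lin x)
  have hw : w ≫ c.shiftSum E s = w := by
    refine Hom.ext (LinearMap.ext_on hS fun x hx => ?_)
    exact hF (w.lin x) s (Finset.subset_biUnion_of_mem (fun x => F (w.lin x)) hx)
  have := mono_of_injective hf
  have := fun h : {h : G // c.φ h = 0} => injective_shift E h.1
  refine ⟨∑ h ∈ s, Injective.factorThru (w ≫ c.projShift E h.1) f ≫ c.inclShift E h.2, ?_⟩
  refine Eq.trans ?_ hw
  rw [shiftSum, Preadditive.comp_sum, Preadditive.comp_sum]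
  refine Finset.sum_congr rfl fun h _ => ?_
  rw [← Category.assoc, Injective.comp_factorThru, Category.assoc]

/-- Both sides are compared with the fine local cohomology of `R U A`. The functor `R` and the
composite `R U` are exact, preserve injectives, commute with torsion and reflect zero objects. -/
theorem isZero_localCohomology_regularModule_iff (h𝒜 : IsGradedNoetherian 𝒜)
    (he : augmentationIdeal 𝒜 = augmentationIdeal ℬ) (hφ : Function.Surjective c.φ) (n : ℕ) :
    IsZero ((localCohomology _ (augmentationIdeal_isHomogeneous ℬ) n).obj (regularModule ℬ)) ↔
      IsZero ((localCohomology _ (augmentationIdeal_isHomogeneous 𝒜) n).obj (regularModule 𝒜)) := by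
  have : (c.U ⋙ c.R).PreservesInjectiveObjects := ⟨fun {E} _ => c.injective_RU h𝒜 E⟩
  have h1 := isZero_rightDerived_obj_iff c.R _ _ (c.torsionRIso he)
    (fun _ h => c.isZero_of_isZero_R hφ h) n (c.U.obj (regularModule 𝒜))
  have h2 := isZero_rightDerived_obj_iff (c.U ⋙ c.R) _ _
    (Functor.associator _ _ _ ≪≫ Functor.isoWhiskerLeft c.U (c.torsionRIso he) ≪≫
      (Functor.associator _ _ _).symm ≪≫ Functor.isoWhiskerRight (c.torsionUIso he) c.R ≪≫
      Functor.associator _ _ _) (fun _ h => c.isZero_of_isZero_RU h) n (regularModule 𝒜)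
  exact ((localCohomology _ (augmentationIdeal_isHomogeneous ℬ) n).mapIso
    c.regularIso.symm).isZero_iff.trans (h1.symm.trans h2)

end Coarsening

end Coarsening

/-! ### Direct sums, free modules and products -/

namespace GrMod

section DirectSums

variable {𝒜 : G → Submodule k A} {S : Type u} (M : S → GrMod 𝒜)

/-- The carrier of a direct sum of graded modules. -/
def DSum : Type u := Π₀ s, M s

instance : AddCommGroup (DSum M) := inferInstanceAs (AddCommGroup (Π₀ s, M s))
instance : Module A (DSum M) := inferInstanceAs (Module A (Π₀ s, M s))

/-- The coordinates of an element of a direct sum. -/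
def dsumCoord (s : S) : DSum M →ₗ[A] M s := DFinsupp.lapply (M := fun s => M s) s

variable {M} in
theorem dsum_ext {x y : DSum M} (h : ∀ s, dsumCoord M s x = dsumCoord M s y) : x = y :=
  DFinsupp.ext h

/-- The inclusion of a summand. -/
def dsumIncl (s : S) : M s →ₗ[A] DSum M :=
  letI : DecidableEq S := Classical.decEq S
  DFinsupp.lsingle (R := A) (M := fun s => (M s : Type u)) s

theorem dsumCoord_incl_same (s : S) (x : M s) : dsumCoord M s (dsumIncl M s x) = x := by
  let : DecidableEq S := Classical.decEq S
  exact DFinsupp.single_eq_same (β := fun s => (M s : Type u))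

theorem dsumCoord_incl_ne {s t : S} (h : s ≠ t) (x : M s) :
    dsumCoord M t (dsumIncl M s x) = 0 := by
  let : DecidableEq S := Classical.decEq S
  exact DFinsupp.single_eq_of_ne (β := fun s => (M s : Type u)) h.symm

theorem dsum_induction {motive : DSum M → Prop} (zero : motive 0)
    (incl : ∀ s x, motive (dsumIncl M s x))
    (add : ∀ x y, motive x → motive y → motive (x + y)) (x : DSum M) : motive x := by
  let : DecidableEq S := Classical.decEq S
  exact DFinsupp.induction (p := motive) x zero fun s m f _ _ hf => add _ _ (incl s m) hf

/-- The direct sum of a family of graded modules. -/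
def dsum : GrMod 𝒜 where
  carrier := DSum M
  gr g :=
    { carrier := {x | ∀ s, dsumCoord M s x ∈ (M s).gr g}
      zero_mem' := fun s => by rw [map_zero]; exact zero_mem _
      add_mem' := fun hx hy s => by rw [map_add]; exact add_mem (hx s) (hy s)
      neg_mem' := fun hx s => by rw [map_neg]; exact neg_mem (hx s) }
  isInternal := isInternal_of_proj _
    (fun g => (DFinsupp.mapRange.addMonoidHom fun s => (M s).proj g : (Π₀ s, M s) →+ Π₀ s, M s))
    (fun g x hx => DFinsupp.ext fun s => (M s).proj_same (hx s))
    (fun g h x hx hgh => DFinsupp.ext fun s => (M s).proj_ne (hx s) hgh)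
    (fun x => by
      induction x using dsum_induction M with
      | zero => exact zero_mem _
      | add x y hx hy => exact add_mem hx hy
      | incl s m =>
        induction m using (M s).induction with
        | zero => rw [map_zero]; exact zero_mem _
        | add x y hx hy => rw [map_add]; exact add_mem hx hy
        | homogeneous g m hm =>
          refine AddSubgroup.subset_closure ⟨g, fun t => ?_⟩
          by_cases h : s = t
          · subst h; rw [dsumCoord_incl_same]; exact hm
          · rw [dsumCoord_incl_ne M h]; exact zero_mem _)
  smul_mem ha hx s := by rw [map_smul]; exact (M s).smul_mem ha (hx s)

/-- The inclusion of a summand. -/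
def dsumι (s : S) : M s ⟶ dsum M where
  lin := dsumIncl M s
  map_mem {g x} hx t := by
    by_cases h : s = t
    · subst h; exact (congrArg (· ∈ (M s).gr g) (dsumCoord_incl_same M s x)).mpr hx
    · exact (congrArg (· ∈ (M t).gr g) (dsumCoord_incl_ne M h x)).mpr (zero_mem _)

variable {M} {N : GrMod 𝒜}

theorem dsum_hom_ext {f f' : dsum M ⟶ N} (h : ∀ s, dsumι M s ≫ f = dsumι M s ≫ f') : f = f' := by
  ext x
  refine dsum_induction M (motive := fun x => f.lin x = f'.lin x) ?_ ?_ ?_ x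
  · exact (map_zero f.lin).trans (map_zero f'.lin).symm
  · exact fun s x => congr_lin (h s) x
  · exact fun x y hx hy =>
      (map_add f.lin x y).trans ((congrArg₂ (· + ·) hx hy).trans (map_add f'.lin x y).symm)

/-- The linear map underlying `dsumDesc`. -/
def dsumDescLin (f : ∀ s, M s ⟶ N) : DSum M →ₗ[A] N :=
  letI : DecidableEq S := Classical.decEq S
  DFinsupp.lsum (R := A) (M := fun s => (M s : Type u)) ℕ fun s => (f s).lin

theorem dsumDescLin_incl (f : ∀ s, M s ⟶ N) (s : S) (x : M s) :
    dsumDescLin f (dsumIncl M s x) = (f s).lin x := by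
  let : DecidableEq S := Classical.decEq S
  exact DFinsupp.lsum_single (R := A) (M := fun s => (M s : Type u)) ℕ (fun s => (f s).lin) s x

theorem dsum_sum_incl [DecidableEq S] (x : DSum M) :
    ∃ t : Finset S, x = ∑ s ∈ t, dsumIncl M s (dsumCoord M s x) := by
  induction x using dsum_induction M with
  | zero => exact ⟨∅, rfl⟩
  | incl s m =>
    refine ⟨{s}, ?_⟩
    rw [Finset.sum_singleton, dsumCoord_incl_same]
  | add x y hx hy =>
    obtain ⟨t, ht⟩ := hx
    obtain ⟨t', ht'⟩ := hy
    have key : ∀ (z : DSum M) (w w' : Finset S), z = ∑ s ∈ w, dsumIncl M s (dsumCoord M s z) →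
        w ⊆ w' → z = ∑ s ∈ w', dsumIncl M s (dsumCoord M s z) := by
      intro z w w' hz hw
      rw [← Finset.sum_subset hw]
      · exact hz
      · intro s _ hs
        have : dsumCoord M s z = 0 := by
          rw [hz, map_sum]
          refine Finset.sum_eq_zero fun i hi => dsumCoord_incl_ne M (by rintro rfl; exact hs hi) _
        rw [this, map_zero]
    refine ⟨t ∪ t', ?_⟩
    simp only [map_add, Finset.sum_add_distrib]
    rw [← key x t _ ht Finset.subset_union_left, ← key y t' _ ht' Finset.subset_union_right]

/-- A morphism from a direct sum. -/
def dsumDesc (f : ∀ s, M s ⟶ N) : dsum M ⟶ N where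
  lin := dsumDescLin f
  map_mem {g x} hx := by
    classical
    obtain ⟨t, ht⟩ := dsum_sum_incl (show DSum M from x)
    have : dsumDescLin f x = ∑ s ∈ t, (f s).lin (dsumCoord M s x) :=
      (congrArg (dsumDescLin f) ht).trans ((map_sum _ _ _).trans
        (Finset.sum_congr rfl fun s _ => dsumDescLin_incl f s _))
    exact (congrArg (· ∈ N.gr g) this).mpr (sum_mem fun s _ => (f s).map_mem (hx s))

theorem dsumι_desc (f : ∀ s, M s ⟶ N) (s : S) : dsumι M s ≫ dsumDesc f = f s := by
  ext x
  exact dsumDescLin_incl f s x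

theorem projective_dsum [∀ s, Projective (M s)] : Projective (dsum M) where
  factors {E X} f e _ := ⟨dsumDesc fun s => Projective.factorThru (dsumι M s ≫ f) e,
    dsum_hom_ext fun s => by
      rw [← Category.assoc, dsumι_desc, Projective.factorThru_comp]⟩

end DirectSums

section Free

variable (𝒜 : G → Submodule k A) [GradedAlgebra 𝒜]

instance projective_regular_shift (g : G) : Projective ((regularModule 𝒜).shift g) where
  factors {E X} f e _ := by
    obtain ⟨y, hy, hy'⟩ := exists_mem_gr_of_surjective (surjective_of_epi (f := e))
      (f.map_mem (one_mem_shift (𝒜 := 𝒜) g (add_neg_cancel g)))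
    refine ⟨ofElem (add_neg_cancel g) hy, shift_hom_ext ?_⟩
    refine (e.lin.map_smul (1 : A) y).trans ?_
    rw [one_smul, hy']

/-- The free graded module with basis elements of degree `-q s`. -/
def free {S : Type u} (q : S → G) : GrMod 𝒜 := dsum fun s => (regularModule 𝒜).shift (q s)

instance {S : Type u} (q : S → G) : Projective (free 𝒜 q) := projective_dsum

variable {𝒜}

/-- The morphism from a free module to a module with given values on the basis. -/
def freeDesc {S : Type u} {q : S → G} {M : GrMod 𝒜} (m : S → M) (hm : ∀ s, m s ∈ M.gr (-q s)) :
    free 𝒜 q ⟶ M :=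
  dsumDesc fun s => ofElem (add_neg_cancel (q s)) (hm s)

theorem freeDesc_incl {S : Type u} {q : S → G} {M : GrMod 𝒜} (m : S → M) (hm) (s : S) (a : A) :
    (freeDesc (q := q) m hm).lin (dsumIncl _ s (toShift 𝒜 (q s) a)) = a • m s :=
  dsumDescLin_incl (fun s => ofElem (add_neg_cancel (q s)) (hm s)) s (toShift 𝒜 (q s) a)

end Free

section Products

variable {𝒜 : G → Submodule k A} [GradedAlgebra 𝒜] {S : Type u}

/-- A family of morphisms which exhibits a graded module as the product of the targets. -/
structure IsGrProd {Z : GrMod 𝒜} {Y : S → GrMod 𝒜} (π : ∀ s, Z ⟶ Y s) : Prop where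
  inj : ∀ g, ∀ z ∈ Z.gr g, (∀ s, (π s).lin z = 0) → z = 0
  surj : ∀ g, ∀ y : ∀ s, Y s, (∀ s, y s ∈ (Y s).gr g) → ∃ z ∈ Z.gr g, ∀ s, (π s).lin z = y s

/-- The components of the product. -/
def piComp (Y : S → GrMod 𝒜) : Components 𝒜 where
  V g := ∀ s, (Y s).gr g
  act {_ _ _} e a y s := ⟨(a : A) • (y s : Y s), (Y s).smul_mem' e a.2 (y s).2⟩
  act_add _ _ _ _ := funext fun _ => Subtype.ext (smul_add _ _ _)
  add_act _ _ _ _ := funext fun _ => Subtype.ext (add_smul _ _ _)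
  one_act _ := funext fun _ => Subtype.ext (one_smul _ _)
  mul_act _ _ _ _ _ _ := funext fun _ => Subtype.ext (mul_smul _ _ _)

/-- The product of a family of graded modules. -/
def pi (Y : S → GrMod 𝒜) : GrMod 𝒜 := (piComp Y).toGrMod

variable {Y : S → GrMod 𝒜}

/-- The projections of a product. -/
def piπ (Y : S → GrMod 𝒜) (s : S) : pi Y ⟶ Y s :=
  Components.desc (D := piComp Y)
    (fun g => ((Y s).gr g).subtype.comp (Pi.evalAddMonoidHom (fun s => (Y s).gr g) s))
    (fun _ x => (x s).2) (fun _ _ _ _ _ => rfl)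

/-- A homogeneous element of a product. -/
def piMk {g : G} (y : ∀ s, (Y s).gr g) : pi Y := (piComp Y).ι g y

theorem piMk_mem {g : G} (y : ∀ s, (Y s).gr g) : piMk y ∈ (pi Y).gr g := (piComp Y).ι_mem g y

theorem piπ_mk {g : G} (y : ∀ s, (Y s).gr g) (s : S) : (piπ Y s).lin (piMk y) = y s :=
  Components.desc_ι (D := piComp Y) _ _ _ y

theorem isGrProd_pi (Y : S → GrMod 𝒜) : IsGrProd (piπ Y) where
  inj := by
    rintro g _ ⟨y, rfl⟩ h
    have : y = 0 := funext fun s => Subtype.ext ((piπ_mk y s).symm.trans (h s))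
    rw [this]
    exact map_zero _
  surj g y hy := ⟨piMk fun s => ⟨y s, hy s⟩, piMk_mem _, fun s => piπ_mk _ s⟩

/-- A morphism to a product. -/
def piLift {X : GrMod 𝒜} (f : ∀ s, X ⟶ Y s) : X ⟶ pi Y :=
  Components.lift (D := piComp Y)
    (fun _ => AddMonoidHom.mk' (fun x s => ⟨(f s).lin x, (f s).map_mem x.2⟩)
      fun _ _ => funext fun s => Subtype.ext (map_add (f s).lin _ _))
    fun _ _ _ _ _ _ => funext fun s => Subtype.ext ((f s).lin.map_smul _ _)

theorem piLift_π {X : GrMod 𝒜} (f : ∀ s, X ⟶ Y s) (s : S) : piLift f ≫ piπ Y s = f s :=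
  hom_ext_gr fun _ x hx =>
    (congrArg (piπ Y s).lin (Components.lift_of_mem (D := piComp Y) _ _ hx)).trans
      (piπ_mk (Y := Y) (fun s => ⟨(f s).lin x, (f s).map_mem hx⟩) s)

theorem IsGrProd.hom_ext {Z : GrMod 𝒜} {π : ∀ s, Z ⟶ Y s} (hπ : IsGrProd π) {X : GrMod 𝒜}
    {f f' : X ⟶ Z} (h : ∀ s, f ≫ π s = f' ≫ π s) : f = f' :=
  hom_ext_gr fun g x hx => by
    rw [← sub_eq_zero]
    refine hπ.inj g _ (sub_mem (f.map_mem hx) (f'.map_mem hx)) fun s => ?_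
    rw [map_sub, sub_eq_zero]
    exact congr_lin (h s) x

theorem injective_pi [∀ s, Injective (Y s)] : Injective (pi Y) where
  factors {X X'} f i _ := ⟨piLift fun s => Injective.factorThru (f ≫ piπ Y s) i,
    (isGrProd_pi Y).hom_ext fun s => by
      rw [Category.assoc, piLift_π, Injective.comp_factorThru]⟩

open Abelian

/-- An extension by a product is trivial if its images in the factors are. -/
theorem IsGrProd.ext_eq_zero {Z : GrMod 𝒜} {π : ∀ s, Z ⟶ Y s} (hπ : IsGrProd π) {X : GrMod 𝒜}
    {n : ℕ} {x : Ext X Z n} (h : ∀ s, x.comp (Ext.mk₀ (π s)) (add_zero n) = 0) : x = 0 := by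
  induction n generalizing Y Z with
  | zero =>
    obtain ⟨f, rfl⟩ := Ext.homEquiv₀.symm.surjective x
    refine (congrArg Ext.mk₀ (hπ.hom_ext (f' := 0) fun s => ?_)).trans (Ext.mk₀_zero X Z)
    rw [zero_comp]
    exact Ext.homEquiv₀.symm.injective (((Ext.mk₀_comp_mk₀ f (π s)).symm.trans (h s)).trans
      (Ext.mk₀_zero X (Y s)).symm)
  | succ n ih =>
    -- Products of graded modules are exact, so embedding each `Y s` in an injective embeds `Z` in a
    -- product of injectives, with the product of the cokernels as cokernel.
    let I : ∀ s, InjectivePresentation (Y s) := fun s => Classical.arbitrary _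
    have hI : ∀ s, Function.Injective (I s).f.lin := fun s => injective_of_mono
    let S : ∀ s, ShortComplex (GrMod 𝒜) := fun s =>
      ShortComplex.mk (I s).f (cokerπ (I s).f) (comp_cokerπ _)
    have hS : ∀ s, (S s).ShortExact := fun s => shortExact_coker _ (hI s)
    have hinj : ∀ s, Injective (I s).J := fun s => (I s).injective
    have hinj' : ∀ s, Injective (S s).X₂ := hinj
    let α : Z ⟶ pi fun s => (I s).J := piLift fun s => π s ≫ (I s).f
    let β : (pi fun s => (I s).J) ⟶ pi fun s => coker (I s).f :=
      piLift fun s => piπ _ s ≫ cokerπ (I s).f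
    have hα : ∀ s z, (piπ _ s).lin (α.lin z) = (I s).f.lin ((π s).lin z) := fun s z =>
      congr_lin (piLift_π (fun s => π s ≫ (I s).f) s) z
    have hβ : ∀ s z, (piπ _ s).lin (β.lin z) = (cokerπ (I s).f).lin ((piπ _ s).lin z) := fun s z =>
      congr_lin (piLift_π (fun s => piπ _ s ≫ cokerπ (I s).f) s) z
    have w : α ≫ β = 0 := (isGrProd_pi _).hom_ext fun s => by
      rw [Category.assoc, piLift_π, ← Category.assoc, piLift_π, Category.assoc, comp_cokerπ,
        comp_zero, zero_comp]
    have hex : (ShortComplex.mk α β w).ShortExact := by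
      refine shortExact_mk ?_ ?_ ?_
      · refine injective_of_gr _ fun g z hz h0 => hπ.inj g z hz fun s => hI s ?_
        rw [← hα, map_zero]
        exact (congrArg (piπ _ s).lin h0).trans (map_zero _)
      · refine surjective_of_gr _ fun g z hz => ?_
        choose y hy hy' using fun s => exists_mem_gr_of_surjective
          (f := cokerπ (I s).f) (Submodule.mkQ_surjective _) ((piπ _ s).map_mem hz)
        obtain ⟨y', hy1, hy2⟩ := (isGrProd_pi fun s => (I s).J).surj g y hy
        refine ⟨y', ?_⟩
        rw [← sub_eq_zero]
        refine (isGrProd_pi _).inj g _ (sub_mem (β.map_mem hy1) hz) fun s => ?_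
        rw [map_sub, sub_eq_zero]
        exact (hβ s y').trans ((congrArg _ (hy2 s)).trans (hy' s))
      · intro z hz
        change β.lin z = 0 at hz
        have key : ∀ g, ∃ y, α.lin y = (pi fun s => (I s).J).proj g z := by
          intro g
          have hz' : β.lin ((pi fun s => (I s).J).proj g z) = 0 := by rw [lin_proj, hz, map_zero]
          have hzg := (pi fun s => (I s).J).proj_mem g z
          choose y hy using fun s => (hS s).exists_lin_eq (x := (piπ _ s).lin
            ((pi fun s => (I s).J).proj g z)) ((hβ s _).symm.trans
              ((congrArg (piπ _ s).lin hz').trans (map_zero _)))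
          have hyg : ∀ s, y s ∈ (Y s).gr g := fun s => mem_gr_of_injective (hI s)
            ((congrArg (· ∈ (I s).J.gr g) (hy s)).mpr ((piπ _ s).map_mem hzg))
          obtain ⟨y', hy1, hy2⟩ := hπ.surj g y hyg
          refine ⟨y', ?_⟩
          rw [← sub_eq_zero]
          refine (isGrProd_pi _).inj g _ (sub_mem (α.map_mem hy1) hzg) fun s => ?_
          rw [map_sub, sub_eq_zero]
          exact (hα s y').trans ((congrArg _ (hy2 s)).trans (hy s))
        obtain ⟨t, ht⟩ := (pi fun s => (I s).J).sum_proj z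
        choose y hy using key
        refine ⟨∑ g ∈ t, y g, ?_⟩
        refine (map_sum α.lin _ _).trans ?_
        exact (Finset.sum_congr rfl fun g _ => hy g).trans ht.symm
    have hJ : Injective (pi fun s => (I s).J) := injective_pi
    have hJ' : Injective (ShortComplex.mk α β w).X₂ := hJ
    obtain ⟨y, rfl⟩ := Ext.covariant_sequence_exact₁ X hex x (Ext.eq_zero_of_injective _) rfl
    let ψ : ∀ s, ShortComplex.mk α β w ⟶ S s := fun s =>
      { τ₁ := π s, τ₂ := piπ _ s, τ₃ := piπ _ s
        comm₁₂ := (piLift_π (fun s => π s ≫ (I s).f) s).symm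
        comm₂₃ := (piLift_π (fun s => piπ _ s ≫ cokerπ (I s).f) s).symm }
    -- By naturality, the connecting map sends the `s`-component of `y` to that of `x`, which
    -- vanishes by assumption.
    have hcoker : ∀ s, ∃ z : Ext X (S s).X₂ n, z.comp (Ext.mk₀ (S s).g) (add_zero n) =
        y.comp (Ext.mk₀ (piπ (fun s => coker (I s).f) s)) (add_zero n) := fun s => by
      refine Ext.covariant_sequence_exact₃ X (hS s) _ rfl ?_
      refine Eq.trans ?_ (h s)
      refine (Ext.comp_assoc_of_second_deg_zero ..).trans ?_
      refine (congrArg (fun t => y.comp t rfl) (hex.extClass_naturality (hS s) (ψ s)).symm).trans ?_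
      exact (Ext.comp_assoc_of_third_deg_zero ..).symm
    -- In degree zero the lifts are chosen factor by factor. In positive degree the components of
    -- `y` come from `Ext` into injectives, hence vanish, and induction gives `y = 0`.
    suffices ∃ y' : Ext X (pi fun s => (I s).J) n, y'.comp (Ext.mk₀ β) (add_zero n) = y by
      obtain ⟨y', rfl⟩ := this
      exact (Ext.comp_assoc_of_second_deg_zero ..).trans
        ((congrArg (fun t => y'.comp t rfl) hex.comp_extClass).trans (Ext.comp_zero ..))
    cases n with
    | zero =>
      obtain ⟨f, rfl⟩ := Ext.homEquiv₀.symm.surjective y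
      have : ∀ s, ∃ f' : X ⟶ (I s).J, f' ≫ cokerπ (I s).f = f ≫ piπ _ s := fun s => by
        obtain ⟨z, hz⟩ := hcoker s
        obtain ⟨f', rfl⟩ := Ext.homEquiv₀.symm.surjective z
        refine ⟨f', Ext.homEquiv₀.symm.injective ?_⟩
        exact (Ext.mk₀_comp_mk₀ _ _).symm.trans (hz.trans (Ext.mk₀_comp_mk₀ _ _))
      choose f' hf' using this
      refine ⟨Ext.mk₀ (piLift f'), (Ext.mk₀_comp_mk₀ _ _).trans (congrArg _ ?_)⟩
      refine (isGrProd_pi _).hom_ext fun s => ?_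
      rw [Category.assoc, piLift_π, ← Category.assoc, piLift_π, hf']
    | succ n =>
      have := ih (isGrProd_pi fun s => coker (I s).f) (x := y) fun s => by
        obtain ⟨z, hz⟩ := hcoker s
        rw [← hz, z.eq_zero_of_injective, Ext.zero_comp]
      exact ⟨0, (Ext.zero_comp ..).trans this.symm⟩

end Products

end GrMod

/-! ### A criterion for the Gorenstein property -/

section Criterion

open Abelian GrMod

theorem exists_addEquiv_of_ker_eq {X Y Z : Type*} [AddCommGroup X] [AddCommGroup Y] [AddCommGroup Z]
    {p : X →+ Y} {q : X →+ Z} (hp : Function.Surjective p) (hq : Function.Surjective q)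
    (h : ∀ x, p x = 0 ↔ q x = 0) : ∃ e : Y ≃+ Z, ∀ x, e (p x) = q x := by
  have hk : p.ker = q.ker := by
    ext x
    exact h x
  refine ⟨(QuotientAddGroup.quotientKerEquivOfSurjective p hp).symm.trans
    ((QuotientAddGroup.quotientAddEquivOfEq hk).trans
      (QuotientAddGroup.quotientKerEquivOfSurjective q hq)), fun x => ?_⟩
  have : (QuotientAddGroup.quotientKerEquivOfSurjective p hp).symm (p x) = (x : X ⧸ p.ker) := by
    rw [AddEquiv.symm_apply_eq]
    rfl
  rw [AddEquiv.trans_apply, this]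
  rfl

variable {𝒜 : G → Submodule k A} [GradedAlgebra 𝒜] {i n : ℕ}

theorem rightMul_comp_rightMul {g h g' h' g'' : G} (e : g + h = g') (e' : g' + h' = g'') {a b : A}
    (ha : a ∈ 𝒜 h) (hb : b ∈ 𝒜 h') {h'' : G} (e'' : g + h'' = g'') (hab : a * b ∈ 𝒜 h'') :
    rightMul e ha ≫ rightMul e' hb = rightMul e'' hab :=
  shift_hom_ext <| by
    refine (congrArg (rightMul e' hb).lin (rightMul_one e ha)).trans ?_
    exact (rightMul_one e'' hab).symm

theorem gradedExtSMul_gradedExtSMul {g h g' h' g'' : G} (e : g + h = g') (e' : g' + h' = g'')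
    {a b : A} (ha : a ∈ 𝒜 h) (hb : b ∈ 𝒜 h') {h'' : G} (e'' : g + h'' = g'') (hab : a * b ∈ 𝒜 h'')
    (x : gradedExt 𝒜 i g) :
    gradedExtSMul i e' hb (gradedExtSMul i e ha x) = gradedExtSMul i e'' hab x := by
  rw [gradedExtSMul, gradedExtSMul, gradedExtSMul, ← rightMul_comp_rightMul e e' ha hb e'' hab,
    ← Ext.mk₀_comp_mk₀]
  exact Ext.comp_assoc_of_third_deg_zero ..

theorem gradedExtSMul_one {g : G} (h1 : (1 : A) ∈ 𝒜 0) (x : gradedExt 𝒜 i g) :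
    gradedExtSMul i (add_zero g) h1 x = x := by
  have : rightMul (add_zero g) h1 = 𝟙 _ := shift_hom_ext (rightMul_one _ h1)
  rw [gradedExtSMul, this]
  exact Ext.comp_mk₀_id x

/-- The action of homogeneous elements of given degree on an element of `Ext`. -/
def gradedExtSMulHom {g h g' : G} (e : g + h = g') (x : gradedExt 𝒜 i g) :
    𝒜 h →+ gradedExt 𝒜 i g' :=
  AddMonoidHom.mk' (fun a => gradedExtSMul i e a.2 x) fun a b => by
    have : rightMul e (a + b).2 = rightMul e a.2 + rightMul e b.2 := shift_hom_ext <| by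
      refine (rightMul_one e (a + b).2).trans ?_
      exact (congrArg₂ (· + ·) (rightMul_one e a.2) (rightMul_one e b.2)).symm
    rw [gradedExtSMul, this, Ext.mk₀_add, Ext.comp_add]
    rfl

theorem gradedExtSMulHom_apply {g h g' : G} (e : g + h = g') (x : gradedExt 𝒜 i g) (a : 𝒜 h) :
    gradedExtSMulHom e x a = gradedExtSMul i e a.2 x := rfl

theorem gradedExtSMulHom_zero {g h g' : G} (e : g + h = g') (a : 𝒜 h) :
    gradedExtSMulHom e (0 : gradedExt 𝒜 i g) a = 0 := by
  rw [gradedExtSMulHom_apply, gradedExtSMul, Ext.zero_comp]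

/-- The map from the homogeneous elements of the algebra to those of the trivial right module. -/
def opTrivialHom (𝒜 : G → Submodule k A) [GradedAlgebra 𝒜] (h : G) :
    𝒜 h →+ (trivialModule (opGrading 𝒜)).gr h :=
  AddMonoidHom.mk' (fun a => ⟨trivialMk (opGrading 𝒜) (MulOpposite.op a.1),
    trivialMk_mem (mem_opGrading.2 a.2)⟩) fun _ _ => rfl

theorem opTrivialHom_surjective (h : G) : Function.Surjective (opTrivialHom 𝒜 h) := by
  rintro ⟨y, hy⟩
  obtain ⟨a, ha, rfl⟩ := exists_trivialMk_eq hy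
  exact ⟨⟨a.unop, mem_opGrading.1 ha⟩, rfl⟩

theorem opTrivialHom_eq_zero {h : G} {a : 𝒜 h} :
    opTrivialHom 𝒜 h a = 0 ↔ (a : A) ∈ augmentationIdeal 𝒜 := by
  rw [← op_mem_augmentationIdeal, ← trivialMk_eq_zero]
  exact Subtype.ext_iff

theorem mem_augmentationIdeal {h : G} (hh : h ≠ 0) {a : A} (ha : a ∈ 𝒜 h) :
    a ∈ augmentationIdeal 𝒜 := by
  have := mul_mem_augmentationIdeal (𝒜 := 𝒜) 1 1 hh ha
  rwa [one_mul, mul_one] at this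

/-- If `𝔪` does not meet `A_0`, the Gorenstein property can be expressed in terms of a generator of
the only nonzero component of `Ext`. -/
theorem isLeftASGorensteinWith_iff (h0 : ∀ a ∈ 𝒜 0, a ∈ augmentationIdeal 𝒜 → a = 0) {ℓ : G} :
    IsLeftASGorensteinWith 𝒜 n ℓ ↔ injectiveDimension (regularModule 𝒜) = n ∧
      (∀ i g, ¬(i = n ∧ g = -ℓ) → Subsingleton (gradedExt 𝒜 i g)) ∧
      ∃ x : gradedExt 𝒜 n (-ℓ), Function.Bijective (gradedExtSMulHom (add_zero (-ℓ)) x) := by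
  constructor
  · rintro ⟨h1, h2, e, he⟩
    refine ⟨h1, fun i g hi => ?_, ?_⟩
    · by_cases hin : i = n
      · subst hin
        have : Subsingleton (((trivialModule (opGrading 𝒜)).shift ℓ).gr g) :=
          subsingleton_of_forall_eq 0 fun y => by
            obtain ⟨a, rfl⟩ := opTrivialHom_surjective (𝒜 := 𝒜) (g + ℓ) y
            exact opTrivialHom_eq_zero.2 (mem_augmentationIdeal
              (fun h => hi ⟨rfl, eq_neg_of_add_eq_zero_left h⟩) a.2)
        exact (e g).toEquiv.subsingleton
      · exact h2 i hin g
    · have h1 : (1 : A) ∈ 𝒜 (-ℓ + ℓ) := by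
        rw [neg_add_cancel]
        exact SetLike.GradedOne.one_mem
      -- The generator of `k[ℓ]` is the class of `1`, in degree `-ℓ`.
      let x := (e (-ℓ)).symm (opTrivialHom 𝒜 (-ℓ + ℓ) ⟨1, h1⟩)
      have hx : ∀ a : 𝒜 0, (e (-ℓ) (gradedExtSMulHom (add_zero (-ℓ)) x a) :
          (trivialModule (opGrading 𝒜)).shift ℓ) = trivialMk (opGrading 𝒜) (MulOpposite.op a.1) := by
        intro a
        refine (he (-ℓ) 0 (-ℓ) (add_zero _) a.1 a.2 x).trans ?_
        refine (congrArg (fun y : (trivialModule (opGrading 𝒜)) => MulOpposite.op a.1 • y)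
          (congrArg Subtype.val ((e (-ℓ)).apply_symm_apply
            (opTrivialHom 𝒜 (-ℓ + ℓ) ⟨1, h1⟩)))).trans ?_
        exact congrArg (trivialMk (opGrading 𝒜)) (mul_one (MulOpposite.op a.1))
      refine ⟨x, (injective_iff_map_eq_zero _).2 fun a ha => ?_, fun y => ?_⟩
      · refine Subtype.ext (h0 a.1 a.2 ?_)
        rw [← op_mem_augmentationIdeal, ← trivialMk_eq_zero, ← hx a, ha, map_zero]
        rfl
      · obtain ⟨a, ha⟩ := opTrivialHom_surjective (𝒜 := 𝒜) (-ℓ + ℓ) (e (-ℓ) y)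
        refine ⟨⟨a.1, (congrArg (a.1 ∈ 𝒜 ·) (neg_add_cancel ℓ)).mp a.2⟩, (e (-ℓ)).injective ?_⟩
        rw [← ha]
        exact Subtype.ext (hx _)
  · rintro ⟨h1, h2, x, hx⟩
    refine ⟨h1, fun i hi g => h2 i g fun h => hi h.1, ?_⟩
    have hE : ∀ g, -ℓ + (g + ℓ) = g := fun g => by abel
    -- The component of `Ext` in degree `g` and that of `k[ℓ]` are both quotients of `A_{g+ℓ}`, via
    -- `a ↦ x a` and `a ↦` class of `a`, with the same kernel. The induced isomorphisms respect the
    -- right action because `(x b) a = x (b a)`.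
    have key : ∀ g, Function.Surjective (gradedExtSMulHom (hE g) x) ∧
        ∀ a, gradedExtSMulHom (hE g) x a = 0 ↔ opTrivialHom 𝒜 (g + ℓ) a = 0 := by
      intro g
      by_cases hg : g = -ℓ
      -- The degree `-ℓ + ℓ` is generalized to `h` so that it can be replaced by `0`.
      · have : ∀ h (hh : -ℓ + h = -ℓ), Function.Surjective (gradedExtSMulHom hh x) ∧
            ∀ a, gradedExtSMulHom hh x a = 0 ↔ opTrivialHom 𝒜 h a = 0 := by
          intro h hh
          obtain rfl : h = 0 := by simpa using hh
          refine ⟨hx.2, fun a => ⟨fun ha => ?_, fun ha => ?_⟩⟩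
          · rw [hx.1 (ha.trans (map_zero _).symm), map_zero]
          · rw [opTrivialHom_eq_zero] at ha
            rw [show a = 0 from Subtype.ext (h0 a.1 a.2 ha), map_zero]
        subst hg
        exact this _ _
      · have := h2 n g fun h => hg h.2
        refine ⟨fun y => ⟨0, Subsingleton.elim _ _⟩, fun a => ⟨fun _ => ?_, fun _ =>
          Subsingleton.elim _ _⟩⟩
        exact opTrivialHom_eq_zero.2 (mem_augmentationIdeal
          (fun h => hg (eq_neg_of_add_eq_zero_left h)) a.2)
    choose e he using fun g => exists_addEquiv_of_ker_eq (key g).1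
      (opTrivialHom_surjective (𝒜 := 𝒜) (g + ℓ)) (key g).2
    refine ⟨e, fun g h g' hg a ha y => ?_⟩
    obtain ⟨b, rfl⟩ := (key g).1 y
    have hb : b.1 * a ∈ 𝒜 (g' + ℓ) := by
      have := SetLike.GradedMul.mul_mem b.2 ha
      rwa [← hg, add_right_comm]
    have : gradedExtSMul n hg ha (gradedExtSMulHom (hE g) x b) =
        gradedExtSMulHom (hE g') x ⟨b.1 * a, hb⟩ :=
      gradedExtSMul_gradedExtSMul _ _ _ _ _ _ _
    refine (congrArg (fun z => (e g' z).1) this).trans ((congrArg Subtype.val (he g' _)).trans ?_)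
    exact congrArg (fun z : trivialModule (opGrading 𝒜) => MulOpposite.op a • z)
      (congrArg Subtype.val (he g b)).symm

end Criterion

/-! ### The Gorenstein property and coarsenings -/

section Coarsening

open Abelian GrMod

variable {H : Type} [AddCommGroup H] [DecidableEq H]

namespace Coarsening

variable {𝒜 : G → Submodule k A} [GradedAlgebra 𝒜] {ℬ : H → Submodule k A} [GradedAlgebra ℬ]
  (c : Coarsening 𝒜 ℬ)

/-- The projection from the refinement of a shift of the regular module. -/
def regularProj (m : H) (g : G) :
    c.R.obj ((regularModule ℬ).shift m) ⟶ (regularModule 𝒜).shift g :=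
  c.desc (N := (regularModule ℬ).shift m) (Y := (regularModule 𝒜).shift g)
    (fun g' => ((regularModule 𝒜).proj (g' + g)).comp
      (AddSubgroup.subtype (((regularModule ℬ).shift m).gr (c.φ g'))))
    (fun g' _ => (regularModule 𝒜).proj_mem (g' + g) _)
    (fun i g' _ ha x _ _ => (regularModule 𝒜).proj_smul (add_assoc i g' g).symm ha x)

theorem regularProj_ι {m : H} {g g' : G} (x : ((regularModule ℬ).shift m).gr (c.φ g')) :
    (c.regularProj m g).lin (c.ι ((regularModule ℬ).shift m) g' x) =
      (regularModule 𝒜).proj (g' + g) (show A from x.1) :=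
  c.desc_ι (N := (regularModule ℬ).shift m) (Y := (regularModule 𝒜).shift g) _ _ _ x

/-- In degree `g`, the refinement of `A[m]` is the coarse component of degree `φ g + m`, the sum of
the fine components `A_{g+s}` with `φ s = m`. Only finitely many are nonzero, so the sum is a
product. -/
theorem isGrProd_regularProj (h : c.LocallyFinite (regularModule 𝒜)) (m : H) :
    IsGrProd fun s : ULift.{u} {g : G // c.φ g = m} => c.regularProj m s.down.1 where
  inj g z hz hz0 := by
    obtain ⟨x, rfl⟩ := c.exists_ι_eq hz
    have hx : (show A from x.1) = 0 := by
      refine (regularModule 𝒜).eq_zero_of_proj fun g' => ?_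
      have hx' : (show A from x.1) ∈ ℬ (c.φ g + m) := x.2
      by_cases hg' : c.φ g' = c.φ g + m
      · have := (c.regularProj_ι x).symm.trans (hz0 ⟨⟨g' - g, by rw [map_sub, hg']; abel⟩⟩)
        rwa [add_sub_cancel] at this
      · refine c.induction (motive := fun x => (regularModule 𝒜).proj g' x = 0) (map_zero _)
          ?_ ?_ hx'
        · rintro i hi x hx
          exact (regularModule 𝒜).proj_ne hx fun e => hg' (e ▸ hi)
        · intro x y hx hy
          exact (map_add ((regularModule 𝒜).proj g') x y).trans
            ((congrArg₂ (fun u v : A => u + v) hx hy).trans (add_zero _))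
    rw [show x = 0 from Subtype.ext hx]
    exact map_zero _
  surj g y hy := by
    let Y : {g : G // c.φ g = m} → A := fun s => y ⟨s⟩
    have hY : ∀ s : {g : G // c.φ g = m}, Y s ∈ 𝒜 (g + s) := fun s => hy ⟨s⟩
    obtain ⟨f, hf1, hf2⟩ : ∃ f : G → A,
        (∀ s : {g : G // c.φ g = m}, f (g + s) = Y s) ∧
        ∀ g', c.φ (g' - g) ≠ m → f g' = 0 := by
      refine ⟨fun g' => if e : c.φ (g' - g) = m then Y ⟨g' - g, e⟩ else 0,
        fun s => ?_, fun g' e => dif_neg e⟩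
      have e : c.φ (g + s - g) = m := by rw [add_sub_cancel_left, s.2]
      exact (dif_pos e).trans (congrArg Y (Subtype.ext (add_sub_cancel_left _ _)))
    have hf : ∀ g', f g' ∈ 𝒜 g' := fun g' => by
      by_cases e : c.φ (g' - g) = m
      · have h1 : f (g + (g' - g)) ∈ 𝒜 (g + (g' - g)) :=
          (congrArg (· ∈ 𝒜 (g + (g' - g))) (hf1 ⟨g' - g, e⟩)).mpr (hY ⟨g' - g, e⟩)
        rwa [add_sub_cancel] at h1
      · rw [hf2 g' e]
        exact zero_mem _
    have hfφ : ∀ g', f g' ∈ ℬ (c.φ g + m) := fun g' => by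
      by_cases e : c.φ (g' - g) = m
      · rw [← e, ← map_add, add_sub_cancel]
        exact c.le _ (hf g')
      · rw [hf2 g' e]
        exact zero_mem _
    let x : ((regularModule ℬ).shift m).gr (c.φ g) :=
      ⟨(∑ g' ∈ (h (c.φ g + m)).toFinset, f g' : A), sum_mem fun g' _ => hfφ g'⟩
    refine ⟨c.ι _ g x, c.ι_mem x, fun s => ?_⟩
    obtain ⟨⟨s, hs⟩⟩ := s
    refine (c.regularProj_ι x).trans ?_
    refine (map_sum ((regularModule 𝒜).proj (g + s)) f _).trans ?_
    rw [Finset.sum_eq_single (g + s)]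
    · exact ((regularModule 𝒜).proj_same (hf _)).trans (hf1 ⟨s, hs⟩)
    · intro g' _ hg'
      exact (regularModule 𝒜).proj_ne (hf g') hg'
    · intro hg
      rw [Set.Finite.mem_toFinset] at hg
      have : (regularModule 𝒜).gr (g + s) = ⊥ := by
        by_contra hb
        exact hg ⟨by rw [map_add, hs], hb⟩
      have h0 : f (g + s) = 0 := AddSubgroup.mem_bot.1 (this ▸ hf (g + s))
      exact (congrArg ((regularModule 𝒜).proj (g + s)) h0).trans (map_zero _)

/-- The inclusion into the refinement of a shift of the regular module. -/
def regularIncl {m : H} {g : G} (hg : c.φ g = m) :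
    (regularModule 𝒜).shift g ⟶ c.R.obj ((regularModule ℬ).shift m) :=
  c.toR (c.homMk (M := (regularModule 𝒜).shift g) (N := (regularModule ℬ).shift m) LinearMap.id
    fun g' x hx => by
      have : (show A from x) ∈ ℬ (c.φ (g' + g)) := c.le (g' + g) hx
      rw [map_add, hg] at this
      exact this)

theorem regularIncl_regularProj {m : H} {g : G} (hg : c.φ g = m) :
    c.regularIncl hg ≫ c.regularProj m g = 𝟙 _ :=
  hom_ext_gr fun g' x hx => by
    refine (congrArg (c.regularProj m g).lin (c.toR_of_mem (M := (regularModule 𝒜).shift g)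
      (N := (regularModule ℬ).shift m) _ hx)).trans ?_
    exact (c.regularProj_ι _).trans ((regularModule 𝒜).proj_same hx)

theorem regularIncl_regularProj_of_ne {m : H} {g g' : G} (hg : c.φ g = m) (h : g ≠ g') :
    c.regularIncl hg ≫ c.regularProj m g' = 0 :=
  hom_ext_gr fun i x hx => by
    refine (congrArg (c.regularProj m g').lin (c.toR_of_mem (M := (regularModule 𝒜).shift g)
      (N := (regularModule ℬ).shift m) _ hx)).trans ?_
    exact (c.regularProj_ι _).trans ((regularModule 𝒜).proj_ne hx fun e => h (add_left_cancel e))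

theorem proj_mul {g h g' : G} (e : g + h = g') (x : A) {a : A} (ha : a ∈ 𝒜 h) :
    (regularModule 𝒜).proj g' (show A from x * a) =
      ((show A from (regularModule 𝒜).proj g (show A from x)) * a : A) := by
  induction x using alg_induction 𝒜 with
  | zero =>
    rw [zero_mul]
    exact (map_zero _).trans
      ((congrArg (fun y : A => y * a) (map_zero ((regularModule 𝒜).proj g))).trans (zero_mul a)).symm
  | add x y hx hy =>
    rw [add_mul]
    refine (map_add ((regularModule 𝒜).proj g') (x * a) (y * a)).trans ?_
    refine (congrArg₂ (fun u v : A => u + v) hx hy).trans ?_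
    refine (add_mul _ _ a).symm.trans ?_
    exact congrArg (fun y : A => y * a) (map_add ((regularModule 𝒜).proj g) x y).symm
  | homogeneous i x hx =>
    have hxa : x * a ∈ 𝒜 (i + h) := SetLike.GradedMul.mul_mem hx ha
    by_cases hi : i = g
    · subst hi
      subst e
      exact ((regularModule 𝒜).proj_same hxa).trans
        (congrArg (fun y : A => y * a) ((regularModule 𝒜).proj_same hx)).symm
    · refine ((regularModule 𝒜).proj_ne hxa fun e' => hi (add_right_cancel (e'.trans e.symm))).trans ?_
      exact ((congrArg (fun y : A => y * a) ((regularModule 𝒜).proj_ne hx hi)).trans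
        (zero_mul a)).symm

theorem R_map_rightMul {m h' m' : H} {g h g' : G} (e : m + h' = m') (e' : g + h = g') {a : A}
    (ha : a ∈ ℬ h') (ha' : a ∈ 𝒜 h) :
    c.R.map (rightMul e ha) ≫ c.regularProj m' g' = c.regularProj m g ≫ rightMul e' ha' :=
  c.R_hom_ext fun i x => by
    refine (congrArg (c.regularProj m' g').lin (c.R_map_ι (rightMul e ha) x)).trans ?_
    refine (c.regularProj_ι _).trans ?_
    refine (proj_mul (by rw [← e', add_assoc]) (show A from x.1) ha').trans ?_
    exact (congrArg (rightMul e' ha').lin (c.regularProj_ι x)).symm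

/-- The coarsening of the trivial module. -/
def trivialHom (he : augmentationIdeal 𝒜 = augmentationIdeal ℬ) :
    c.U.obj (trivialModule 𝒜) ⟶ trivialModule ℬ :=
  c.homMk (M := trivialModule 𝒜) (N := trivialModule ℬ)
    (Submodule.quotEquivOfEq _ _ he).toLinearMap fun g x hx => by
      obtain ⟨a, ha, rfl⟩ := exists_trivialMk_eq hx
      exact trivialMk_mem (c.le g ha)

theorem isIso_trivialHom (he : augmentationIdeal 𝒜 = augmentationIdeal ℬ) :
    IsIso (c.trivialHom he) :=
  isIso_of_bijective (Submodule.quotEquivOfEq _ _ he).bijective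

variable (he : augmentationIdeal 𝒜 = augmentationIdeal ℬ)

/-- The component of the comparison map between graded `Ext` groups. -/
def gradedExtProj (i : ℕ) (m : H) (g : G) : gradedExt ℬ i m →+ gradedExt 𝒜 i g :=
  ((Ext.mk₀ (c.regularProj m g)).postcomp (trivialModule 𝒜) (add_zero i)).comp
    ((adjExt c.adjUR (trivialModule 𝒜) ((regularModule ℬ).shift m) i).comp
      ((Ext.mk₀ (c.trivialHom he)).precomp ((regularModule ℬ).shift m) (zero_add i)))

theorem gradedExtProj_apply {i : ℕ} {m : H} (g : G) (x : gradedExt ℬ i m) :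
    c.gradedExtProj he i m g x = (adjExt c.adjUR (trivialModule 𝒜) ((regularModule ℬ).shift m) i
      ((Ext.mk₀ (c.trivialHom he)).comp x (zero_add i))).comp
        (Ext.mk₀ (c.regularProj m g)) (add_zero i) := rfl

/-- The coarse `Ext` is the fine `Ext` of `k` with values in `R(A[m])`, a product of the fine shifts
over `m`, and extensions by a product are detected on its factors. -/
theorem eq_zero_of_gradedExtProj (h : c.LocallyFinite (regularModule 𝒜)) {i : ℕ} {m : H}
    {x : gradedExt ℬ i m} (hx : ∀ g, c.φ g = m → c.gradedExtProj he i m g x = 0) : x = 0 := by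
  have := c.isIso_trivialHom he
  have h1 := (c.isGrProd_regularProj h m).ext_eq_zero fun s => hx s.down.1 s.down.2
  have h2 := (adjExt_bijective c.adjUR (trivialModule 𝒜) ((regularModule ℬ).shift m) i).1
    (h1.trans (map_zero _).symm)
  have h3 : (Ext.mk₀ (inv (c.trivialHom he))).comp
      ((Ext.mk₀ (c.trivialHom he)).comp x (zero_add i)) (zero_add i) = x := by simp
  rw [← h3]
  exact (congrArg (fun z => (Ext.mk₀ (inv (c.trivialHom he))).comp z (zero_add i)) h2).trans
    (Ext.comp_zero ..)

/-- The lift is obtained by pushing `y` along the inclusion of the factor `A[g]`, which the other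
projections annihilate. -/
theorem exists_gradedExtProj_eq {i : ℕ} {m : H} {g : G} (hg : c.φ g = m) (y : gradedExt 𝒜 i g) :
    ∃ x, c.gradedExtProj he i m g x = y ∧ ∀ g', g' ≠ g → c.gradedExtProj he i m g' x = 0 := by
  have := c.isIso_trivialHom he
  obtain ⟨z, hz⟩ := (adjExt_bijective c.adjUR (trivialModule 𝒜) ((regularModule ℬ).shift m) i).2
    (y.comp (Ext.mk₀ (c.regularIncl hg)) (add_zero i))
  have hx : (Ext.mk₀ (c.trivialHom he)).comp
      ((Ext.mk₀ (inv (c.trivialHom he))).comp z (zero_add i)) (zero_add i) = z := by simp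
  refine ⟨(Ext.mk₀ (inv (c.trivialHom he))).comp z (zero_add i), ?_, fun g' hg' => ?_⟩
  · rw [gradedExtProj_apply, hx, hz, Ext.comp_assoc_of_third_deg_zero, Ext.mk₀_comp_mk₀,
      regularIncl_regularProj]
    exact Ext.comp_mk₀_id y
  · rw [gradedExtProj_apply, hx, hz, Ext.comp_assoc_of_third_deg_zero, Ext.mk₀_comp_mk₀,
      c.regularIncl_regularProj_of_ne hg hg'.symm, Ext.mk₀_zero, Ext.comp_zero]

theorem gradedExtProj_smul {i : ℕ} {m h' m' : H} {g h g' : G} (e : m + h' = m') (e' : g + h = g')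
    {a : A} (ha : a ∈ ℬ h') (ha' : a ∈ 𝒜 h) (x : gradedExt ℬ i m) :
    c.gradedExtProj he i m' g' (gradedExtSMul i e ha x) =
      gradedExtSMul i e' ha' (c.gradedExtProj he i m g x) := by
  rw [gradedExtProj_apply, gradedExtProj_apply, gradedExtSMul, gradedExtSMul,
    ← Ext.comp_assoc_of_third_deg_zero, adjExt_comp_mk₀, Ext.comp_assoc_of_third_deg_zero,
    Ext.comp_assoc_of_third_deg_zero, Ext.mk₀_comp_mk₀, Ext.mk₀_comp_mk₀, c.R_map_rightMul e e']

variable [Nontrivial A] (hlf : c.LocallyFinite (regularModule 𝒜))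
  (hpos : ∀ g, g ≠ 0 → c.φ g = 0 → 𝒜 g = ⊥) (h0 : ∀ a ∈ 𝒜 0, a ∈ augmentationIdeal 𝒜 → a = 0)

include hpos in
theorem mem_zero_iff {a : A} : a ∈ ℬ 0 ↔ a ∈ 𝒜 0 := by
  refine ⟨fun ha => ?_, fun ha => by simpa using c.le 0 ha⟩
  refine c.induction (motive := fun a => a ∈ 𝒜 0) (zero_mem _) ?_ (fun _ _ => add_mem) ha
  intro g hg a ha
  by_cases h : g = 0
  · rwa [← h]
  · rw [hpos g h hg, Submodule.mem_bot] at ha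
    rw [ha]
    exact zero_mem _

include hlf hpos h0 in
-- By the generator criterion, `Ext` is concentrated in one place and is there free of rank one over
-- `A_0`. Since a coarse component is detected by the fine ones in its fibre and each of these
-- lifts, rank one forces exactly one of them, in some degree `-ℓ` with `φ ℓ = L`, to be nonzero.
-- Conversely, a generator of that component lifts to a coarse one.
theorem isLeftASGorensteinWith_iff (hdiv : ∀ a ∈ 𝒜 0, a ≠ 0 → ∃ b ∈ 𝒜 0, a * b = 1) {n : ℕ}
    {L : H} : IsLeftASGorensteinWith ℬ n L ↔ ∃ ℓ, c.φ ℓ = L ∧ IsLeftASGorensteinWith 𝒜 n ℓ := by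
  have he := c.augmentationIdeal_eq hpos
  have hB0 := fun a => c.mem_zero_iff hpos (a := a)
  rw [_root_.isLeftASGorensteinWith_iff (𝒜 := ℬ) fun a ha ha' =>
    h0 a ((hB0 a).1 ha) (he ▸ ha'), c.injectiveDimension_regularModule hlf]
  have hsmul : ∀ (m : H) (g : G) (a : A) (ha : a ∈ ℬ 0) (x : gradedExt ℬ n m),
      c.gradedExtProj he n m g (gradedExtSMulHom (add_zero m) x ⟨a, ha⟩) =
        gradedExtSMulHom (add_zero g) (c.gradedExtProj he n m g x) ⟨a, (hB0 a).1 ha⟩ :=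
    fun m g a ha x => c.gradedExtProj_smul he (add_zero m) (add_zero g) ha ((hB0 a).1 ha) x
  -- If `x a = 0` with `a ≠ 0`, a right inverse `b` of `a` gives `x = (x a) b = 0`.
  have hunit : ∀ (g : G) (x : gradedExt 𝒜 n g) (a : 𝒜 0), x ≠ 0 →
      gradedExtSMulHom (add_zero g) x a = 0 → a = 0 := by
    intro g x a hx ha
    by_contra ha0
    obtain ⟨b, hb, hab⟩ := hdiv a.1 a.2 fun h => ha0 (Subtype.ext h)
    have h1 : (1 : A) ∈ 𝒜 0 := SetLike.GradedOne.one_mem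
    have h2 := gradedExtSMul_gradedExtSMul (add_zero g) (add_zero g) a.2 hb (add_zero g)
      (hab.symm ▸ h1) x
    have h3 : gradedExtSMulHom (add_zero g) x ⟨a.1 * b, hab.symm ▸ h1⟩ = x := by
      rw [show (⟨a.1 * b, hab.symm ▸ h1⟩ : 𝒜 0) = ⟨1, h1⟩ from Subtype.ext hab]
      exact gradedExtSMul_one h1 x
    refine hx (h3.symm.trans (h2.symm.trans ?_))
    exact (congrArg (gradedExtSMul n (add_zero g) hb) ha).trans (Ext.zero_comp ..)
  constructor
  · rintro ⟨h1, h2, x, hx⟩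
    have hx0 : x ≠ 0 := by
      rintro rfl
      have h1 : (1 : A) ∈ ℬ 0 := SetLike.GradedOne.one_mem
      have := @hx.1 ⟨1, h1⟩ 0 ((gradedExtSMulHom_zero _ _).trans (gradedExtSMulHom_zero _ _).symm)
      exact one_ne_zero (congrArg Subtype.val this)
    obtain ⟨g, hg, hgx⟩ : ∃ g, c.φ g = -L ∧ c.gradedExtProj he n (-L) g x ≠ 0 := by
      by_contra! H
      exact hx0 (c.eq_zero_of_gradedExtProj he hlf H)
    obtain ⟨ℓ, rfl⟩ : ∃ ℓ, g = -ℓ := ⟨-g, (neg_neg g).symm⟩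
    -- Every `y` is `x a`, and the `-ℓ`-component of `x` is nonzero, hence has no annihilator in
    -- `A_0`. Applied to lifts supported at another degree, this kills all other fine components
    -- over `-L`.
    have key : ∀ y, c.gradedExtProj he n (-L) (-ℓ) y = 0 → y = 0 := by
      intro y hy
      obtain ⟨⟨a, ha⟩, rfl⟩ := hx.2 y
      have := hunit _ _ _ hgx ((hsmul _ _ a ha x).symm.trans hy)
      have h' : a = 0 := Subtype.ext_iff.1 this
      rw [show (⟨a, ha⟩ : ℬ 0) = 0 from Subtype.ext h', map_zero]
    refine ⟨ℓ, by rwa [map_neg, neg_inj] at hg, (_root_.isLeftASGorensteinWith_iff h0).2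
      ⟨h1, fun i g' hi => subsingleton_of_forall_eq 0 fun y => ?_,
        c.gradedExtProj he n (-L) (-ℓ) x, ?_, fun y => ?_⟩⟩
    · by_cases hig : i = n ∧ c.φ g' = -L
      · obtain ⟨rfl, hg'⟩ := hig
        obtain ⟨z, rfl, hz⟩ := c.exists_gradedExtProj_eq he hg' y
        rw [key z (hz _ fun h => hi ⟨rfl, h.symm⟩), map_zero]
      · have := h2 i (c.φ g') hig
        obtain ⟨z, rfl, -⟩ := c.exists_gradedExtProj_eq he (rfl : c.φ g' = _) y
        rw [Subsingleton.elim z 0, map_zero]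
    · exact (injective_iff_map_eq_zero _).2 fun a ha => hunit _ _ a hgx ha
    · obtain ⟨z, rfl, -⟩ := c.exists_gradedExtProj_eq he hg y
      obtain ⟨⟨a, ha⟩, rfl⟩ := hx.2 z
      exact ⟨_, (hsmul _ _ a ha x).symm⟩
  · rintro ⟨ℓ, rfl, h⟩
    obtain ⟨h1, h2, x, hx⟩ := (_root_.isLeftASGorensteinWith_iff h0).1 h
    obtain ⟨z, rfl, -⟩ := c.exists_gradedExtProj_eq he (map_neg c.φ ℓ) x
    refine ⟨h1, fun i m hi => subsingleton_of_forall_eq 0 fun y => ?_, z, ?_, fun y => ?_⟩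
    · refine c.eq_zero_of_gradedExtProj he hlf fun g hg => ?_
      have := h2 i g (by
        rintro ⟨rfl, rfl⟩
        exact hi ⟨rfl, hg.symm.trans (map_neg c.φ ℓ)⟩)
      exact Subsingleton.elim _ _
    · refine (injective_iff_map_eq_zero _).2 fun a ha => ?_
      have := (hsmul _ (-ℓ) a.1 a.2 z).symm.trans ((congrArg _ ha).trans (map_zero _))
      have h' : a.1 = 0 := Subtype.ext_iff.1 (hx.1 (this.trans (map_zero _).symm))
      exact Subtype.ext h'
    · obtain ⟨a, ha⟩ := hx.2 (c.gradedExtProj he n _ (-ℓ) y)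
      refine ⟨⟨a.1, (hB0 a.1).2 a.2⟩, sub_eq_zero.1 ?_⟩
      refine c.eq_zero_of_gradedExtProj he hlf fun g hg => ?_
      rw [map_sub, sub_eq_zero]
      by_cases hgl : g = -ℓ
      · subst hgl
        exact (hsmul _ _ _ _ z).trans ha
      · have := h2 n g fun h => hgl h.2
        exact Subsingleton.elim _ _

end Coarsening

end Coarsening

/-! ### Injective dimension and cyclic modules -/

namespace GrMod

open Abelian

section

variable {𝒜 : G → Submodule k A} [GradedAlgebra 𝒜]

/-- A dimension-shifted version of Baer's criterion. -/
theorem hasInjectiveDimensionLT_of_baer (N : GrMod 𝒜) (m : ℕ)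
    (h : ∀ (g : G) (X : GrMod 𝒜) (f : X ⟶ (regularModule 𝒜).shift g), Function.Injective f.lin →
      Subsingleton (Ext (coker f) N (m + 1))) : HasInjectiveDimensionLT N (m + 1) := by
  induction m generalizing N with
  | zero =>
    rw [zero_add, ← injective_iff_hasInjectiveDimensionLT_one]
    refine injective_of_baer _ fun g X f hf w => ?_
    have := h g X f hf
    obtain ⟨x, hx⟩ := Ext.contravariant_sequence_exact₁ (shortExact_coker f hf) N (Ext.mk₀ w)
      (add_zero 1) (Subsingleton.elim (α := Ext (coker f) N (0 + 1)) _ _)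
    obtain ⟨v, rfl⟩ := Ext.homEquiv₀.symm.surjective x
    exact ⟨v, Ext.homEquiv₀.symm.injective ((Ext.mk₀_comp_mk₀ f v).symm.trans hx)⟩
  | succ m ih =>
    let I : InjectivePresentation N := Classical.arbitrary _
    have hI := I.injective
    have hS := shortExact_coker I.f injective_of_mono
    refine hS.hasInjectiveDimensionLT_X₁ (m + 1) (ih _ fun g X f hf => ?_)
      (hasInjectiveDimensionLT_of_ge I.J 1 (m + 1 + 1) (by omega))
    have := h g X f hf
    refine subsingleton_of_forall_eq 0 fun z => ?_
    obtain ⟨y, rfl⟩ := Ext.covariant_sequence_exact₃ (coker f) hS z rfl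
      (Subsingleton.elim (α := Ext (coker f) N (m + 1 + 1)) _ _)
    have hI' : Injective (ShortComplex.mk I.f (cokerπ I.f) (comp_cokerπ _)).X₂ := hI
    rw [y.eq_zero_of_injective, Ext.zero_comp]

/-- The submodule `𝔪 M` is graded. -/
theorem proj_mem_augmentationIdeal_smul (M : GrMod 𝒜) (g : G) (x : M)
    (hx : x ∈ augmentationIdeal 𝒜 • (⊤ : Submodule A M)) :
    M.proj g x ∈ augmentationIdeal 𝒜 • (⊤ : Submodule A M) := by
  induction hx using Submodule.smul_induction_on' with
  | smul a ha y _ =>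
    induction y using M.induction with
    | zero => rw [smul_zero, map_zero]; exact zero_mem _
    | add y z hy hz => rw [smul_add, map_add]; exact add_mem (hy trivial) (hz trivial)
    | homogeneous e y hy =>
      refine augmentationIdeal_induction
        (motive := fun a => M.proj g (a • y) ∈ augmentationIdeal 𝒜 • (⊤ : Submodule A M)) ?_ ?_ ?_ ha
      · rw [zero_smul, map_zero]; exact zero_mem _
      · intro a b ha hb
        rw [add_smul, map_add]
        exact add_mem ha hb
      · intro i j l a b d ha hb hd hj
        have h1 : (a * b * d) • y ∈ augmentationIdeal 𝒜 • (⊤ : Submodule A M) :=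
          Submodule.smul_mem_smul (mul_mem_augmentationIdeal a d hj hb) Submodule.mem_top
        have h2 := M.smul_mem
          (SetLike.GradedMul.mul_mem (SetLike.GradedMul.mul_mem ha hb) hd) hy
        by_cases h : i + j + l + e = g
        · rw [h] at h2
          rwa [M.proj_same h2]
        · rw [M.proj_ne h2 h]
          exact zero_mem _
  | add x _ y _ hx hy => rw [map_add]; exact add_mem hx hy

/-- The quotient `M / 𝔪 M`. -/
def cotop (M : GrMod 𝒜) : GrMod 𝒜 :=
  M.ofQuot (augmentationIdeal 𝒜 • ⊤) M.proj_mem_augmentationIdeal_smul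

/-- The projection `M → M / 𝔪 M`. -/
def cotopπ (M : GrMod 𝒜) : M ⟶ M.cotop :=
  ⟨(augmentationIdeal 𝒜 • (⊤ : Submodule A M)).mkQ, fun h => ⟨_, h, rfl⟩⟩

theorem cotopπ_eq_zero {M : GrMod 𝒜} {x : M} :
    M.cotopπ.lin x = 0 ↔ x ∈ augmentationIdeal 𝒜 • (⊤ : Submodule A M) :=
  Submodule.Quotient.mk_eq_zero _

theorem cotopπ_surjective (M : GrMod 𝒜) : Function.Surjective M.cotopπ.lin :=
  Submodule.mkQ_surjective _

theorem smul_cotop (M : GrMod 𝒜) {a : A} (ha : a ∈ augmentationIdeal 𝒜) (v : M.cotop) :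
    a • v = 0 := by
  obtain ⟨x, rfl⟩ := M.cotopπ_surjective v
  exact (M.cotopπ.lin.map_smul a x).symm.trans
    (cotopπ_eq_zero.2 (Submodule.smul_mem_smul ha Submodule.mem_top))

end

/-! ### Bounded below modules over connected algebras -/

section Bounded

variable {ℬ : ℤ → Submodule k A} [GradedAlgebra ℬ]

/-- A bounded below graded module. -/
def BoundedBelow (M : GrMod ℬ) (h₀ : ℤ) : Prop := ∀ h < h₀, M.gr h = ⊥

theorem BoundedBelow.eq_zero {M : GrMod ℬ} {h₀ h : ℤ} (hM : M.BoundedBelow h₀) (hh : h < h₀) {x : M}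
    (hx : x ∈ M.gr h) : x = 0 := AddSubgroup.mem_bot.1 (hM h hh ▸ hx)

theorem BoundedBelow.of_injective {M N : GrMod ℬ} {h₀ : ℤ} (hN : N.BoundedBelow h₀) {f : M ⟶ N}
    (hf : Function.Injective f.lin) : M.BoundedBelow h₀ := fun _ hh =>
  (AddSubgroup.eq_bot_iff_forall _).2 fun _ hx =>
    hf ((hN.eq_zero hh (f.map_mem hx)).trans (map_zero f.lin).symm)

theorem BoundedBelow.of_surjective {M N : GrMod ℬ} {h₀ : ℤ} (hM : M.BoundedBelow h₀) {f : M ⟶ N}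
    (hf : Function.Surjective f.lin) : N.BoundedBelow h₀ := fun h hh =>
  (AddSubgroup.eq_bot_iff_forall _).2 fun y hy => by
    obtain ⟨x, hx, rfl⟩ := exists_mem_gr_of_surjective hf hy
    rw [hM.eq_zero hh hx, map_zero]

variable (hneg : ∀ h < 0, ℬ h = ⊥)

include hneg

theorem boundedBelow_regular_shift (g : ℤ) : ((regularModule ℬ).shift g).BoundedBelow (-g) :=
  fun h hh => (AddSubgroup.eq_bot_iff_forall _).2 fun x hx => by
    have h1 : (show A from x) ∈ ℬ (h + g) := hx
    rw [hneg (h + g) (by omega)] at h1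
    exact (Submodule.mem_bot k (M := A)).1 h1

/-- A nonzero generator of `𝔪` has positive degree, so `𝔪 M` lies strictly above the lower bound of
`M`. -/
theorem proj_eq_zero_of_mem_augmentationIdeal_smul {M : GrMod ℬ} {h : ℤ} (hM : M.BoundedBelow h)
    {x : M} (hx : x ∈ augmentationIdeal ℬ • (⊤ : Submodule A M)) : M.proj h x = 0 := by
  have nonneg : ∀ {i : ℤ} {a : A}, a ∈ ℬ i → a ≠ 0 → 0 ≤ i := fun {i a} ha h0 => by
    by_contra hi
    rw [hneg i (not_le.1 hi)] at ha
    exact h0 ((Submodule.mem_bot k).1 ha)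
  induction hx using Submodule.smul_induction_on' with
  | smul a ha y _ =>
    induction y using M.induction with
    | zero => rw [smul_zero, map_zero]
    | add y z hy hz => rw [smul_add, map_add, hy trivial, hz trivial, add_zero]
    | homogeneous g y hy =>
      refine augmentationIdeal_induction (motive := fun a => M.proj h (a • y) = 0) ?_ ?_ ?_ ha
      · rw [zero_smul, map_zero]
      · intro a b ha hb
        rw [add_smul, map_add, ha, hb, add_zero]
      · intro i j l a b d ha hb hd hj
        by_cases h0 : (a * b * d) • y = 0
        · rw [h0, map_zero]
        have hi := nonneg ha (by rintro rfl; simp at h0)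
        have hj' := nonneg hb (by rintro rfl; simp at h0)
        have hl := nonneg hd (by rintro rfl; simp at h0)
        have hg : h ≤ g := by
          by_contra hg
          exact h0 (by rw [hM.eq_zero (not_le.1 hg) hy, smul_zero])
        refine M.proj_ne (M.smul_mem
          (SetLike.GradedMul.mul_mem (SetLike.GradedMul.mul_mem ha hb) hd) hy) ?_
        omega
  | add x _ y _ hx hy => rw [map_add, hx, hy, add_zero]

/-- Nakayama's lemma for graded modules. -/
theorem BoundedBelow.eq_zero_of_top {M : GrMod ℬ} {h₀ : ℤ} (hM : M.BoundedBelow h₀)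
    (h : ∀ x : M, x ∈ augmentationIdeal ℬ • (⊤ : Submodule A M)) (x : M) : x = 0 := by
  -- As `M = 𝔪 M`, the lowest component allowed by any lower bound vanishes, so the bound can be
  -- raised forever.
  have key : ∀ n : ℕ, M.BoundedBelow (h₀ + n) := by
    intro n
    induction n with
    | zero => simpa using hM
    | succ n ih =>
      intro i hi
      by_cases hi' : i < h₀ + n
      · exact ih i hi'
      · obtain rfl : i = h₀ + n := by push_cast at hi; omega
        refine (AddSubgroup.eq_bot_iff_forall _).2 fun x hx => ?_
        rw [← M.proj_same hx]
        exact proj_eq_zero_of_mem_augmentationIdeal_smul hneg ih (h x)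
  refine M.eq_zero_of_proj fun g => (key (g - h₀ + 1).toNat).eq_zero ?_ (M.proj_mem g x)
  have := Int.self_le_toNat (g - h₀ + 1)
  omega

end Bounded

end GrMod

/-! ### Minimal free covers and projective dimension over connected `ℤ`-graded algebras. -/

namespace GrMod

open Abelian

section Bounded

variable {ℬ : ℤ → Submodule k A} [GradedAlgebra ℬ]

theorem exists_sub_algebraMap_mem (hz : ∀ a ∈ ℬ 0, a ∈ Set.range (algebraMap k A)) (a : A) :
    ∃ c : k, a - algebraMap k A c ∈ augmentationIdeal ℬ := by
  induction a using alg_induction ℬ with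
  | zero => exact ⟨0, by simp⟩
  | add a b ha hb =>
    obtain ⟨c, hc⟩ := ha
    obtain ⟨d, hd⟩ := hb
    exact ⟨c + d, by rw [map_add, add_sub_add_comm]; exact add_mem hc hd⟩
  | homogeneous g a ha =>
    by_cases hg : g = 0
    · subst hg
      obtain ⟨c, rfl⟩ := hz a ha
      exact ⟨c, by rw [sub_self]; exact zero_mem _⟩
    · exact ⟨0, by rw [map_zero, sub_zero]; exact mem_augmentationIdeal hg ha⟩

variable (hneg : ∀ h < 0, ℬ h = ⊥) (hz : ∀ a ∈ ℬ 0, a ∈ Set.range (algebraMap k A))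

include hneg in
theorem boundedBelow_free {S : Type u} {q : S → ℤ} {h₀ : ℤ} (hq : ∀ s, h₀ ≤ -q s) :
    (free ℬ q).BoundedBelow h₀ := fun _ hh =>
  (AddSubgroup.eq_bot_iff_forall _).2 fun _ hx => dsum_ext fun s =>
    ((boundedBelow_regular_shift hneg (q s)).eq_zero (hh.trans_le (hq s)) (hx s)).trans
      (map_zero (dsumCoord (fun s => (regularModule ℬ).shift (q s)) s)).symm

include hneg hz

/-- Minimal free covers of bounded below graded modules. -/
theorem BoundedBelow.exists_minimal_cover {M : GrMod ℬ} {h₀ : ℤ} (hM : M.BoundedBelow h₀) :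
    ∃ (F : GrMod ℬ) (π : F ⟶ M), Projective F ∧ F.BoundedBelow h₀ ∧ Function.Surjective π.lin ∧
      ∀ x, π.lin x = 0 → x ∈ augmentationIdeal ℬ • (⊤ : Submodule A F) := by
  classical
  let : Module k M.cotop := Module.compHom M.cotop (algebraMap k A)
  have hk : ∀ (a : A) (c : k), a - algebraMap k A c ∈ augmentationIdeal ℬ → ∀ v : M.cotop,
      a • v = c • v := fun a c hac v => by
    have := M.smul_cotop hac v
    rw [sub_smul, sub_eq_zero] at this
    exact this
  let s : Set M.cotop := {v | ∃ h, ∃ x ∈ M.gr h, M.cotopπ.lin x = v}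
  -- A `k`-basis of `M / 𝔪 M` consisting of classes of homogeneous elements; their lifts become the
  -- images of the free generators.
  obtain ⟨b, hbs, hspan, hb⟩ := exists_linearIndependent k s
  choose d m hm hmb using fun v : b => hbs v.2
  let q : b → ℤ := fun v => -d v
  have hm' : ∀ v, m v ∈ M.gr (-q v) := fun v => by simpa only [q, neg_neg] using hm v
  let π : free ℬ q ⟶ M := freeDesc m hm'
  have hπ : ∀ v a, π.lin (dsumIncl _ v (toShift ℬ (q v) a)) = a • m v := freeDesc_incl m hm'
  refine ⟨free ℬ q, π, inferInstance, boundedBelow_free hneg fun v => ?_, ?_, fun x hx => ?_⟩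
  · rw [neg_neg]
    by_contra hv
    refine hb.ne_zero v ?_
    rw [← hmb v, hM.eq_zero (not_le.1 hv) (hm v), map_zero]
  · have h1 : ∀ v ∈ Submodule.span k b, ∃ y, M.cotopπ.lin (π.lin y) = v := by
      intro v hv
      induction hv using Submodule.span_induction with
      | mem v hv =>
        refine ⟨dsumIncl _ ⟨v, hv⟩ (toShift ℬ (q ⟨v, hv⟩) 1), ?_⟩
        exact (congrArg M.cotopπ.lin ((hπ ⟨v, hv⟩ 1).trans (one_smul _ _))).trans (hmb ⟨v, hv⟩)
      | zero => exact ⟨0, (congrArg M.cotopπ.lin (map_zero π.lin)).trans (map_zero _)⟩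
      | add v w _ _ hv hw =>
        obtain ⟨y, rfl⟩ := hv
        obtain ⟨z, rfl⟩ := hw
        exact ⟨y + z, (congrArg M.cotopπ.lin (map_add π.lin y z)).trans (map_add _ _ _)⟩
      | smul c v _ hv =>
        obtain ⟨y, rfl⟩ := hv
        exact ⟨algebraMap k A c • y,
          (congrArg M.cotopπ.lin (π.lin.map_smul _ y)).trans (M.cotopπ.lin.map_smul _ _)⟩
    have h2 : ∀ x : M, M.cotopπ.lin x ∈ Submodule.span k b := by
      intro x
      rw [hspan]
      induction x using M.induction with
      | zero => rw [map_zero]; exact zero_mem _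
      | add x y hx hy => rw [map_add]; exact add_mem hx hy
      | homogeneous g x hx => exact Submodule.subset_span ⟨g, x, hx, rfl⟩
    have h3 : ∀ x : M, ∃ y, x - π.lin y ∈ augmentationIdeal ℬ • (⊤ : Submodule A M) := by
      intro x
      obtain ⟨y, hy⟩ := h1 _ (h2 x)
      exact ⟨y, by rw [← cotopπ_eq_zero, map_sub, hy, sub_self]⟩
    have hc : Function.Surjective (cokerπ π).lin := Submodule.mkQ_surjective _
    -- Surjectivity modulo `𝔪 M` makes the cokernel `Q` satisfy `Q = 𝔪 Q`, so Nakayama's lemma kills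
    -- it.
    have h4 := (hM.of_surjective (f := cokerπ π) hc).eq_zero_of_top hneg fun z => by
      obtain ⟨x, rfl⟩ := hc z
      obtain ⟨y, hy⟩ := h3 x
      have h5 : (cokerπ π).lin x = (cokerπ π).lin (x - π.lin y) := by
        rw [map_sub]
        exact (sub_eq_self.2 (congr_lin (comp_cokerπ π) y)).symm
      rw [h5]
      have h6 := Submodule.mem_map_of_mem (f := (cokerπ π).lin) hy
      rw [Submodule.map_smul''] at h6
      exact Submodule.smul_mono le_rfl le_top h6
    intro x
    exact (Submodule.Quotient.mk_eq_zero _).1 (h4 ((cokerπ π).lin x))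
  -- Minimality: reducing a relation between the lifts modulo `𝔪 M` gives a `k`-linear relation
  -- between basis vectors, so every coefficient of `x` lies in `𝔪`.
  · obtain ⟨t, ht⟩ := dsum_sum_incl (show DSum _ from x)
    choose c hc using fun v => exists_sub_algebraMap_mem hz (dsumCoord _ v x : A)
    have h1 : ∑ v ∈ t, c v • (v : M.cotop) = 0 := by
      have h2 : π.lin x = ∑ v ∈ t, (show A from dsumCoord _ v x) • m v :=
        (congrArg π.lin ht).trans ((map_sum π.lin _ _).trans
          (Finset.sum_congr rfl fun v _ => hπ v _))
      have h3 := congrArg M.cotopπ.lin (h2.symm.trans hx)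
      rw [map_zero, map_sum] at h3
      refine (Finset.sum_congr rfl fun v _ => ?_).trans h3
      rw [map_smul, hmb]
      exact (hk _ _ (hc v) _).symm
    have h4 := linearIndependent_iff'.1 hb t c h1
    have h5 : ∀ v ∈ t, dsumIncl (fun v => (regularModule ℬ).shift (q v)) v (dsumCoord _ v x) ∈
        augmentationIdeal ℬ • (⊤ : Submodule A (free ℬ q)) := by
      intro v hv
      have h6 : (show A from dsumCoord _ v x) ∈ augmentationIdeal ℬ := by
        have := hc v
        rw [h4 v hv, map_zero] at this
        exact (congrArg (· ∈ augmentationIdeal ℬ) (sub_zero (show A from dsumCoord _ v x))).mp this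
      have h7 : dsumIncl (fun v => (regularModule ℬ).shift (q v)) v (dsumCoord _ v x) =
          (show A from dsumCoord _ v x) • dsumIncl (fun v => (regularModule ℬ).shift (q v)) v
            (toShift ℬ (q v) 1) := by
        refine Eq.trans ?_ ((dsumIncl (fun v => (regularModule ℬ).shift (q v)) v).map_smul _ _)
        exact congrArg (dsumIncl (fun v => (regularModule ℬ).shift (q v)) v)
          (mul_one (show A from dsumCoord _ v x)).symm
      exact (congrArg (· ∈ augmentationIdeal ℬ • (⊤ : Submodule A (free ℬ q))) h7).mpr
        (Submodule.smul_mem_smul h6 Submodule.mem_top)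
    exact (congrArg (· ∈ augmentationIdeal ℬ • (⊤ : Submodule A (free ℬ q))) ht).mpr (sum_mem h5)

/-- Bounded below modules without extensions by modules killed by `𝔪` are projective. -/
theorem BoundedBelow.projective_of_ext {M : GrMod ℬ} {h₀ : ℤ} (hM : M.BoundedBelow h₀)
    (h : ∀ V : GrMod ℬ, (∀ a ∈ augmentationIdeal ℬ, ∀ v : V, a • v = 0) →
      Subsingleton (Ext M V 1)) : Projective M := by
  obtain ⟨F, π, hF, hF', hπ, hmin⟩ := hM.exists_minimal_cover hneg hz
  -- Let `K` be the kernel of the minimal cover `F → M`. As `Ext^1 (M, K / 𝔪 K) = 0`, the projection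
  -- `K → K / 𝔪 K` extends to `F`. The extension kills `𝔪 F`, which contains `K`, so `K = 𝔪 K` and
  -- Nakayama's lemma gives `K = 0`.
  have := h (ker π).cotop fun a ha v => smul_cotop _ ha v
  obtain ⟨x, hx⟩ := Ext.contravariant_sequence_exact₁ (shortExact_ker π hπ) (ker π).cotop
    (Ext.mk₀ (ker π).cotopπ) (add_zero 1)
    (Subsingleton.elim (α := Ext M (ker π).cotop 1) _ _)
  obtain ⟨g, rfl⟩ := Ext.homEquiv₀.symm.surjective x
  have hg : kerι π ≫ g = (ker π).cotopπ :=
    Ext.homEquiv₀.symm.injective ((Ext.mk₀_comp_mk₀ _ _).symm.trans hx)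
  have h0 : ∀ x : F, x ∈ augmentationIdeal ℬ • (⊤ : Submodule A F) → g.lin x = 0 := by
    intro x hx
    induction hx using Submodule.smul_induction_on' with
    | smul a ha y _ =>
      rw [map_smul]
      exact smul_cotop _ ha _
    | add x _ y _ hx hy => rw [map_add, hx, hy, add_zero]
  have hK := (hF'.of_injective (f := kerι π) Subtype.val_injective).eq_zero_of_top hneg fun x => by
    rw [← cotopπ_eq_zero, ← hg]
    exact h0 _ (hmin _ x.2)
  have : IsIso π := isIso_of_bijective ⟨(injective_iff_map_eq_zero _).2 fun x hx =>
    congrArg Subtype.val (hK ⟨x, hx⟩), hπ⟩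
  exact Projective.of_iso (asIso π) hF

theorem BoundedBelow.hasProjectiveDimensionLT_of_ext {M : GrMod ℬ} {h₀ : ℤ}
    (hM : M.BoundedBelow h₀) (m : ℕ) (h : ∀ V : GrMod ℬ,
      (∀ a ∈ augmentationIdeal ℬ, ∀ v : V, a • v = 0) → Subsingleton (Ext M V (m + 1))) :
    HasProjectiveDimensionLT M (m + 1) := by
  induction m generalizing M with
  | zero => exact projective_iff_hasProjectiveDimensionLT_one.1 (hM.projective_of_ext hneg hz h)
  | succ m ih =>
    obtain ⟨F, π, hF, hF', hπ, -⟩ := hM.exists_minimal_cover hneg hz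
    have hS := shortExact_ker π hπ
    refine (hS.hasProjectiveDimensionLT_X₃_iff m hF).2
      (ih (hF'.of_injective (f := kerι π) Subtype.val_injective) fun V hV => ?_)
    have := h V hV
    refine subsingleton_of_forall_eq 0 fun x => ?_
    obtain ⟨y, rfl⟩ := Ext.contravariant_sequence_exact₁ hS V x (add_comm 1 (m + 1))
      (Subsingleton.elim (α := Ext M V (m + 1 + 1)) _ _)
    have hF₂ : Projective (ShortComplex.mk (kerι π) π (kerι_comp π)).X₂ := hF
    rw [Ext.eq_zero_of_projective y, Ext.comp_zero]

/-- Quotients of shifts of `A` are bounded below, so their projective dimension is controlled by the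
modules killed by `𝔪`. By the dimension-shifted Baer criterion, these quotients control the
injective dimension of every module. -/
theorem hasInjectiveDimensionLT_of_forall (m : ℕ) (h : ∀ V : GrMod ℬ,
      (∀ a ∈ augmentationIdeal ℬ, ∀ v : V, a • v = 0) → HasInjectiveDimensionLT V (m + 1))
    (N : GrMod ℬ) : HasInjectiveDimensionLT N (m + 1) := by
  refine hasInjectiveDimensionLT_of_baer N m fun g X f _ => ?_
  have := ((boundedBelow_regular_shift hneg g).of_surjective (f := cokerπ f)
    (Submodule.mkQ_surjective _)).hasProjectiveDimensionLT_of_ext hneg hz m fun V hV =>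
      have := h V hV
      HasInjectiveDimensionLT.subsingleton V (m + 1) (m + 1) le_rfl _
  exact HasProjectiveDimensionLT.subsingleton _ (m + 1) (m + 1) le_rfl N

end Bounded

end GrMod

/-! ### Coarsenings and global dimension. -/

section Coarsening

variable {H : Type} [AddCommGroup H] [DecidableEq H]

open GrMod Abelian

namespace Coarsening

section Retract

variable [Nontrivial A] {𝒜 : G → Submodule k A} [GradedAlgebra 𝒜] {ℬ : H → Submodule k A}
  [GradedAlgebra ℬ] (c : Coarsening 𝒜 ℬ) (hpos : ∀ g, g ≠ 0 → c.φ g = 0 → 𝒜 g = ⊥) {σ : H → G}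
  (hσ : ∀ h, c.φ (σ h) = h) {V : GrMod ℬ} (hV : ∀ a ∈ augmentationIdeal ℬ, ∀ v : V, a • v = 0)

theorem sum_mem {N : GrMod ℬ} {g : G} {y : c.R.obj N} (hy : y ∈ (c.R.obj N).gr g) :
    c.sum N y ∈ N.gr (c.φ g) := by
  obtain ⟨x, rfl⟩ := c.exists_ι_eq hy
  rw [c.sum_ι]
  exact x.2

include hV in
theorem smul_P_R_eq_zero {h : H} (hh : h ≠ 0) {a : A} (ha : a ∈ ℬ h)
    (y : c.P.obj (c.R.obj V)) : a • y = 0 := by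
  refine c.induction (motive := fun a => a • y = 0) (zero_smul _ _) ?_
    (fun a b ha hb => by rw [add_smul, ha, hb, add_zero]) ha
  rintro i rfl a ha
  refine c.eval_ext fun g => (c.eval_smul (add_sub_cancel i g) ha y).trans ?_
  refine Eq.trans ?_ (map_zero (c.eval (c.R.obj V) g)).symm
  obtain ⟨x, hx⟩ := c.exists_ι_eq (c.eval_mem (g - i) y)
  rw [← hx, c.smul_ι (add_sub_cancel i g) ha]
  refine (congrArg (c.ι V g) (Subtype.ext ?_)).trans (map_zero _)
  exact hV a (mem_augmentationIdeal hh (c.le i ha)) x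

include hσ in
theorem sum_eval_mem (h : H) (y : c.prodSubmodule (c.R.obj V)) :
    c.sum V (c.eval (c.R.obj V) (σ h) y) ∈ V.gr h := by
  have := c.sum_mem (c.eval_mem (σ h) y)
  rwa [hσ] at this

/-- The component of degree `h` of the retraction in `retractPR`. -/
def sumEval (V : GrMod ℬ) (h : H) : (c.P.obj (c.R.obj V)).gr h →+ V.gr h :=
  AddMonoidHom.codRestrict (((c.sum V).toAddMonoidHom.comp (c.eval (c.R.obj V) (σ h))).comp
    (AddSubgroup.subtype (c.fibre (c.R.obj V) h))) (V.gr h) fun y => c.sum_eval_mem hσ h y.1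

/-- The retraction in `retractPR`. -/
def sumEvalHom : c.P.obj (c.R.obj V) ⟶ V :=
  GrMod.homMk (M := c.P.obj (c.R.obj V)) (c.sumEval hσ V) fun h g a ha y hy => by
    change c.sum V (c.eval (c.R.obj V) (σ (h + g)) (a • (show c.prodSubmodule (c.R.obj V) from y))) =
      a • c.sum V (c.eval (c.R.obj V) (σ g) y)
    -- The section `σ` need not be additive. This is harmless: in degree `0` the degree `σ g` does
    -- not move, and in any other degree both sides vanish because `V` is killed by `𝔪`.
    by_cases hh : h = 0
    · subst hh
      rw [c.eval_smul (by rw [zero_add, zero_add]) ((c.mem_zero_iff hpos).1 ha), map_smul]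
    · rw [hV a (mem_augmentationIdeal hh ha)]
      exact (congrArg (c.sum V) ((congrArg (c.eval (c.R.obj V) (σ (h + g)))
        (c.smul_P_R_eq_zero hV hh ha y)).trans (map_zero _))).trans (map_zero _)

theorem sumEvalHom_of_mem {h : H} {y : c.P.obj (c.R.obj V)} (hy : y ∈ (c.P.obj (c.R.obj V)).gr h) :
    (c.sumEvalHom hpos hσ hV).lin y = c.sum V (c.eval (c.R.obj V) (σ h) y) :=
  homMk_of_mem (M := c.P.obj (c.R.obj V)) (c.sumEval hσ V) _ hy

/-- A graded module killed by the augmentation ideal is a retract of a product. -/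
def retractPR : Retract V (c.P.obj (c.R.obj V)) where
  i := c.toP (𝟙 _)
  r := c.sumEvalHom hpos hσ hV
  retract := hom_ext_gr fun h x hx => by
    refine (c.sumEvalHom_of_mem hpos hσ hV ((c.toP (𝟙 _)).map_mem hx)).trans ?_
    refine (congrArg (c.sum V) (c.eval_toP (𝟙 _) x (σ h))).trans ((c.sum_ι _).trans ?_)
    change V.proj (c.φ (σ h)) x = x
    rw [hσ, V.proj_same hx]

end Retract

/-- Since `N` is a retract of `R U N`, the group `Ext (M, N)` embeds in `Ext (M, R U N) ≅ Ext (U M,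
U N)`. -/
theorem hasProjectiveDimensionLT_of_U {𝒜 : G → Submodule k A} [GradedAlgebra 𝒜]
    {ℬ : H → Submodule k A} [GradedAlgebra ℬ] (c : Coarsening 𝒜 ℬ) (M : GrMod 𝒜) (n : ℕ)
    [HasProjectiveDimensionLT (c.U.obj M) n] : HasProjectiveDimensionLT M n := by
  rw [hasProjectiveDimensionLT_iff]
  intro i hi N e
  have h : e.comp (Ext.mk₀ (c.retractRU N).i) (add_zero i) = 0 := by
    obtain ⟨x, hx⟩ := (adjExt_bijective c.adjUR M (c.U.obj N) i).2
      (e.comp (Ext.mk₀ (c.retractRU N).i) (add_zero i))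
    rw [← hx, x.eq_zero_of_hasProjectiveDimensionLT n hi, map_zero]
  have h' := congrArg (fun t => t.comp (Ext.mk₀ (c.retractRU N).r) (add_zero i)) h
  simpa using h'

/-- The fine bound holds for injective dimensions, and `P` transports it to `P R V`. If `V` is
killed by `𝔪`, it is a retract of `P R V` and inherits the bound, and such `V` control all coarse
modules. The case `n = 0` would force `A` to be zero. -/
theorem hasProjectiveDimensionLT_of_forall [Nontrivial A] {𝒜 : G → Submodule k A}
    [GradedAlgebra 𝒜] {ℬ : ℤ → Submodule k A} [GradedAlgebra ℬ] (c : Coarsening 𝒜 ℬ)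
    (hpos : ∀ g, g ≠ 0 → c.φ g = 0 → 𝒜 g = ⊥) {σ : ℤ → G} (hσ : ∀ h, c.φ (σ h) = h)
    (hneg : ∀ h < 0, ℬ h = ⊥) (hz : ∀ a ∈ ℬ 0, a ∈ Set.range (algebraMap k A)) (n : ℕ)
    (h : ∀ M : GrMod 𝒜, HasProjectiveDimensionLT M n) (M : GrMod ℬ) :
    HasProjectiveDimensionLT M n := by
  cases n with
  | zero =>
    have := isZero_of_hasProjectiveDimensionLT_zero (regularModule 𝒜)
    exact absurd (congr_lin ((IsZero.iff_id_eq_zero _).1 this) (show A from 1))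
      (one_ne_zero (α := A))
  | succ m =>
    have hinj : ∀ Y : GrMod 𝒜, HasInjectiveDimensionLT Y (m + 1) := fun Y => by
      rw [hasInjectiveDimensionLT_iff]
      exact fun i hi X e => e.eq_zero_of_hasProjectiveDimensionLT (m + 1) hi
    have key := hasInjectiveDimensionLT_of_forall hneg hz m fun V hV => by
      have := hinj (c.R.obj V)
      have := hasInjectiveDimensionLT_of_adj c.adjRP (c.R.obj V) (m + 1)
      exact (c.retractPR hpos hσ hV).hasInjectiveDimensionLT (m + 1)
    rw [hasProjectiveDimensionLT_iff]
    intro i hi N e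
    have := key N
    exact e.eq_zero_of_hasInjectiveDimensionLT (m + 1) hi

theorem gradedGlobalDimension_eq [Nontrivial A] {𝒜 : G → Submodule k A}
    [GradedAlgebra 𝒜] {ℬ : ℤ → Submodule k A} [GradedAlgebra ℬ] (c : Coarsening 𝒜 ℬ)
    (hpos : ∀ g, g ≠ 0 → c.φ g = 0 → 𝒜 g = ⊥) {σ : ℤ → G} (hσ : ∀ h, c.φ (σ h) = h)
    (hneg : ∀ h < 0, ℬ h = ⊥) (hz : ∀ a ∈ ℬ 0, a ∈ Set.range (algebraMap k A)) :
    gradedGlobalDimension ℬ = gradedGlobalDimension 𝒜 := by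
  refine le_antisymm (iSup_le fun M => ?_) (iSup_le fun M => ?_)
  · exact sInf_le fun i hi => c.hasProjectiveDimensionLT_of_forall hpos hσ hneg hz i (fun N =>
      projectiveDimension_lt_iff.1 ((le_iSup (fun N : GrMod 𝒜 => projectiveDimension N) N).trans_lt
        hi)) M
  · exact (projectiveDimension_le_of_forall fun n (_ : HasProjectiveDimensionLT (c.U.obj M) n) =>
      c.hasProjectiveDimensionLT_of_U M n).trans (le_iSup (fun M : GrMod ℬ => projectiveDimension M) _)

end Coarsening

end Coarsening

open GrMod

/-! ### One-sided Gorenstein conditions and noetherianity under twists. -/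

namespace TwistedIso

variable {B : Type u} [Ring B] [Algebra k B] {ℬ : G → Submodule k B} {𝒜 : G → Submodule k A}
  [GradedAlgebra ℬ] [GradedAlgebra 𝒜] (T : TwistedIso ℬ 𝒜)

include T in
theorem isLeftASGorensteinWith_iff {n : ℕ} {ℓ : G} :
    IsLeftASGorensteinWith ℬ n ℓ ↔ IsLeftASGorensteinWith 𝒜 n ℓ :=
  ⟨T.symm.isLeftASGorensteinWith, T.isLeftASGorensteinWith⟩

theorem coe_decompose (g h : G) (b : B) :
    (DirectSum.decompose 𝒜 (T.θ g b) h : A) = T.θ g (DirectSum.decompose ℬ b h) := by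
  induction b using GrMod.alg_induction ℬ with
  | zero => simp
  | add b b' hb hb' => simp only [map_add, DirectSum.decompose_add, DirectSum.add_apply,
      Submodule.coe_add, hb, hb']
  | homogeneous i b hb =>
    by_cases e : i = h
    · subst e
      rw [DirectSum.decompose_of_mem_same ℬ hb,
        DirectSum.decompose_of_mem_same 𝒜 ((T.mem_iff g).2 hb)]
    · rw [DirectSum.decompose_of_mem_ne ℬ hb e,
        DirectSum.decompose_of_mem_ne 𝒜 ((T.mem_iff g).2 hb) e, map_zero]

/-- The homogeneous left ideal corresponding to a homogeneous left ideal under a twist. -/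
def comap (I : Ideal A) (hI : I.IsHomogeneous 𝒜) : Ideal B where
  carrier := {b | T.θ 0 b ∈ I}
  zero_mem' := (congrArg (· ∈ I) (map_zero (T.θ 0))).mpr I.zero_mem
  add_mem' {b b'} hb hb' := (congrArg (· ∈ I) (map_add (T.θ 0) b b')).mpr (I.add_mem hb hb')
  smul_mem' b b' hb' := by
    classical
    change T.θ 0 (b * b') ∈ I
    -- On each component of `b'` the twist changes only the index of `θ` on the left factor, which
    -- does not matter for a left ideal.
    rw [← DirectSum.sum_support_decompose ℬ b', Finset.mul_sum, map_sum]
    refine sum_mem fun h _ => ?_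
    rw [T.map_mul 0 b (SetLike.coe_mem _), ← T.coe_decompose]
    exact I.mul_mem_left _ (hI h hb')

theorem _root_.Ideal.IsHomogeneous.exists_span_eq {I : Ideal A} (hI : I.IsHomogeneous 𝒜)
    (h : I.FG) : ∃ s : Finset A, (∀ a ∈ s, ∃ g, a ∈ 𝒜 g) ∧ Ideal.span (s : Set A) = I := by
  classical
  obtain ⟨t, rfl⟩ := h
  refine ⟨t.biUnion fun a => (DirectSum.decompose 𝒜 a).support.image
    fun g => (DirectSum.decompose 𝒜 a g : A), fun a ha => ?_, le_antisymm ?_ ?_⟩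
  · obtain ⟨b, -, hb⟩ := Finset.mem_biUnion.1 ha
    obtain ⟨g, -, rfl⟩ := Finset.mem_image.1 hb
    exact ⟨g, SetLike.coe_mem _⟩
  · refine Ideal.span_le.2 fun a ha => ?_
    obtain ⟨b, hb, hb'⟩ := Finset.mem_biUnion.1 ha
    obtain ⟨g, -, rfl⟩ := Finset.mem_image.1 hb'
    exact hI g (Ideal.subset_span hb)
  · refine Ideal.span_le.2 fun a ha => ?_
    rw [← DirectSum.sum_support_decompose 𝒜 a]
    refine sum_mem fun g hg => Ideal.subset_span ?_
    exact Finset.mem_biUnion.2 ⟨a, ha, Finset.mem_image_of_mem _ hg⟩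

include T in
-- `θ_0` matches homogeneous left ideals and carries homogeneous generators to generators. The
-- Cohen–Macaulay comparison is also applied to the twist, whose noetherianity is not among the
-- hypotheses.
theorem isGradedNoetherian (h : IsGradedNoetherian 𝒜) : IsGradedNoetherian ℬ := by
  classical
  intro I hI
  have hI' : (T.symm.comap I hI).IsHomogeneous 𝒜 := fun i a ha =>
    (congrArg (· ∈ I) (T.symm.coe_decompose 0 i a)).mp (hI i ha)
  obtain ⟨s, hs, hs'⟩ := hI'.exists_span_eq (h _ hI')
  refine ⟨s.image (T.symm.θ 0), le_antisymm (Ideal.span_le.2 fun b hb => ?_) fun b hb => ?_⟩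
  · obtain ⟨a, ha, rfl⟩ := Finset.mem_image.1 hb
    have : a ∈ T.symm.comap I hI := hs' ▸ Ideal.subset_span ha
    exact this
  · obtain ⟨a, rfl⟩ := (T.symm.θ 0).surjective b
    have ha : a ∈ Ideal.span (s : Set A) := hs' ▸ hb
    clear hb
    induction ha using Submodule.closure_induction with
    | zero => rw [map_zero]; exact zero_mem _
    | add x y _ _ hx hy => rw [map_add]; exact add_mem hx hy
    | smul_mem r x hx =>
      obtain ⟨g, hg⟩ := hs x hx
      rw [smul_eq_mul, T.symm.map_mul 0 r hg]
      exact Ideal.mul_mem_left _ _ (Ideal.subset_span (Finset.mem_image_of_mem _ hx))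

end TwistedIso

/-! ### Connected gradings and the total degree. -/

namespace IsConnectedGrading

variable {r : ℕ} {𝒜 : (Fin (r + 1) → ℤ) → Submodule k A}

theorem op (h : IsConnectedGrading 𝒜) : IsConnectedGrading (opGrading 𝒜) where
  support g hg := h.support g fun h0 => hg <| (Submodule.eq_bot_iff _).2 fun _ hx =>
    MulOpposite.unop_injective ((Submodule.mem_bot k).1 (h0 ▸ mem_opGrading.1 hx))
  algebraMap_injective _ _ hxy := h.algebraMap_injective (MulOpposite.op_injective hxy)
  zero_eq_range _ := mem_opGrading.trans ((h.zero_eq_range _).trans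
    ⟨fun ⟨x, hx⟩ => ⟨x, MulOpposite.unop_injective hx⟩, fun ⟨x, hx⟩ =>
      ⟨x, MulOpposite.op_injective hx⟩⟩)

theorem twist [GradedAlgebra 𝒜] (h : IsConnectedGrading 𝒜) (T : NormalizedLeftTwistingSystem 𝒜) :
    IsConnectedGrading T.twistGrading where
  support g hg := h.support g fun h0 => hg <| (Submodule.eq_bot_iff _).2 fun x hx =>
    (Submodule.mem_bot k).1 (show (show A from x) ∈ (⊥ : Submodule k A) from h0 ▸ hx)
  algebraMap_injective x y hxy := h.algebraMap_injective <| by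
    rw [Algebra.algebraMap_eq_smul_one, Algebra.algebraMap_eq_smul_one] at hxy ⊢
    exact hxy
  zero_eq_range a := by
    refine Iff.trans (h.zero_eq_range (show A from a)) (exists_congr fun x => ?_)
    rw [Algebra.algebraMap_eq_smul_one, Algebra.algebraMap_eq_smul_one]
    rfl

theorem nontrivial (h : IsConnectedGrading 𝒜) : Nontrivial A :=
  h.algebraMap_injective.nontrivial

theorem exists_mul_eq_one (h : IsConnectedGrading 𝒜) {a : A} (ha : a ∈ 𝒜 0) (ha0 : a ≠ 0) :
    ∃ b ∈ 𝒜 0, a * b = 1 := by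
  obtain ⟨c, rfl⟩ := (h.zero_eq_range a).1 ha
  refine ⟨algebraMap k A c⁻¹, (h.zero_eq_range _).2 ⟨_, rfl⟩, ?_⟩
  rw [← map_mul, mul_inv_cancel₀ (fun hc => ha0 (by rw [hc, map_zero])), map_one]

theorem nonneg (h : IsConnectedGrading 𝒜) {g : Fin (r + 1) → ℤ} {a : A} (ha : a ∈ 𝒜 g)
    (ha0 : a ≠ 0) : 0 ≤ g :=
  h.support g fun h0 => ha0 ((Submodule.mem_bot k).1 (h0 ▸ ha))

theorem eq_bot_of_sumHom_eq_zero (h : IsConnectedGrading 𝒜) (g : Fin (r + 1) → ℤ) (hg : g ≠ 0)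
    (hg' : sumHom r g = 0) : 𝒜 g = ⊥ := by
  by_contra h0
  refine hg (funext fun i => ?_)
  exact (Finset.sum_eq_zero_iff_of_nonneg (f := g) (s := Finset.univ)
    fun i _ => h.support g h0 i).1 hg' i (Finset.mem_univ i)

variable [GradedAlgebra 𝒜]

/-- Degrees of nonzero elements are nonnegative, so a nonzero product with a factor of nonzero
degree has nonzero degree. -/
theorem eq_zero_of_mem_augmentationIdeal (h : IsConnectedGrading 𝒜) {a : A} (ha : a ∈ 𝒜 0)
    (ha' : a ∈ augmentationIdeal 𝒜) : a = 0 := by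
  rw [← DirectSum.decompose_of_mem_same 𝒜 ha]
  refine augmentationIdeal_induction (motive := fun a => (DirectSum.decompose 𝒜 a 0 : A) = 0)
    (by simp) (fun a b ha hb => by simp [ha, hb]) ?_ ha'
  intro i j l a b c ha hb hc hj
  by_cases h0 : a * b * c = 0
  · simp [h0]
  refine DirectSum.decompose_of_mem_ne 𝒜
    (SetLike.GradedMul.mul_mem (SetLike.GradedMul.mul_mem ha hb) hc) fun e => hj ?_
  have hi := h.nonneg ha fun h => h0 (by rw [h, zero_mul, zero_mul])
  have hj := h.nonneg hb fun h => h0 (by rw [h, mul_zero, zero_mul])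
  have hl := h.nonneg hc fun h => h0 (by rw [h, mul_zero])
  refine le_antisymm (fun t => ?_) hj
  have := congrFun e t
  have h1 := hi t
  have h2 := hl t
  simp only [Pi.add_apply, Pi.zero_apply] at *
  linarith

variable {ℬ : ℤ → Submodule k A} [GradedAlgebra ℬ] (c : Coarsening 𝒜 ℬ) (hc : c.φ = sumHom r)

include hc

theorem eq_bot_of_φ_eq_zero (h : IsConnectedGrading 𝒜) (g : Fin (r + 1) → ℤ) (hg : g ≠ 0)
    (hg' : c.φ g = 0) : 𝒜 g = ⊥ := h.eq_bot_of_sumHom_eq_zero g hg (hc ▸ hg')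

/-- Nonnegative multidegrees of total degree `m` lie in the box between `0` and `(m, …, m)`. -/
theorem locallyFinite (h : IsConnectedGrading 𝒜) : c.LocallyFinite (regularModule 𝒜) := by
  intro m
  refine (Set.finite_Icc (0 : Fin (r + 1) → ℤ) fun _ => m).subset ?_
  rintro g ⟨hg, hg'⟩
  have h0 : ∀ i, 0 ≤ g i := h.support g fun h0 => hg' <|
    (AddSubgroup.eq_bot_iff_forall _).2 fun x (hx : (show A from x) ∈ 𝒜 g) =>
      (Submodule.mem_bot k (M := A)).1 (h0 ▸ hx)
  refine ⟨h0, fun i => ?_⟩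
  rw [hc] at hg
  rw [← hg]
  exact Finset.single_le_sum (f := g) (fun i _ => h0 i) (Finset.mem_univ i)

theorem φ_single (m : ℤ) : c.φ (Pi.single 0 m) = m := by
  rw [hc]
  exact (Finset.sum_pi_single' (0 : Fin (r + 1)) m Finset.univ).trans (if_pos (Finset.mem_univ _))

theorem isLeftASGorensteinWith_iff (h : IsConnectedGrading 𝒜) {n : ℕ} {L : ℤ} :
    IsLeftASGorensteinWith ℬ n L ↔ ∃ ℓ, sumHom r ℓ = L ∧ IsLeftASGorensteinWith 𝒜 n ℓ := by
  have := h.nontrivial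
  rw [← hc]
  exact c.isLeftASGorensteinWith_iff (h.locallyFinite c hc) (h.eq_bot_of_φ_eq_zero c hc)
    (fun _ => h.eq_zero_of_mem_augmentationIdeal) fun _ => h.exists_mul_eq_one

theorem gradedGlobalDimension_eq (h : IsConnectedGrading 𝒜) :
    gradedGlobalDimension ℬ = gradedGlobalDimension 𝒜 := by
  have := h.nontrivial
  refine c.gradedGlobalDimension_eq (h.eq_bot_of_φ_eq_zero c hc) (φ_single c hc)
    (fun m hm => (Submodule.eq_bot_iff _).2 fun x hx => ?_) fun a ha =>
      (h.zero_eq_range a).1 ((c.mem_zero_iff (h.eq_bot_of_φ_eq_zero c hc)).1 ha)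
  refine c.induction (motive := fun x => x = 0) rfl ?_
    (fun a b ha hb => by rw [ha, hb, add_zero]) hx
  rintro g rfl a ha
  by_contra ha0
  rw [hc] at hm
  exact hm.not_ge (Finset.sum_nonneg (f := g) (s := Finset.univ)
    fun i _ => h.nonneg ha ha0 i)

theorem isZero_localCohomology_iff (h : IsConnectedGrading 𝒜) (h𝒜 : IsGradedNoetherian 𝒜) (n : ℕ) :
    IsZero ((GrMod.localCohomology _ (augmentationIdeal_isHomogeneous ℬ) n).obj (regularModule ℬ)) ↔
      IsZero ((GrMod.localCohomology _ (augmentationIdeal_isHomogeneous 𝒜) n).obj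
        (regularModule 𝒜)) :=
  c.isZero_localCohomology_regularModule_iff h𝒜
    (c.augmentationIdeal_eq (h.eq_bot_of_φ_eq_zero c hc)) (fun m => ⟨_, φ_single c hc m⟩) n

end IsConnectedGrading

/-! ### Transfer of the total-degree properties through twists. -/

section Total

variable {r : ℕ} {𝒜 : (Fin (r + 1) → ℤ) → Submodule k A} [GradedAlgebra 𝒜]
  {B : Type u} [Ring B] [Algebra k B] {ℬ : (Fin (r + 1) → ℤ) → Submodule k B} [GradedAlgebra ℬ]

/-- The left and right shifts `ℓ` need only have the same total degree. This separated form is what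
twists preserve, one side at a time. -/
theorem IsConnectedGrading.isASGorenstein_totalGrading_iff (h : IsConnectedGrading 𝒜) :
    IsASGorenstein (totalGrading 𝒜) ↔ ∃ n L,
      (∃ ℓ, sumHom r ℓ = L ∧ IsLeftASGorensteinWith 𝒜 n ℓ) ∧
        ∃ ℓ, sumHom r ℓ = L ∧ IsLeftASGorensteinWith (opGrading 𝒜) n ℓ :=
  exists₂_congr fun _ _ => and_congr
    (h.isLeftASGorensteinWith_iff (Coarsening.regrade 𝒜 (sumHom r)) rfl)
    (h.op.isLeftASGorensteinWith_iff (Coarsening.regrade 𝒜 (sumHom r)).op rfl)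

theorem IsConnectedGrading.isASCohenMacaulay_totalGrading_iff (h : IsConnectedGrading 𝒜)
    (hl : IsGradedNoetherian 𝒜) (hr : IsGradedNoetherian (opGrading 𝒜)) :
    IsASCohenMacaulay (totalGrading 𝒜) ↔ IsASCohenMacaulay 𝒜 :=
  exists_congr fun _ => forall₂_congr fun i _ => and_congr
    (h.isZero_localCohomology_iff (Coarsening.regrade 𝒜 (sumHom r)) rfl hl i)
    (h.op.isZero_localCohomology_iff (Coarsening.regrade 𝒜 (sumHom r)).op rfl hr i)

theorem TwistedIso.isASGorenstein_totalGrading_iff (T : TwistedIso ℬ 𝒜)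
    (T' : TwistedIso (opGrading ℬ) (opGrading 𝒜)) (hA : IsConnectedGrading 𝒜)
    (hB : IsConnectedGrading ℬ) :
    IsASGorenstein (totalGrading 𝒜) ↔ IsASGorenstein (totalGrading ℬ) := by
  rw [hA.isASGorenstein_totalGrading_iff, hB.isASGorenstein_totalGrading_iff]
  simp only [T.isLeftASGorensteinWith_iff, T'.isLeftASGorensteinWith_iff]

theorem TwistedIso.isASRegular_totalGrading_iff (T : TwistedIso ℬ 𝒜)
    (T' : TwistedIso (opGrading ℬ) (opGrading 𝒜)) (hA : IsConnectedGrading 𝒜)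
    (hB : IsConnectedGrading ℬ) :
    IsASRegular (totalGrading 𝒜) ↔ IsASRegular (totalGrading ℬ) := by
  refine and_congr (T.isASGorenstein_totalGrading_iff T' hA hB) (exists_congr fun d => ?_)
  rw [hA.gradedGlobalDimension_eq (Coarsening.regrade 𝒜 (sumHom r)) rfl,
    hB.gradedGlobalDimension_eq (Coarsening.regrade ℬ (sumHom r)) rfl,
    hA.op.gradedGlobalDimension_eq (Coarsening.regrade 𝒜 (sumHom r)).op rfl,
    hB.op.gradedGlobalDimension_eq (Coarsening.regrade ℬ (sumHom r)).op rfl,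
    T.gradedGlobalDimension_eq, T'.gradedGlobalDimension_eq]

theorem TwistedIso.isASCohenMacaulay_totalGrading_iff (T : TwistedIso ℬ 𝒜)
    (T' : TwistedIso (opGrading ℬ) (opGrading 𝒜)) (hA : IsConnectedGrading 𝒜)
    (hB : IsConnectedGrading ℬ) (hl : IsGradedNoetherian 𝒜)
    (hr : IsGradedNoetherian (opGrading 𝒜)) :
    IsASCohenMacaulay (totalGrading 𝒜) ↔ IsASCohenMacaulay (totalGrading ℬ) := by
  rw [hA.isASCohenMacaulay_totalGrading_iff hl hr, hB.isASCohenMacaulay_totalGrading_iff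
    (T.isGradedNoetherian hl) (T'.isGradedNoetherian hr), T.isASCohenMacaulay_iff T']

end Total

end

theorem mainTheorem1 {r : ℕ} {k : Type v} [Field k] {A : Type u} [Ring A] [Algebra k A]
    (𝒜 : (Fin (r + 1) → ℤ) → Submodule k A) [GradedAlgebra 𝒜]
    (hconn : IsConnectedGrading 𝒜)
    (hleft : IsNoetherianRing A) (hright : IsNoetherianRing Aᵐᵒᵖ)
    (T : NormalizedLeftTwistingSystem 𝒜) :
    ((IsASCohenMacaulay (totalGrading 𝒜) ↔ IsASCohenMacaulay (totalGrading T.twistGrading)) ∧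
      (IsASGorenstein (totalGrading 𝒜) ↔ IsASGorenstein (totalGrading T.twistGrading)) ∧
      (IsASRegular (totalGrading 𝒜) ↔ IsASRegular (totalGrading T.twistGrading))) ∧
    ((IsASCohenMacaulay 𝒜 ↔ IsASCohenMacaulay T.twistGrading) ∧
      (IsASGorenstein 𝒜 ↔ IsASGorenstein T.twistGrading) ∧
      (IsASRegular 𝒜 ↔ IsASRegular T.twistGrading)) := by
  have hl : IsGradedNoetherian 𝒜 := fun I _ => IsNoetherian.noetherian I
  have hr : IsGradedNoetherian (opGrading 𝒜) := fun I _ => IsNoetherian.noetherian I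
  exact ⟨⟨T.twistedIso.isASCohenMacaulay_totalGrading_iff T.opTwistedIso hconn (hconn.twist T) hl hr,
    T.twistedIso.isASGorenstein_totalGrading_iff T.opTwistedIso hconn (hconn.twist T),
    T.twistedIso.isASRegular_totalGrading_iff T.opTwistedIso hconn (hconn.twist T)⟩,
    T.isASCohenMacaulay_iff, T.isASGorenstein_iff, T.isASRegular_iff⟩
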